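/- Let $N>2$, let $\Omega\subset\mathbb R^N$ be a smooth bounded domain, let $1<q+1<2<p+1<2^*=\frac{2N}{N-2}$, and let $\phi:[0,+\infty)\to\mathbb R$ be of class $C^2$. Put $\Phi(s)=\int_0^s\phi(\tau)\,d\tau$. Assume that there are constants $\rho_0,\dots,\rho_6$ and $\phi(\infty)$ such that for all $s\ge 0$: - $(\phi_1)$ $0<\rho_0\le\rho_1$, $\max\{\frac{q+1}{2},\frac{2}{p+1}\}\rho_1<\rho_0\le\phi(s)\le\rho_1$; - $(\phi_2)$ $\rho_2>0$ and $|\phi'(s)|s+|\phi''(s)|s^2\le\rho_2$; - $(\phi_3)$ $0<\rho_3\le(1-q)\phi(s)+2\phi'(s)s\le\rho_4$; - $(\phi_4)$ $\rho_5>0$ and $\rho_5+2\phi'(s)s\le(p-1)\phi(s)$; - $(\phi_5)$ $\rho_6>0$ and $(1-q)(1-p)\phi(s)+2(4-p-q)\phi'(s)s+4\phi''(s)s^2\le-\rho_6$; - $(\phi_6)$ $t\mapsto\Phi(t^2)$ is strictly convex on $[0,+\infty)$; - $(\phi_7)$ $\phi(\infty)>0$ and $\phi(s)\to\phi(\infty)$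 as $s\to+\infty$; and that - $(H)$ $a,b:\Omega\to\mathbb R$ are continuous, belong to $L^\infty(\Omega)$, and each takes both a positive and a negative value on $\Omega$. $H^1_0(\Omega)$ is the closure of $C_0^\infty(\Omega)$ in $W^{1,2}(\Omega)$. For $1<r<2^*$ let $S_r$ be the best constant in $\|u\|_r\le S_r\|\nabla u\|_2$, $u\in H^1_0(\Omega)$. For $\lambda>0$ and $u,v\in H_0^1(\Omega)$ let $$J_\lambda(u)=\int_\Omega\Phi\Big(\frac{u^2+|\nabla u|^2}{2}\Big)dx-\frac{\lambda}{q+1}\int_\Omega a|u|^{q+1}dx-\frac1{p+1}\int_\Omega b|u|^{p+1}dx,$$ $$\langle J_\lambda'(u),v\rangle=\int_\Omega\phi\Big(\frac{u^2+|\nabla u|^2}{2}\Big)(uv+\nabla u\cdot\nabla v)\,dx-\lambda\int_\Omega a|u|^{q-1}uv\,dx-\int_\Omega b|u|^{p-1}uv\,dx.$$ A weak solution of $$-\operatorname{div}\Big\{\phi\Big(\frac{u^2+|\nabla u|^2}{2}\Big)\nabla u\Big\}+\phi\Big(\frac{u^2+|\nabla u|^2}{2}\Big)u=\lambda a|u|^{q-1}u+b|u|^{p-1}u\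 \text{ in }\Omega,\qquad u=0\ \text{ on }\partial\Omega\qquad(\ast)$$ is a $u\in H^1_0(\Omega)$ with $\langle J_\lambda'(u),v\rangle=0$ for all $v\in H^1_0(\Omega)$; it is a ground state if it is nontrivial and has the least energy $J_\lambda$ among all nontrivial weak solutions. Put $N_\lambda=\{u\in H^1_0(\Omega)\setminus\{0\}:\langle J_\lambda'(u),u\rangle=0\}$, $\gamma_u(t)=J_\lambda(tu)$, and $N_\lambda^{\pm}=\{u\in N_\lambda:\pm\gamma_u''(1)>0\}$. Define $$\lambda_1=\frac{\rho_5}{(p-q)\|a\|_\infty S_{q+1}^{q+1}}\Big(\frac{\rho_3}{(p-q)\|b\|_\infty S_{p+1}^{p+1}}\Big)^{\frac{1-q}{p-1}},\qquad \lambda_2=\frac{\delta^{1-\frac{q+1}{2}}}{c_1},$$ $$c_1=\frac{\|a\|_\infty S_{q+1}^{q+1}}{(q+1)\big(\frac{\rho_0}{2}-\frac{\rho_1}{p+1}\big)^{\frac{q+1}{2}}},\qquad \delta=\Big(\frac{\rho_0}{2}-\frac{\rho_1}{p+1}\Big)\Big(\frac{\rho_0}{\|b\|_\infty S_{p+1}^{p+1}}\Big)^{\frac{2}{p-1}}.$$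 Then for every $\lambda$ with $0<\lambda<\lambda_0=\min\{\lambda_1,\lambda_2\}$, problem $(\ast)$ has at least two nontrivial weak solutions $u_0,\tilde u_0\in H^1_0(\Omega)$ such that - $J_\lambda(u_0)>0$, $u_0\in N_\lambda^-$ and $J_\lambda(u_0)=\min_{N_\lambda^-}J_\lambda$; - $J_\lambda(\tilde u_0)<0$, $\tilde u_0\in N_\lambda^+$, $J_\lambda(\tilde u_0)=\min_{N_\lambda^+}J_\lambda$, and $\tilde u_0$ is a ground state of $(\ast)$. -/

import Mathlib

open MeasureTheory Set Filter Topology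
open scoped NNReal ENNReal ContDiff

noncomputable section

namespace Stuart

/-- Euclidean space of dimension `N`. -/
abbrev Eucl (N : ℕ) : Type := EuclideanSpace ℝ (Fin N)

variable {N : ℕ}

/-- Lebesgue measure on `Ω`. -/
abbrev vol (Ω : Set (Eucl N)) : Measure (Eucl N) := volume.restrict Ω

/-- A smooth bounded domain: open, connected (in particular non-empty), bounded, and near each
boundary point the sublevel set of a smooth function with non-vanishing differential. -/
structure IsSmoothBoundedDomain (Ω : Set (Eucl N)) : Prop where
  isOpen : IsOpen Ω
  isConnected : IsConnected Ω
  isBounded : Bornology.IsBounded Ω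
  smooth_boundary : ∀ x₀ ∈ frontier Ω, ∃ (U : Set (Eucl N)) (r : Eucl N → ℝ),
    IsOpen U ∧ x₀ ∈ U ∧ ContDiffOn ℝ ∞ r U ∧ fderiv ℝ r x₀ ≠ 0 ∧
      ∀ x ∈ U, (x ∈ Ω ↔ r x < 0)

/-- `C₀^∞(Ω)`: smooth functions whose support is compact and contained in `Ω`. -/
structure IsTestFunction (Ω : Set (Eucl N)) (ψ : Eucl N → ℝ) : Prop where
  contDiff : ContDiff ℝ ∞ ψ
  hasCompactSupport : HasCompactSupport ψ
  tsupport_subset : tsupport ψ ⊆ Ω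

/-- `∂ψ/∂xᵢ`. -/
def partialDeriv (i : Fin N) (ψ : Eucl N → ℝ) (x : Eucl N) : ℝ :=
  fderiv ℝ ψ x (EuclideanSpace.single i 1)

/-- `G` is the weak gradient of `u` on `Ω`. -/
def HasWeakGradient (Ω : Set (Eucl N)) (u : Eucl N → ℝ) (G : Eucl N → Eucl N) : Prop :=
  ∀ ψ, IsTestFunction Ω ψ → ∀ i : Fin N,
    ∫ x in Ω, u x * partialDeriv i ψ x = -∫ x in Ω, G x i * ψ x

theorem IsTestFunction.memLp {Ω : Set (Eucl N)} {ψ : Eucl N → ℝ} (h : IsTestFunction Ω ψ) :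
    MemLp ψ 2 (vol Ω) :=
  (h.contDiff.continuous.memLp_of_hasCompactSupport h.hasCompactSupport).restrict Ω

theorem IsTestFunction.memLp_partialDeriv {Ω : Set (Eucl N)} {ψ : Eucl N → ℝ}
    (h : IsTestFunction Ω ψ) (i : Fin N) : MemLp (partialDeriv i ψ) 2 (vol Ω) := by
  have hc : Continuous (partialDeriv i ψ) :=
    (h.contDiff.continuous_fderiv (by simp)).clm_apply continuous_const
  have hs : HasCompactSupport (partialDeriv i ψ) :=
    (h.hasCompactSupport.fderiv (𝕜 := ℝ)).comp_left
      (g := fun L : Eucl N →L[ℝ] ℝ => L (EuclideanSpace.single i 1)) (by simp)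
  exact (hc.memLp_of_hasCompactSupport hs).restrict Ω

theorem memLp_coord {Ω : Set (Eucl N)} {G : Eucl N → Eucl N} (h : MemLp G 2 (vol Ω))
    (i : Fin N) : MemLp (fun x => G x i) 2 (vol Ω) :=
  (EuclideanSpace.proj i : Eucl N →L[ℝ] ℝ).comp_memLp' h

/-- `W^{1,2}(Ω)`, each function being stored together with its weak gradient (which it determines
almost everywhere); the topology is that of `L² × L²`, i.e. that of the `W^{1,2}` norm. -/
def W12 (Ω : Set (Eucl N)) : Submodule ℝ (Lp ℝ 2 (vol Ω) × Lp (Eucl N) 2 (vol Ω)) where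
  carrier := {U | HasWeakGradient Ω U.1 U.2}
  zero_mem' := by
    intro ψ _ i
    have h1 : ∫ x in Ω, (0 : Lp ℝ 2 (vol Ω)) x * partialDeriv i ψ x = ∫ _ in Ω, (0 : ℝ) := by
      apply integral_congr_ae
      filter_upwards [Lp.coeFn_zero ℝ 2 (vol Ω)] with x hx
      rw [hx, Pi.zero_apply, zero_mul]
    have h2 : ∫ x in Ω, (0 : Lp (Eucl N) 2 (vol Ω)) x i * ψ x = ∫ _ in Ω, (0 : ℝ) := by
      apply integral_congr_ae
      filter_upwards [Lp.coeFn_zero (Eucl N) 2 (vol Ω)] with x hx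
      rw [hx, Pi.zero_apply, PiLp.zero_apply, zero_mul]
    change ∫ x in Ω, (0 : Lp ℝ 2 (vol Ω)) x * partialDeriv i ψ x
      = -∫ x in Ω, (0 : Lp (Eucl N) 2 (vol Ω)) x i * ψ x
    rw [h1, h2]
    simp
  add_mem' := by
    intro U V hU hV ψ hψ i
    have h1 : ∫ x in Ω, (U.1 + V.1 : Lp ℝ 2 (vol Ω)) x * partialDeriv i ψ x
        = ∫ x in Ω, (U.1 x * partialDeriv i ψ x + V.1 x * partialDeriv i ψ x) := by
      apply integral_congr_ae
      filter_upwards [Lp.coeFn_add U.1 V.1] with x hx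
      simp only [hx, Pi.add_apply]
      ring
    have h2 : ∫ x in Ω, (U.2 + V.2 : Lp (Eucl N) 2 (vol Ω)) x i * ψ x
        = ∫ x in Ω, (U.2 x i * ψ x + V.2 x i * ψ x) := by
      apply integral_congr_ae
      filter_upwards [Lp.coeFn_add U.2 V.2] with x hx
      simp only [hx, Pi.add_apply, PiLp.add_apply]
      ring
    change ∫ x in Ω, (U.1 + V.1 : Lp ℝ 2 (vol Ω)) x * partialDeriv i ψ x
      = -∫ x in Ω, (U.2 + V.2 : Lp (Eucl N) 2 (vol Ω)) x i * ψ x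
    have hd := hψ.memLp_partialDeriv i
    have hm := hψ.memLp
    have e1 := integral_add (μ := vol Ω) (f := fun x => U.1 x * partialDeriv i ψ x)
      (g := fun x => V.1 x * partialDeriv i ψ x)
      ((Lp.memLp U.1).integrable_mul hd) ((Lp.memLp V.1).integrable_mul hd)
    have e2 := integral_add (μ := vol Ω) (f := fun x => U.2 x i * ψ x)
      (g := fun x => V.2 x i * ψ x)
      ((memLp_coord (Lp.memLp U.2) i).integrable_mul hm)
      ((memLp_coord (Lp.memLp V.2) i).integrable_mul hm)
    rw [h1, h2, e1, e2, hU ψ hψ i, hV ψ hψ i]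
    ring
  smul_mem' := by
    intro c U hU ψ hψ i
    have h1 : ∫ x in Ω, (c • U.1 : Lp ℝ 2 (vol Ω)) x * partialDeriv i ψ x
        = ∫ x in Ω, c * (U.1 x * partialDeriv i ψ x) := by
      apply integral_congr_ae
      filter_upwards [Lp.coeFn_smul c U.1] with x hx
      simp only [hx, Pi.smul_apply, smul_eq_mul]
      ring
    have h2 : ∫ x in Ω, (c • U.2 : Lp (Eucl N) 2 (vol Ω)) x i * ψ x
        = ∫ x in Ω, c * (U.2 x i * ψ x) := by
      apply integral_congr_ae
      filter_upwards [Lp.coeFn_smul c U.2] with x hx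
      simp only [hx, Pi.smul_apply, PiLp.smul_apply, smul_eq_mul]
      ring
    change ∫ x in Ω, (c • U.1 : Lp ℝ 2 (vol Ω)) x * partialDeriv i ψ x
      = -∫ x in Ω, (c • U.2 : Lp (Eucl N) 2 (vol Ω)) x i * ψ x
    rw [h1, h2, integral_const_mul, integral_const_mul, hU ψ hψ i]
    ring

/-- `C₀^∞(Ω)` as a subspace of `W^{1,2}(Ω)`. -/
def testSubspace (Ω : Set (Eucl N)) : Submodule ℝ (W12 Ω) where
  carrier := {U | ∃ ψ, IsTestFunction Ω ψ ∧ U.1.1 =ᵐ[vol Ω] ψ ∧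
    U.1.2 =ᵐ[vol Ω] fun x => gradient ψ x}
  zero_mem' := by
    refine ⟨fun _ => 0, ⟨contDiff_const, HasCompactSupport.zero, ?_⟩, ?_, ?_⟩
    · have : tsupport (fun _ : Eucl N => (0 : ℝ)) = ∅ := tsupport_eq_empty_iff.2 rfl
      simp [this]
    · exact Lp.coeFn_zero ℝ 2 (vol Ω)
    · filter_upwards [Lp.coeFn_zero (Eucl N) 2 (vol Ω)] with x hx
      change (0 : Lp (Eucl N) 2 (vol Ω)) x = _
      rw [hx]
      simp [gradient]
  add_mem' := by
    rintro U V ⟨f, hf, hf1, hf2⟩ ⟨g, hg, hg1, hg2⟩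
    refine ⟨f + g, ⟨hf.contDiff.add hg.contDiff, hf.hasCompactSupport.add hg.hasCompactSupport,
      (tsupport_add f g).trans (union_subset hf.tsupport_subset hg.tsupport_subset)⟩, ?_, ?_⟩
    · filter_upwards [Lp.coeFn_add U.1.1 V.1.1, hf1, hg1] with x hx h1 h2
      change (U.1.1 + V.1.1 : Lp ℝ 2 (vol Ω)) x = _
      rw [hx, Pi.add_apply, Pi.add_apply, h1, h2]
    · filter_upwards [Lp.coeFn_add U.1.2 V.1.2, hf2, hg2] with x hx h1 h2
      change (U.1.2 + V.1.2 : Lp (Eucl N) 2 (vol Ω)) x = _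
      rw [hx, Pi.add_apply, h1, h2]
      simp only [gradient]
      rw [fderiv_add (hf.contDiff.differentiable (by simp) x)
        (hg.contDiff.differentiable (by simp) x), map_add]
  smul_mem' := by
    rintro c U ⟨f, hf, hf1, hf2⟩
    refine ⟨c • f, ⟨contDiff_const.smul hf.contDiff, hf.hasCompactSupport.smul_left,
      (closure_mono (Function.support_const_smul_subset c f)).trans hf.tsupport_subset⟩, ?_, ?_⟩
    · filter_upwards [Lp.coeFn_smul c U.1.1, hf1] with x hx h1
      change (c • U.1.1 : Lp ℝ 2 (vol Ω)) x = _
      rw [hx, Pi.smul_apply, Pi.smul_apply, h1]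
    · filter_upwards [Lp.coeFn_smul c U.1.2, hf2] with x hx h1
      change (c • U.1.2 : Lp (Eucl N) 2 (vol Ω)) x = _
      rw [hx, Pi.smul_apply, h1]
      simp only [gradient]
      rw [fderiv_const_smul (hf.contDiff.differentiable (by simp) x), map_smul]

/-- `H₀¹(Ω)`: the closure of `C₀^∞(Ω)` in `W^{1,2}(Ω)`. -/
def H10 (Ω : Set (Eucl N)) : Submodule ℝ (W12 Ω) := (testSubspace Ω).topologicalClosure

/-- The function underlying an element of `H₀¹(Ω)`. -/
def fn {Ω : Set (Eucl N)} (u : H10 Ω) : Lp ℝ 2 (vol Ω) := u.1.1.1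

/-- The weak gradient `∇u`. -/
def grad {Ω : Set (Eucl N)} (u : H10 Ω) : Lp (Eucl N) 2 (vol Ω) := u.1.1.2

/-- `‖a‖_∞` on `Ω`. -/
def supNorm (Ω : Set (Eucl N)) (a : Eucl N → ℝ) : ℝ := (eLpNorm a ∞ (vol Ω)).toReal

/-- `S_r`: the least `C ≥ 0` such that `‖u‖_r ≤ C ‖∇u‖₂` for all `u ∈ H₀¹(Ω)`. -/
def sobolevConst (Ω : Set (Eucl N)) (r : ℝ) : ℝ :=
  ((sInf {C : ℝ≥0 | ∀ u : H10 Ω, eLpNorm (fn u) (ENNReal.ofReal r) (vol Ω) ≤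
    C * eLpNorm (grad u) 2 (vol Ω)} : ℝ≥0) : ℝ)

/-- `a` changes sign on `Ω`. -/
def SignChanging (Ω : Set (Eucl N)) (a : Eucl N → ℝ) : Prop :=
  (∃ x ∈ Ω, 0 < a x) ∧ ∃ x ∈ Ω, a x < 0

/-- `Φ(s) = ∫₀ˢ φ(τ) dτ`. -/
def primitive (φ : ℝ → ℝ) (s : ℝ) : ℝ := ∫ τ in (0 : ℝ)..s, φ τ

/-- `φ'` on `[0, ∞)` (one-sided at `0`). -/
def dphi (φ : ℝ → ℝ) (s : ℝ) : ℝ := derivWithin φ (Ici 0) s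

/-- `φ''` on `[0, ∞)` (one-sided at `0`). -/
def ddphi (φ : ℝ → ℝ) (s : ℝ) : ℝ := iteratedDerivWithin 2 φ (Ici 0) s

section Functional

variable {Ω : Set (Eucl N)} (φ : ℝ → ℝ) (p q : ℝ) (a b : Eucl N → ℝ) (lam : ℝ)

/-- The density `(u² + |∇u|²) / 2`. -/
def dens (u : H10 Ω) (x : Eucl N) : ℝ := ((fn u x) ^ 2 + ‖grad u x‖ ^ 2) / 2

/-- The energy functional `J_λ`. -/
def J (u : H10 Ω) : ℝ :=
  (∫ x in Ω, primitive φ (dens u x))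
    - lam / (q + 1) * (∫ x in Ω, a x * |fn u x| ^ (q + 1))
    - 1 / (p + 1) * ∫ x in Ω, b x * |fn u x| ^ (p + 1)

/-- `⟨J_λ'(u), v⟩`: the weak form of the equation at `u`, tested with `v`. -/
def dJ (u v : H10 Ω) : ℝ :=
  (∫ x in Ω, φ (dens u x) * (fn u x * fn v x + inner ℝ (grad u x) (grad v x)))
    - lam * (∫ x in Ω, a x * (|fn u x| ^ (q - 1) * fn u x * fn v x))
    - ∫ x in Ω, b x * (|fn u x| ^ (p - 1) * fn u x * fn v x)

/-- `u ∈ H₀¹(Ω)` is a nontrivial weak solution of the Dirichlet problem. -/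
def IsNontrivialWeakSolution (u : H10 Ω) : Prop :=
  fn u ≠ 0 ∧ ∀ v : H10 Ω, dJ φ p q a b lam u v = 0

/-- A ground state: a nontrivial weak solution of least energy among all of them. -/
def IsGroundState (u : H10 Ω) : Prop :=
  IsNontrivialWeakSolution φ p q a b lam u ∧
    ∀ w : H10 Ω, IsNontrivialWeakSolution φ p q a b lam w →
      J φ p q a b lam u ≤ J φ p q a b lam w

/-- The Nehari manifold `N_λ`. -/
def nehari (Ω : Set (Eucl N)) : Set (H10 Ω) := {u | fn u ≠ 0 ∧ dJ φ p q a b lam u u = 0}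

/-- The fibering map `γ_u(t) = J_λ(tu)`. -/
def fiber (u : H10 Ω) (t : ℝ) : ℝ := J φ p q a b lam (t • u)

/-- `N_λ⁺ = {u ∈ N_λ : γ_u''(1) > 0}`. -/
def nehariPlus (Ω : Set (Eucl N)) : Set (H10 Ω) :=
  {u ∈ nehari φ p q a b lam Ω | 0 < iteratedDeriv 2 (fiber φ p q a b lam u) 1}

/-- `N_λ⁻ = {u ∈ N_λ : γ_u''(1) < 0}`. -/
def nehariMinus (Ω : Set (Eucl N)) : Set (H10 Ω) :=
  {u ∈ nehari φ p q a b lam Ω | iteratedDeriv 2 (fiber φ p q a b lam u) 1 < 0}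

end Functional

section Constants

variable (Ω : Set (Eucl N)) (p q : ℝ) (a b : Eucl N → ℝ)

/-- The threshold `λ₁`. -/
def lambda1 (ρ₃ ρ₅ : ℝ) : ℝ :=
  ρ₅ / ((p - q) * supNorm Ω a * sobolevConst Ω (q + 1) ^ (q + 1)) *
    (ρ₃ / ((p - q) * supNorm Ω b * sobolevConst Ω (p + 1) ^ (p + 1))) ^ ((1 - q) / (p - 1))

/-- The constant `c₁`. -/
def c1 (ρ₀ ρ₁ : ℝ) : ℝ :=
  supNorm Ω a * sobolevConst Ω (q + 1) ^ (q + 1) /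
    ((q + 1) * (ρ₀ / 2 - ρ₁ / (p + 1)) ^ ((q + 1) / 2))

/-- The constant `δ`. -/
def deltaConst (ρ₀ ρ₁ : ℝ) : ℝ :=
  (ρ₀ / 2 - ρ₁ / (p + 1)) *
    (ρ₀ / (supNorm Ω b * sobolevConst Ω (p + 1) ^ (p + 1))) ^ (2 / (p - 1))

/-- The threshold `λ₂`. -/
def lambda2 (ρ₀ ρ₁ : ℝ) : ℝ :=
  deltaConst Ω p b ρ₀ ρ₁ ^ (1 - (q + 1) / 2) / c1 Ω p q a ρ₀ ρ₁

end Constants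

end Stuart

end

open Stuart

/-! The proof studies the fibering maps γ_u(t) = J(tu). The derivative of t^{-q} γ_u'(t) is t^{-q}
D_u(t) with D_u = `rayDisc`. The structural hypothesis `hφ5` makes t^{1-p} D_u(t) nonincreasing, so
once D_u is negative it stays negative to the right, and once positive it is positive to the left
(`rayDisc_neg_of_le`, `rayDisc_pos_of_le`). At a zero of γ_u' the number γ_u'' equals D_u, so this
controls the shape of γ_u around points of N⁺ and N⁻.

The two bounds on λ play separate roles. If λ < λ₁, no point of the Nehari set has γ_u''(1) = 0
(`iteratedDeriv_two_ne_zero`): vanishing would force ‖∇u‖ to be both large and small. If λ < λ₂, J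
is positive on the sphere ‖∇u‖ = R, R = `barrierRadius` (`J_pos_of_sphere`). Hence N⁺ lies strictly
inside the ball of radius R (`grad_lt_of_nehariPlus`), while each u in N⁻ has J(u) > 0 and maximizes
J on its ray (`nehariMinus_maximal`).

The solution of negative energy minimizes J on that ball. The minimum is negative, hence interior,
hence a critical point; it is a local minimum on its own ray, so it lies in N⁺. It is minimal on N⁺
because N⁺ is inside the ball, and it is a ground state because the rest of the Nehari set has
positive energy.

The solution of positive energy minimizes J on N⁻. Minimizing sequences are bounded by coercivity,
and ∫ b|u|^{p+1} stays away from 0 on N⁻, so the ray through a weak limit w meets N⁻ at some tw.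
With lower semicontinuity, J(tw) ≤ lim J(tu_n) ≤ lim J(u_n), the limits read as upper bounds along
the sequence. Criticality needs no Lagrange multiplier: if J decreased at the minimizer u in a
direction v, some t(u + sv) in N⁻ with t near 1 would satisfy J(t(u + sv)) < J(tu) ≤ J(u)
(`dJ_nonneg_of_nehariMinus_minimizer`).

Lower semicontinuity is obtained from closed convex sublevel sets, together with Rellich's theorem
and interpolation for the power terms (`exists_limit`). Since φ is given only on [0, ∞), the
argument runs with its constant extension to the line. -/

namespace Stuart

/-! ### Weighted power integrals: integrability, derivative along lines, continuity. -/

section Powers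

theorem abs_rpow_sub_two_mul_abs {r : ℝ} (hr : 1 < r) (w : ℝ) :
    |w| ^ (r - 2) * |w| = |w| ^ (r - 1) := by
  rcases eq_or_ne w 0 with rfl | hw
  · simp [Real.zero_rpow (by linarith : r - 1 ≠ 0)]
  · have h : 0 < |w| := abs_pos.2 hw
    rw [← Real.rpow_add_one h.ne']
    congr 1
    ring

/-- For r < 2 the factor |w|^{r-2} is singular at 0, so continuity is read off from the form
(w⁺)^{r-1} − (w⁻)^{r-1}, whose exponent is positive. -/
theorem continuous_abs_rpow_sub_two_mul {r : ℝ} (hr : 1 < r) :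
    Continuous fun w : ℝ => |w| ^ (r - 2) * w := by
  have h : (fun w : ℝ => |w| ^ (r - 2) * w) =
      fun w => max w 0 ^ (r - 1) - max (-w) 0 ^ (r - 1) := by
    funext w
    have h0 : (0 : ℝ) ^ (r - 1) = 0 := Real.zero_rpow (by linarith)
    have h1 := abs_rpow_sub_two_mul_abs hr w
    rcases le_total 0 w with hw | hw
    · rw [abs_of_nonneg hw] at h1 ⊢
      rw [max_eq_left hw, max_eq_right (by linarith), h0, h1, sub_zero]
    · rw [abs_of_nonpos hw] at h1 ⊢
      rw [max_eq_right hw, max_eq_left (by linarith), h0, ← h1]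
      ring
  rw [h]
  have hc : ∀ w : ℝ, max w 0 ≠ 0 ∨ 0 ≤ r - 1 := fun _ => Or.inr (by linarith)
  exact ((continuous_id.max continuous_const).rpow_const hc).sub
    ((continuous_neg.max continuous_const).rpow_const fun w => hc (-w))

variable {α : Type*} [MeasurableSpace α] {μ : Measure α}

theorem ae_abs_le_of_memLp_top {a : α → ℝ} (ha : MemLp a ∞ μ) :
    ∀ᵐ x ∂μ, |a x| ≤ (eLpNorm a ∞ μ).toReal := by
  filter_upwards [ae_le_eLpNormEssSup (f := a) (μ := μ)] with x hx
  have h := ENNReal.toReal_mono ha.eLpNorm_ne_top (hx.trans_eq eLpNorm_exponent_top.symm)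
  rwa [toReal_enorm, Real.norm_eq_abs] at h

theorem integrable_abs_rpow {f : α → ℝ} {r : ℝ} (hr : 0 < r) (hf : MemLp f (ENNReal.ofReal r) μ) :
    Integrable (fun x => |f x| ^ r) μ := by
  have := hf.integrable_norm_rpow (by simpa using hr) ENNReal.ofReal_ne_top
  simpa [ENNReal.toReal_ofReal hr.le] using this

theorem integral_abs_rpow {f : α → ℝ} {r : ℝ} (hr : 0 < r) (hf : MemLp f (ENNReal.ofReal r) μ) :
    ∫ x, |f x| ^ r ∂μ = (eLpNorm f (ENNReal.ofReal r) μ).toReal ^ r := by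
  have h0 : ENNReal.ofReal r ≠ 0 := by simpa using hr
  rw [hf.eLpNorm_eq_integral_rpow_norm h0 ENNReal.ofReal_ne_top, ENNReal.toReal_ofReal hr.le,
    ENNReal.toReal_ofReal (by positivity), ← Real.rpow_mul (by positivity), inv_mul_cancel₀ hr.ne',
    Real.rpow_one]
  rfl

theorem integrable_mul_of_memLp_top {a g : α → ℝ} (ha : MemLp a ∞ μ) (hg : Integrable g μ) :
    Integrable (fun x => a x * g x) μ :=
  hg.bdd_mul ha.1 (ae_abs_le_of_memLp_top ha)

theorem abs_integral_mul_abs_rpow_le {a f : α → ℝ} {r : ℝ} (hr : 0 < r) (ha : MemLp a ∞ μ)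
    (hf : MemLp f (ENNReal.ofReal r) μ) :
    |∫ x, a x * |f x| ^ r ∂μ| ≤
      (eLpNorm a ∞ μ).toReal * (eLpNorm f (ENNReal.ofReal r) μ).toReal ^ r := by
  rw [← integral_abs_rpow hr hf, ← integral_const_mul]
  have hi := integrable_abs_rpow hr hf
  refine (norm_integral_le_integral_norm _).trans (integral_mono_ae
    (integrable_mul_of_memLp_top ha hi).norm (hi.const_mul _) ?_)
  filter_upwards [ae_abs_le_of_memLp_top ha] with x hx
  rw [norm_mul, Real.norm_eq_abs, Real.norm_eq_abs, abs_of_nonneg (Real.rpow_nonneg (abs_nonneg (f x)) _)]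
  gcongr

/-- A single majorant W of both |w| and |h| replaces Hölder's inequality with conjugate exponents:
if f and h are in L^r, so is |f| + |h|. -/
theorem abs_power_kernel_le {r M A w h W : ℝ} (hr : 1 < r) (hM : |A| ≤ M) (hw : |w| ≤ W)
    (hh : |h| ≤ W) : |A * (|w| ^ (r - 2) * w * h)| ≤ M * |W| ^ r := by
  have hW : 0 ≤ W := (abs_nonneg w).trans hw
  rw [abs_mul, abs_mul, abs_mul, abs_of_nonneg (Real.rpow_nonneg (abs_nonneg w) _),
    abs_rpow_sub_two_mul_abs hr, abs_of_nonneg hW]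
  refine mul_le_mul hM ?_ (by positivity) ((abs_nonneg A).trans hM)
  calc |w| ^ (r - 1) * |h| ≤ W ^ (r - 1) * W := by
        refine mul_le_mul (Real.rpow_le_rpow (abs_nonneg w) hw (by linarith)) hh (abs_nonneg h)
          (by positivity)
    _ = W ^ r := by
        have := abs_rpow_sub_two_mul_abs (r := r + 1) (by linarith) W
        rw [show r = (r - 1) + 1 by ring, Real.rpow_add_one' hW (by linarith)]
        norm_num

variable {a f h : α → ℝ} {r : ℝ}

theorem integrable_power_kernel (hr : 1 < r) (ha : MemLp a ∞ μ) (hf : MemLp f (ENNReal.ofReal r) μ)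
    (hh : MemLp h (ENNReal.ofReal r) μ) :
    Integrable (fun x => a x * (|f x| ^ (r - 2) * f x * h x)) μ := by
  have hW : MemLp (fun x => |f x| + |h x|) (ENNReal.ofReal r) μ := hf.norm.add hh.norm
  refine ((integrable_abs_rpow (by linarith) hW).const_mul (eLpNorm a ∞ μ).toReal).mono'
    (ha.1.mul (((continuous_abs_rpow_sub_two_mul hr).comp_aestronglyMeasurable hf.1).mul hh.1)) ?_
  filter_upwards [ae_abs_le_of_memLp_top ha] with x hx
  exact abs_power_kernel_le hr hx (by linarith [abs_nonneg (h x)]) (by linarith [abs_nonneg (f x)])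

theorem hasDerivAt_integral_abs_rpow (hr : 1 < r) (ha : MemLp a ∞ μ)
    (hf : MemLp f (ENNReal.ofReal r) μ) (hh : MemLp h (ENNReal.ofReal r) μ) (t₀ : ℝ) :
    HasDerivAt (fun t => ∫ x, a x * |f x + t * h x| ^ r ∂μ)
      (r * ∫ x, a x * (|f x + t₀ * h x| ^ (r - 2) * (f x + t₀ * h x) * h x) ∂μ) t₀ := by
  have hlin : ∀ t : ℝ, MemLp (fun x => f x + t * h x) (ENNReal.ofReal r) μ :=
    fun t => hf.add (hh.const_mul t)
  have hW : MemLp (fun x => |f x| + (|t₀| + 1) * |h x|) (ENNReal.ofReal r) μ :=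
    -- For |t − t₀| < 1 this function dominates both f + th and h, so its r-th power serves as the
    -- majorant.
    hf.norm.add (hh.norm.const_mul _)
  rw [← integral_const_mul]
  refine (hasDerivAt_integral_of_dominated_loc_of_deriv_le
    (F := fun t x => a x * |f x + t * h x| ^ r)
    (F' := fun t x => r * (a x * (|f x + t * h x| ^ (r - 2) * (f x + t * h x) * h x)))
    (bound := fun x => r * ((eLpNorm a ∞ μ).toReal * |(fun x => |f x| + (|t₀| + 1) * |h x|) x| ^ r))
    (Metric.ball_mem_nhds t₀ one_pos) (Eventually.of_forall fun t => ?_) ?_ ?_ ?_ ?_ ?_).2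
  · exact (integrable_mul_of_memLp_top ha (integrable_abs_rpow (by linarith) (hlin t))).1
  · exact integrable_mul_of_memLp_top ha (integrable_abs_rpow (by linarith) (hlin t₀))
  · exact ((integrable_power_kernel hr ha (hlin t₀) hh).const_mul r).1
  · filter_upwards [ae_abs_le_of_memLp_top ha] with x hx t ht
    rw [Real.norm_eq_abs, abs_mul, abs_of_pos (by linarith : 0 < r)]
    refine mul_le_mul_of_nonneg_left (abs_power_kernel_le hr hx ?_ ?_) (by linarith)
    · have ht' : |t| ≤ |t₀| + 1 := by
        have h1 : |t - t₀| < 1 := by simpa [Real.dist_eq] using ht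
        have := abs_add_le t₀ (t - t₀)
        rw [add_sub_cancel] at this
        linarith
      calc |f x + t * h x| ≤ |f x| + |t| * |h x| := (abs_add_le _ _).trans (by rw [abs_mul])
        _ ≤ _ := by gcongr
    · nlinarith [abs_nonneg (f x), abs_nonneg (h x), abs_nonneg t₀, mul_nonneg (abs_nonneg t₀) (abs_nonneg (h x))]
  · exact ((integrable_abs_rpow (by linarith) hW).const_mul _).const_mul _
  · refine Eventually.of_forall fun x t _ => ?_
    have h1 : HasDerivAt (fun t : ℝ => f x + t * h x) (h x) t := by
      simpa using ((hasDerivAt_id t).mul_const (h x)).const_add (f x)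
    have h2 := ((hasDerivAt_abs_rpow (f x + t * h x) hr).comp t h1).const_mul (a x)
    refine h2.congr_deriv ?_
    ring

/-- Joint continuity in the dilation t and the displacement s is needed because perturbations inside
N⁻ move both at once. -/
theorem continuousAt_integral_power_kernel (hr : 1 < r) (ha : MemLp a ∞ μ)
    (hf : MemLp f (ENNReal.ofReal r) μ) (hh : MemLp h (ENNReal.ofReal r) μ) :
    ContinuousAt (fun z : ℝ × ℝ => ∫ x, a x * (|z.1 * f x + z.2 * h x| ^ (r - 2) *
      (z.1 * f x + z.2 * h x) * h x) ∂μ) (1, 0) := by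
  have hlin : ∀ z : ℝ × ℝ, MemLp (fun x => z.1 * f x + z.2 * h x) (ENNReal.ofReal r) μ :=
    fun z => (hf.const_mul z.1).add (hh.const_mul z.2)
  have hW : MemLp (fun x => 2 * |f x| + 1 * |h x|) (ENNReal.ofReal r) μ :=
    (hf.norm.const_mul _).add (hh.norm.const_mul _)
  refine continuousAt_of_dominated
    (bound := fun x => (eLpNorm a ∞ μ).toReal * |(fun x => 2 * |f x| + 1 * |h x|) x| ^ r)
    (Eventually.of_forall fun z => (integrable_power_kernel hr ha (hlin z) hh).1) ?_
    ((integrable_abs_rpow (by linarith) hW).const_mul _) ?_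
  · filter_upwards [Metric.ball_mem_nhds ((1, 0) : ℝ × ℝ) one_pos] with z hz
    filter_upwards [ae_abs_le_of_memLp_top ha] with x hx
    rw [Metric.mem_ball, Prod.dist_eq, max_lt_iff, Real.dist_eq, Real.dist_eq, sub_zero] at hz
    have hz1 : |z.1| ≤ 2 := by
      have := abs_add_le (z.1 - 1) 1
      rw [sub_add_cancel, abs_one] at this
      linarith [hz.1]
    refine abs_power_kernel_le hr hx ?_ (by linarith [abs_nonneg (f x)])
    calc |z.1 * f x + z.2 * h x| ≤ |z.1| * |f x| + |z.2| * |h x| :=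
          (abs_add_le _ _).trans (by rw [abs_mul, abs_mul])
      _ ≤ _ := by gcongr; exact hz.2.le
  · refine Eventually.of_forall fun x => ?_
    refine continuousAt_const.mul (ContinuousAt.mul ?_ continuousAt_const)
    exact ((continuous_abs_rpow_sub_two_mul hr).comp
      (f := fun z : ℝ × ℝ => z.1 * f x + z.2 * h x) (by fun_prop)).continuousAt

end Powers

/-! ### The quasilinear energy: derivative along lines, convexity, lower semicontinuity. -/

section Quasilinear

variable {φ : ℝ → ℝ} {ρ₀ ρ₁ : ℝ}

theorem hasDerivAt_primitive (hφ : Continuous φ) (s : ℝ) : HasDerivAt (primitive φ) (φ s) s :=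
  (hφ.integral_hasStrictDerivAt 0 s).hasDerivAt

theorem continuous_primitive (hφ : Continuous φ) : Continuous (primitive φ) :=
  continuous_iff_continuousAt.2 fun s => (hasDerivAt_primitive hφ s).continuousAt

theorem mul_le_primitive (hφ : Continuous φ) (h0 : ∀ s, ρ₀ ≤ φ s) {s : ℝ} (hs : 0 ≤ s) :
    ρ₀ * s ≤ primitive φ s := by
  have := intervalIntegral.integral_mono_on (μ := volume) hs
    ((continuous_const (y := ρ₀)).intervalIntegrable 0 s) (hφ.intervalIntegrable 0 s)
    fun x _ => h0 x
  simpa [mul_comm, primitive] using this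

theorem primitive_le_mul (hφ : Continuous φ) (h1 : ∀ s, φ s ≤ ρ₁) {s : ℝ} (hs : 0 ≤ s) :
    primitive φ s ≤ ρ₁ * s := by
  have := intervalIntegral.integral_mono_on (μ := volume) hs (hφ.intervalIntegrable 0 s)
    ((continuous_const (y := ρ₁)).intervalIntegrable 0 s)
    fun x _ => h1 x
  simpa [mul_comm, primitive] using this

theorem primitive_monotone (hφ : Continuous φ) (h : ∀ s, 0 ≤ φ s) : Monotone (primitive φ) :=
  monotone_of_deriv_nonneg (fun s => (hasDerivAt_primitive hφ s).differentiableAt)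
    fun s => by rw [(hasDerivAt_primitive hφ s).deriv]; exact h s

variable {α : Type*} [MeasurableSpace α] {μ : Measure α}
  {E : Type*} [NormedAddCommGroup E] {U V : α → E}

theorem integrable_half_norm_sq (hU : MemLp U 2 μ) : Integrable (fun x => ‖U x‖ ^ 2 / 2) μ :=
  hU.integrable_norm_pow (by norm_num) |>.div_const 2

theorem integrable_primitive (hφ : Continuous φ) (hpos : 0 < ρ₀) (h0 : ∀ s, ρ₀ ≤ φ s)
    (h1 : ∀ s, φ s ≤ ρ₁) (hU : MemLp U 2 μ) :
    Integrable (fun x => primitive φ (‖U x‖ ^ 2 / 2)) μ := by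
  refine ((integrable_half_norm_sq hU).const_mul ρ₁).mono'
    ((continuous_primitive hφ).comp_aestronglyMeasurable (integrable_half_norm_sq hU).1)
    (Eventually.of_forall fun x => ?_)
  have hd : 0 ≤ ‖U x‖ ^ 2 / 2 := by positivity
  rw [Real.norm_eq_abs, abs_of_nonneg ((mul_nonneg hpos.le hd).trans (mul_le_primitive hφ h0 hd))]
  exact primitive_le_mul hφ h1 hd

/-- Fatou's lemma along an almost everywhere convergent subsequence; this is strong lower
semicontinuity of the energy. -/
theorem isClosed_setOf_integral_primitive_le (hφ : Continuous φ) (hpos : 0 < ρ₀)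
    (h0 : ∀ s, ρ₀ ≤ φ s) (h1 : ∀ s, φ s ≤ ρ₁) (c : ℝ) :
    IsClosed {u : Lp E 2 μ | ∫ x, primitive φ (‖u x‖ ^ 2 / 2) ∂μ ≤ c} := by
  have hi := fun w : Lp E 2 μ => integrable_primitive hφ hpos h0 h1 (Lp.memLp w)
  have hnn : ∀ w : E, 0 ≤ primitive φ (‖w‖ ^ 2 / 2) := fun w =>
    (mul_nonneg hpos.le (by positivity)).trans (mul_le_primitive hφ h0 (by positivity))
  have hcont : Continuous fun w : E => primitive φ (‖w‖ ^ 2 / 2) :=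
    (continuous_primitive hφ).comp ((continuous_norm.pow 2).div_const 2)
  have hl : ∀ w : Lp E 2 μ, ENNReal.ofReal (∫ x, primitive φ (‖w x‖ ^ 2 / 2) ∂μ) =
      ∫⁻ x, ENNReal.ofReal (primitive φ (‖w x‖ ^ 2 / 2)) ∂μ := fun w =>
    ofReal_integral_eq_lintegral_ofReal (hi w) (Eventually.of_forall fun x => hnn _)
  refine IsSeqClosed.isClosed fun u v hu huv => ?_
  -- Nonnegativity of c is needed because `ENNReal.ofReal` sends negative numbers to 0 and would
  -- lose the comparison.
  have hc0 : 0 ≤ c := (integral_nonneg fun x => hnn _).trans (hu 0)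
  obtain ⟨σ, -, hσ⟩ := ((Lp.tendsto_Lp_iff_tendsto_eLpNorm' _ _).1 huv |>
    tendstoInMeasure_of_tendsto_eLpNorm (by norm_num) (fun n => Lp.aestronglyMeasurable _)
      (Lp.aestronglyMeasurable v)).exists_seq_tendsto_ae
  rw [mem_ofPred_eq, ← ENNReal.ofReal_le_ofReal_iff hc0, hl]
  calc ∫⁻ x, ENNReal.ofReal (primitive φ (‖v x‖ ^ 2 / 2)) ∂μ
      = ∫⁻ x, liminf (fun n => ENNReal.ofReal (primitive φ (‖u (σ n) x‖ ^ 2 / 2))) atTop ∂μ := by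
        refine lintegral_congr_ae ?_
        filter_upwards [hσ] with x hx
        exact (((ENNReal.continuous_ofReal.comp hcont).tendsto _).comp hx).liminf_eq.symm
    _ ≤ liminf (fun n => ∫⁻ x, ENNReal.ofReal (primitive φ (‖u (σ n) x‖ ^ 2 / 2)) ∂μ) atTop :=
        lintegral_liminf_le' fun n => (hi _).1.aemeasurable.ennreal_ofReal
    _ ≤ ENNReal.ofReal c := by
        refine liminf_le_of_frequently_le' (Eventually.of_forall fun n => ?_).frequently
        rw [← hl]
        exact ENNReal.ofReal_le_ofReal (hu _)

variable [InnerProductSpace ℝ E]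

theorem abs_quasilinear_kernel_le {c : ℝ} {v w : E} (hc0 : 0 ≤ c) (hc : c ≤ ρ₁) {W : ℝ}
    (hv : ‖v‖ ≤ W) (hw : ‖w‖ ≤ W) : |c * inner ℝ v w| ≤ ρ₁ * W ^ 2 := by
  rw [abs_mul, abs_of_nonneg hc0, sq]
  exact mul_le_mul hc ((abs_real_inner_le_norm v w).trans
    (mul_le_mul hv hw (norm_nonneg _) ((norm_nonneg _).trans hv))) (abs_nonneg _) (hc0.trans hc)

theorem integrable_quasilinear_kernel (hφ : Continuous φ) (hpos : 0 < ρ₀) (h0 : ∀ s, ρ₀ ≤ φ s)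
    (h1 : ∀ s, φ s ≤ ρ₁) (hU : MemLp U 2 μ) (hV : MemLp V 2 μ) :
    Integrable (fun x => φ (‖U x‖ ^ 2 / 2) * inner ℝ (U x) (V x)) μ := by
  have hW : MemLp (fun x => ‖U x‖ + ‖V x‖) 2 μ := hU.norm.add hV.norm
  refine ((hW.integrable_sq).const_mul ρ₁).mono'
    ((hφ.comp_aestronglyMeasurable (integrable_half_norm_sq hU).1).mul (hU.1.inner hV.1)) ?_
  refine Eventually.of_forall fun x => ?_
  exact abs_quasilinear_kernel_le (hpos.le.trans (h0 _)) (h1 _) (by simp) (by simp)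

theorem hasDerivAt_integral_primitive (hφ : Continuous φ) (hpos : 0 < ρ₀) (h0 : ∀ s, ρ₀ ≤ φ s)
    (h1 : ∀ s, φ s ≤ ρ₁) (hU : MemLp U 2 μ) (hV : MemLp V 2 μ) (t₀ : ℝ) :
    HasDerivAt (fun t : ℝ => ∫ x, primitive φ (‖U x + t • V x‖ ^ 2 / 2) ∂μ)
      (∫ x, φ (‖U x + t₀ • V x‖ ^ 2 / 2) * inner ℝ (U x + t₀ • V x) (V x) ∂μ) t₀ := by
  have hlin : ∀ t : ℝ, MemLp (fun x => U x + t • V x) 2 μ := fun t => hU.add (hV.const_smul t)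
  have hW : MemLp (fun x => ‖U x‖ + (|t₀| + 1) * ‖V x‖) 2 μ := hU.norm.add (hV.norm.const_mul _)
  refine (hasDerivAt_integral_of_dominated_loc_of_deriv_le
    (F := fun t x => primitive φ (‖U x + t • V x‖ ^ 2 / 2))
    (F' := fun t x => φ (‖U x + t • V x‖ ^ 2 / 2) * inner ℝ (U x + t • V x) (V x))
    (bound := fun x => ρ₁ * (‖U x‖ + (|t₀| + 1) * ‖V x‖) ^ 2)
    (Metric.ball_mem_nhds t₀ one_pos) (Eventually.of_forall fun t => ?_) ?_ ?_ ?_ ?_ ?_).2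
  · exact (integrable_primitive hφ hpos h0 h1 (hlin t)).1
  · exact integrable_primitive hφ hpos h0 h1 (hlin t₀)
  · exact (integrable_quasilinear_kernel hφ hpos h0 h1 (hlin t₀) hV).1
  · refine Eventually.of_forall fun x t ht => ?_
    refine abs_quasilinear_kernel_le (hpos.le.trans (h0 _)) (h1 _) ?_ ?_
    · have ht' : |t| ≤ |t₀| + 1 := by
        have h1 : |t - t₀| < 1 := by simpa [Real.dist_eq] using ht
        have := abs_add_le t₀ (t - t₀)
        rw [add_sub_cancel] at this
        linarith
      calc ‖U x + t • V x‖ ≤ ‖U x‖ + |t| * ‖V x‖ := (norm_add_le _ _).trans (by rw [norm_smul, Real.norm_eq_abs])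
        _ ≤ _ := by gcongr
    · nlinarith [norm_nonneg (U x), norm_nonneg (V x), mul_nonneg (abs_nonneg t₀) (norm_nonneg (V x))]
  · exact hW.integrable_sq.const_mul _
  · refine Eventually.of_forall fun x t _ => ?_
    have h1 : HasDerivAt (fun t : ℝ => U x + t • V x) (V x) t := by
      simpa using ((hasDerivAt_id t).smul_const (V x)).const_add (U x)
    have h2 := (hasDerivAt_primitive hφ (‖U x + t • V x‖ ^ 2 / 2)).comp t (h1.norm_sq.div_const 2)
    refine h2.congr_deriv ?_
    ring

theorem continuousAt_integral_quasilinear_kernel (hφ : Continuous φ) (hpos : 0 < ρ₀)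
    (h0 : ∀ s, ρ₀ ≤ φ s) (h1 : ∀ s, φ s ≤ ρ₁) (hU : MemLp U 2 μ) (hV : MemLp V 2 μ) :
    ContinuousAt (fun z : ℝ × ℝ => ∫ x, φ (‖z.1 • U x + z.2 • V x‖ ^ 2 / 2) *
      inner ℝ (z.1 • U x + z.2 • V x) (V x) ∂μ) (1, 0) := by
  have hlin : ∀ z : ℝ × ℝ, MemLp (fun x => z.1 • U x + z.2 • V x) 2 μ :=
    fun z => (hU.const_smul z.1).add (hV.const_smul z.2)
  have hW : MemLp (fun x => 2 * ‖U x‖ + 1 * ‖V x‖) 2 μ :=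
    (hU.norm.const_mul _).add (hV.norm.const_mul _)
  refine continuousAt_of_dominated (bound := fun x => ρ₁ * (2 * ‖U x‖ + 1 * ‖V x‖) ^ 2)
    (Eventually.of_forall fun z => (integrable_quasilinear_kernel hφ hpos h0 h1 (hlin z) hV).1) ?_
    (hW.integrable_sq.const_mul _) (Eventually.of_forall fun x => ?_)
  · filter_upwards [Metric.ball_mem_nhds ((1, 0) : ℝ × ℝ) one_pos] with z hz
    refine Eventually.of_forall fun x => ?_
    rw [Metric.mem_ball, Prod.dist_eq, max_lt_iff, Real.dist_eq, Real.dist_eq, sub_zero] at hz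
    have hz1 : |z.1| ≤ 2 := by
      have := abs_add_le (z.1 - 1) 1
      rw [sub_add_cancel, abs_one] at this
      linarith [hz.1]
    refine abs_quasilinear_kernel_le (hpos.le.trans (h0 _)) (h1 _) ?_ (by linarith [norm_nonneg (U x)])
    calc ‖z.1 • U x + z.2 • V x‖ ≤ |z.1| * ‖U x‖ + |z.2| * ‖V x‖ :=
          (norm_add_le _ _).trans (by rw [norm_smul, norm_smul, Real.norm_eq_abs, Real.norm_eq_abs])
      _ ≤ _ := by gcongr; exact hz.2.le
  · have hc : Continuous fun z : ℝ × ℝ => z.1 • U x + z.2 • V x := by fun_prop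
    exact ((hφ.comp ((hc.norm.pow 2).div_const 2)).mul (hc.inner continuous_const)).continuousAt

/-- Φ(‖v‖²/2) is the increasing convex function t ↦ Φ(t²) evaluated at the convex function ‖v‖/√2.
-/
theorem convexOn_primitive_half_norm_sq (hφ : Continuous φ) (h : ∀ s, 0 ≤ φ s)
    (hconv : ConvexOn ℝ (Ici 0) fun t : ℝ => primitive φ (t ^ 2)) :
    ConvexOn ℝ univ fun v : E => primitive φ (‖v‖ ^ 2 / 2) := by
  have hrep : ∀ t : ℝ, primitive φ (t ^ 2 / 2) = primitive φ ((t / √2) ^ 2) := fun t => by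
    rw [div_pow, Real.sq_sqrt (by norm_num)]
  refine ⟨convex_univ, fun v _ w _ a b ha hb hab => ?_⟩
  have h2 : 0 < √2 := by positivity
  have key := hconv.2 (x := ‖v‖ / √2) (by simp only [mem_Ici]; positivity)
    (y := ‖w‖ / √2) (by simp only [mem_Ici]; positivity) ha hb hab
  simp only [hrep]
  refine le_trans (primitive_monotone hφ h ?_) key
  have : ‖a • v + b • w‖ / √2 ≤ a • (‖v‖ / √2) + b • (‖w‖ / √2) := by
    rw [smul_eq_mul, smul_eq_mul, ← mul_div_assoc, ← mul_div_assoc, ← add_div]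
    gcongr
    refine (norm_add_le _ _).trans (by rw [norm_smul, norm_smul, Real.norm_of_nonneg ha, Real.norm_of_nonneg hb])
  gcongr

theorem convex_setOf_integral_primitive_le (hφ : Continuous φ) (hpos : 0 < ρ₀) (h0 : ∀ s, ρ₀ ≤ φ s)
    (h1 : ∀ s, φ s ≤ ρ₁) (hconv : ConvexOn ℝ (Ici 0) fun t : ℝ => primitive φ (t ^ 2)) (c : ℝ) :
    Convex ℝ {u : Lp E 2 μ | ∫ x, primitive φ (‖u x‖ ^ 2 / 2) ∂μ ≤ c} := by
  intro u hu v hv a b ha hb hab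
  have hc := convexOn_primitive_half_norm_sq (E := E) hφ (fun s => hpos.le.trans (h0 s)) hconv
  have hi := fun w : Lp E 2 μ => integrable_primitive hφ hpos h0 h1 (Lp.memLp w)
  calc ∫ x, primitive φ (‖(a • u + b • v : Lp E 2 μ) x‖ ^ 2 / 2) ∂μ
      ≤ ∫ x, (a * primitive φ (‖u x‖ ^ 2 / 2) + b * primitive φ (‖v x‖ ^ 2 / 2)) ∂μ := by
        refine integral_mono_ae (hi _) (((hi u).const_mul a).add ((hi v).const_mul b)) ?_
        filter_upwards [Lp.coeFn_add (a • u) (b • v), Lp.coeFn_smul a u, Lp.coeFn_smul b v]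
          with x e1 e2 e3
        rw [e1, Pi.add_apply, e2, e3]
        exact hc.2 (mem_univ _) (mem_univ _) ha hb hab
    _ = a * ∫ x, primitive φ (‖u x‖ ^ 2 / 2) ∂μ + b * ∫ x, primitive φ (‖v x‖ ^ 2 / 2) ∂μ := by
        rw [integral_add ((hi u).const_mul a) ((hi v).const_mul b), integral_const_mul,
          integral_const_mul]
    _ ≤ a * c + b * c := by
        gcongr
        · exact hu
        · exact hv
    _ = c := by rw [← add_mul, hab, one_mul]

end Quasilinear

/-! ### Second variation along a ray, in terms of a nonnegative density d. -/

section FiberCalculus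

variable {φ : ℝ → ℝ}

theorem hasDerivAt_dphi (hφ : ContDiffOn ℝ 2 φ (Ici 0)) {s : ℝ} (hs : 0 < s) :
    HasDerivAt φ (dphi φ s) s :=
  ((hφ.differentiableOn (by norm_num)) s hs.le).hasDerivWithinAt.hasDerivAt (Ici_mem_nhds hs)

theorem contDiffOn_dphi (hφ : ContDiffOn ℝ 2 φ (Ici 0)) : ContDiffOn ℝ 1 (dphi φ) (Ici 0) :=
  hφ.derivWithin (uniqueDiffOn_Ici 0) (by norm_num)

theorem hasDerivAt_ddphi (hφ : ContDiffOn ℝ 2 φ (Ici 0)) {s : ℝ} (hs : 0 < s) :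
    HasDerivAt (dphi φ) (ddphi φ s) s := by
  have h := (((contDiffOn_dphi hφ).differentiableOn (by norm_num)) s hs.le).hasDerivWithinAt
  have e : ddphi φ s = derivWithin (dphi φ) (Ici 0) s := by
    rw [ddphi, iteratedDerivWithin_succ]
    congr 1
    funext x
    rw [iteratedDerivWithin_one]
    rfl
  rw [e]
  exact h.hasDerivAt (Ici_mem_nhds hs)

/-- `dphi φ` is known to be continuous only on [0, ∞); precomposing with max(·, 0) gives a
continuous function that agrees with it on the values of d. -/
theorem aestronglyMeasurable_dphi_comp {α : Type*} [MeasurableSpace α] {μ : Measure α}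
    (hφ : ContDiffOn ℝ 2 φ (Ici 0)) {d : α → ℝ} (hd : AEStronglyMeasurable d μ) (h0 : ∀ x, 0 ≤ d x) :
    AEStronglyMeasurable (fun x => dphi φ (d x)) μ := by
  have hc : Continuous fun s => dphi φ (max s 0) :=
    (contDiffOn_dphi hφ).continuousOn.comp_continuous (continuous_id.max continuous_const)
      fun s => mem_Ici.2 (le_max_right _ _)
  refine (hc.comp_aestronglyMeasurable hd).congr (Eventually.of_forall fun x => ?_)
  simp [h0 x]

variable {p q ρ₀ ρ₁ ρ₂ : ℝ}

theorem hasDerivAt_scaled_kernel (hφ : ContDiffOn ℝ 2 φ (Ici 0)) {d t : ℝ} (hd : 0 ≤ d)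
    (ht : 0 < t) : HasDerivAt (fun t => φ (t ^ 2 * d) * (t * (2 * d)))
      ((φ (t ^ 2 * d) + 2 * (dphi φ (t ^ 2 * d) * (t ^ 2 * d))) * (2 * d)) t := by
  -- At d = 0 the argument of φ sits at the endpoint, where `dphi` is only one-sided, but the kernel
  -- vanishes identically.
  rcases hd.eq_or_lt with rfl | hd
  · simpa using hasDerivAt_const t (0 : ℝ)
  · have h1 : HasDerivAt (fun t : ℝ => t ^ 2 * d) (2 * t * d) t := by
      simpa using (hasDerivAt_pow 2 t).mul_const d
    have h2 := (hasDerivAt_dphi hφ (by positivity : 0 < t ^ 2 * d)).comp t h1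
    have h3 := h2.mul ((hasDerivAt_id t).mul_const (2 * d))
    refine h3.congr_deriv ?_
    simp only [Function.comp_apply, id]
    ring

/-- With s = t²d, the derivative in t is t^{-p} times the expression that `h5` declares nonpositive.
-/
theorem antitoneOn_scaled_kernel (hφ : ContDiffOn ℝ 2 φ (Ici 0))
    (h5 : ∀ s, 0 ≤ s → (1 - q) * (1 - p) * φ s + 2 * (4 - p - q) * dphi φ s * s
      + 4 * ddphi φ s * s ^ 2 ≤ 0) {d : ℝ} (hd : 0 < d) :
    AntitoneOn (fun t : ℝ => t ^ (1 - p) *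
      ((1 - q) * φ (t ^ 2 * d) + 2 * (dphi φ (t ^ 2 * d) * (t ^ 2 * d)))) (Ioi 0) := by
  have hder : ∀ t ∈ Ioi (0 : ℝ), HasDerivAt (fun t : ℝ => t ^ (1 - p) *
      ((1 - q) * φ (t ^ 2 * d) + 2 * (dphi φ (t ^ 2 * d) * (t ^ 2 * d))))
      (t ^ (-p) * ((1 - q) * (1 - p) * φ (t ^ 2 * d)
        + 2 * (4 - p - q) * dphi φ (t ^ 2 * d) * (t ^ 2 * d)
        + 4 * ddphi φ (t ^ 2 * d) * (t ^ 2 * d) ^ 2)) t := by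
    intro t ht
    have ht : 0 < t := ht
    have h1 : HasDerivAt (fun t : ℝ => t ^ 2 * d) (2 * t * d) t := by
      simpa using (hasDerivAt_pow 2 t).mul_const d
    have hs : 0 < t ^ 2 * d := by positivity
    have h2 := (hasDerivAt_dphi hφ hs).comp t h1
    have h3 := ((hasDerivAt_ddphi hφ hs).comp t h1).mul h1
    have h4 := Real.hasDerivAt_rpow_const (p := 1 - p) (Or.inl ht.ne')
    refine (h4.mul ((h2.const_mul (1 - q)).add (h3.const_mul 2))).congr_deriv ?_
    have e1 : t ^ (1 - p - 1) = t ^ (-p) := by congr 1; ring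
    have e2 : t ^ (1 - p) = t ^ (-p) * t := by rw [← Real.rpow_add_one ht.ne']; congr 1; ring
    rw [e1, e2]
    simp only [Function.comp_apply, Pi.add_apply, Pi.mul_apply]
    ring
  refine antitoneOn_of_deriv_nonpos (convex_Ioi 0)
    (fun t ht => (hder t ht).continuousAt.continuousWithinAt)
    (fun t ht => (hder t (interior_subset ht)).differentiableAt.differentiableWithinAt)
    fun t ht => ?_
  have ht : t ∈ Ioi (0 : ℝ) := interior_subset ht
  rw [(hder t ht).deriv]
  have ht' : 0 < t := ht
  exact mul_nonpos_of_nonneg_of_nonpos (Real.rpow_nonneg ht'.le _) (h5 _ (by positivity))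

variable {α : Type*} [MeasurableSpace α] {μ : Measure α} {d : α → ℝ}

theorem integrable_comp_mul (hc : Continuous φ) (hpos : 0 < ρ₀) (h0 : ∀ s, ρ₀ ≤ φ s)
    (h1 : ∀ s, φ s ≤ ρ₁) (hd : Integrable d μ) (t : ℝ) :
    Integrable (fun x => φ (t ^ 2 * d x) * (2 * d x)) μ := by
  refine (hd.const_mul 2).bdd_mul (c := ρ₁)
    (hc.comp_aestronglyMeasurable (hd.1.const_mul (t ^ 2)))
    (Eventually.of_forall fun x => ?_)
  rw [Real.norm_eq_abs, abs_of_nonneg (hpos.le.trans (h0 _))]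
  exact h1 _

theorem integrable_dphi_comp_mul (hφ : ContDiffOn ℝ 2 φ (Ici 0))
    (h2 : ∀ s, 0 ≤ s → |dphi φ s| * s ≤ ρ₂) (hd : Integrable d μ) (hd0 : ∀ x, 0 ≤ d x) (t : ℝ) :
    Integrable (fun x => dphi φ (t ^ 2 * d x) * (t ^ 2 * d x) * (2 * d x)) μ := by
  have hdt : ∀ x, 0 ≤ t ^ 2 * d x := fun x => mul_nonneg (sq_nonneg t) (hd0 x)
  refine (hd.const_mul 2).bdd_mul (c := ρ₂)
    ((aestronglyMeasurable_dphi_comp hφ (hd.1.const_mul _) hdt).mul (hd.1.const_mul _))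
    (Eventually.of_forall fun x => ?_)
  rw [Real.norm_eq_abs, abs_mul, abs_of_nonneg (hdt x)]
  exact h2 _ (hdt x)

/-- The integral governing the second variation of the quasilinear energy along a ray, corrected
by the sublinear power. -/
noncomputable def raySecond (φ : ℝ → ℝ) (q : ℝ) (μ : Measure α) (d : α → ℝ) (t : ℝ) : ℝ :=
  ∫ x, ((1 - q) * φ (t ^ 2 * d x) + 2 * (dphi φ (t ^ 2 * d x) * (t ^ 2 * d x))) * (2 * d x) ∂μ

theorem integrable_raySecond (hc : Continuous φ) (hφ : ContDiffOn ℝ 2 φ (Ici 0)) (hpos : 0 < ρ₀)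
    (h0 : ∀ s, ρ₀ ≤ φ s) (h1 : ∀ s, φ s ≤ ρ₁) (h2 : ∀ s, 0 ≤ s → |dphi φ s| * s ≤ ρ₂)
    (hd : Integrable d μ) (hd0 : ∀ x, 0 ≤ d x) (q t : ℝ) :
    Integrable (fun x => ((1 - q) * φ (t ^ 2 * d x) +
      2 * (dphi φ (t ^ 2 * d x) * (t ^ 2 * d x))) * (2 * d x)) μ := by
  refine (((integrable_comp_mul hc hpos h0 h1 hd t).const_mul (1 - q)).add
    ((integrable_dphi_comp_mul hφ h2 hd hd0 t).const_mul 2)).congr (Eventually.of_forall fun x => ?_)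
  simp only [Pi.add_apply]
  ring

/-- Lets the first-order equation eliminate one of the power terms: parameter 0 is the plain second
variation, q corresponds to eliminating the a-term, p to eliminating the b-term. -/
theorem raySecond_sub (hc : Continuous φ) (hφ : ContDiffOn ℝ 2 φ (Ici 0)) (hpos : 0 < ρ₀)
    (h0 : ∀ s, ρ₀ ≤ φ s) (h1 : ∀ s, φ s ≤ ρ₁) (h2 : ∀ s, 0 ≤ s → |dphi φ s| * s ≤ ρ₂)
    (hd : Integrable d μ) (hd0 : ∀ x, 0 ≤ d x) (q q' t : ℝ) :
    raySecond φ q μ d t = raySecond φ q' μ d t + (q' - q) * ∫ x, φ (t ^ 2 * d x) * (2 * d x) ∂μ := by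
  rw [raySecond, raySecond, ← integral_const_mul, ← integral_add
    (integrable_raySecond hc hφ hpos h0 h1 h2 hd hd0 q' t)
    ((integrable_comp_mul hc hpos h0 h1 hd t).const_mul _)]
  refine integral_congr_ae (Eventually.of_forall fun x => ?_)
  simp only
  ring

theorem rpow_mul_raySecond_antitoneOn (hc : Continuous φ) (hφ : ContDiffOn ℝ 2 φ (Ici 0))
    (hpos : 0 < ρ₀) (h0 : ∀ s, ρ₀ ≤ φ s) (h1 : ∀ s, φ s ≤ ρ₁)
    (h2 : ∀ s, 0 ≤ s → |dphi φ s| * s ≤ ρ₂)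
    (h5 : ∀ s, 0 ≤ s → (1 - q) * (1 - p) * φ s + 2 * (4 - p - q) * dphi φ s * s
      + 4 * ddphi φ s * s ^ 2 ≤ 0) (hd : Integrable d μ) (hd0 : ∀ x, 0 ≤ d x) :
    AntitoneOn (fun t : ℝ => t ^ (1 - p) * raySecond φ q μ d t) (Ioi 0) := by
  intro t₁ ht₁ t₂ ht₂ hle
  simp only [raySecond, ← integral_const_mul]
  have hi := integrable_raySecond hc hφ hpos h0 h1 h2 hd hd0 q
  refine integral_mono ((hi t₂).const_mul _) ((hi t₁).const_mul _) fun x => ?_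
  rcases (hd0 x).eq_or_lt with hx | hx
  · simp [← hx]
  · have := antitoneOn_scaled_kernel hφ h5 hx ht₁ ht₂ hle
    simp only [← mul_assoc] at this ⊢
    exact mul_le_mul_of_nonneg_right
      (mul_le_mul_of_nonneg_right (by linarith) (by norm_num)) hx.le

/-- Only the product φ'(s)s is bounded, which suffices: the derivative in t involves φ' at s = t²d
multiplied by s, and is dominated by (ρ₁ + 2ρ₂)·2d. -/
theorem hasDerivAt_integral_scaled_kernel (hc : Continuous φ) (hφ : ContDiffOn ℝ 2 φ (Ici 0))
    (hpos : 0 < ρ₀) (h0 : ∀ s, ρ₀ ≤ φ s) (h1 : ∀ s, φ s ≤ ρ₁)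
    (h2 : ∀ s, 0 ≤ s → |dphi φ s| * s ≤ ρ₂) (hd : Integrable d μ) (hd0 : ∀ x, 0 ≤ d x)
    {t₀ : ℝ} (ht₀ : 0 < t₀) :
    HasDerivAt (fun t => ∫ x, φ (t ^ 2 * d x) * (t * (2 * d x)) ∂μ) (raySecond φ 0 μ d t₀) t₀ := by
  have hF : ∀ t : ℝ, Integrable (fun x => φ (t ^ 2 * d x) * (t * (2 * d x))) μ := fun t =>
    ((integrable_comp_mul hc hpos h0 h1 hd t).const_mul t).congr
      (Eventually.of_forall fun x => by ring)
  have key := (hasDerivAt_integral_of_dominated_loc_of_deriv_le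
    (F := fun t x => φ (t ^ 2 * d x) * (t * (2 * d x)))
    (F' := fun t x => ((1 - 0) * φ (t ^ 2 * d x) +
      2 * (dphi φ (t ^ 2 * d x) * (t ^ 2 * d x))) * (2 * d x))
    (bound := fun x => (ρ₁ + 2 * ρ₂) * (2 * d x)) (Ioi_mem_nhds ht₀)
    (Eventually.of_forall fun t => (hF t).1) (hF t₀)
    (integrable_raySecond hc hφ hpos h0 h1 h2 hd hd0 0 t₀).1 ?_ ((hd.const_mul 2).const_mul _) ?_).2
  · exact key
  · refine Eventually.of_forall fun x t _ => ?_
    have hdt : 0 ≤ t ^ 2 * d x := mul_nonneg (sq_nonneg t) (hd0 x)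
    rw [norm_mul, Real.norm_of_nonneg (by linarith [hd0 x] : 0 ≤ 2 * d x)]
    refine mul_le_mul_of_nonneg_right ?_ (by linarith [hd0 x])
    refine (norm_add_le _ _).trans ?_
    rw [sub_zero, one_mul, Real.norm_of_nonneg (hpos.le.trans (h0 _)), norm_mul, norm_mul,
      Real.norm_of_nonneg hdt, Real.norm_eq_abs, Real.norm_eq_abs, abs_two]
    linarith [h1 (t ^ 2 * d x), h2 _ hdt]
  · refine Eventually.of_forall fun x t ht => ?_
    simpa using hasDerivAt_scaled_kernel hφ (hd0 x) ht

end FiberCalculus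

/-! ### A substitute for weak limits, stated through closed convex sets. -/

section Mazur

/-- A bounded sequence in a Hilbert space has a point common to all closed convex sets which
contain the sequence eventually. -/
theorem exists_mem_of_eventually_mem_convex {K : Type*} [NormedAddCommGroup K]
    [InnerProductSpace ℝ K] [CompleteSpace K] (u : ℕ → K) {M : ℝ} (hM : ∀ n, ‖u n‖ ≤ M) :
    ∃ w : K, ∀ C : Set K, IsClosed C → Convex ℝ C → (∀ᶠ n in atTop, u n ∈ C) → w ∈ C := by
  set C : ℕ → Set K := fun n => closure (convexHull ℝ (u '' Ici n)) with hC
  have hconv : ∀ n, Convex ℝ (C n) := fun n => (convex_convexHull ℝ _).closure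
  have hmem : ∀ n, u n ∈ C n := fun n =>
    subset_closure (subset_convexHull ℝ _ (mem_image_of_mem u (mem_Ici.2 le_rfl)))
  have hanti : ∀ {n m}, n ≤ m → C m ⊆ C n := fun h =>
    closure_mono (convexHull_mono (image_mono (Ici_subset_Ici.2 h)))
  -- The desired point is the limit of the points of least norm in the closed convex hulls of the
  -- tails. The hulls decrease, so these norms increase, and they are bounded by M.
  have hmin : ∀ n, ∃ v ∈ C n, ∀ w ∈ C n, ‖v‖ ≤ ‖w‖ := fun n => by
    obtain ⟨v, hv, hv'⟩ := exists_norm_eq_iInf_of_complete_convex ⟨_, hmem n⟩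
      (isClosed_closure.isComplete (s := C n)) (hconv n) (0 : K)
    refine ⟨v, hv, fun w hw => ?_⟩
    rw [zero_sub, norm_neg] at hv'
    rw [hv', ← norm_neg w, ← zero_sub w]
    exact ciInf_le ⟨0, forall_mem_range.2 fun _ => norm_nonneg _⟩ (⟨w, hw⟩ : C n)
  choose v hv hvmin using hmin
  have hmono : Monotone fun n => ‖v n‖ ^ 2 := fun n m h =>
    pow_le_pow_left₀ (norm_nonneg _) (hvmin n _ (hanti h (hv m))) 2
  have hbdd : BddAbove (range fun n => ‖v n‖ ^ 2) :=
    ⟨M ^ 2, forall_mem_range.2 fun n =>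
      pow_le_pow_left₀ (norm_nonneg _) ((hvmin n _ (hmem n)).trans (hM n)) 2⟩
  have hlim := tendsto_atTop_ciSup hmono hbdd
  set L := ⨆ n, ‖v n‖ ^ 2
  have hcau : CauchySeq v := by
    refine cauchySeq_of_le_tendsto_0' (fun n => √(2 * (L - ‖v n‖ ^ 2))) (fun n m h => ?_) ?_
    · rw [dist_eq_norm]
      refine Real.le_sqrt_of_sq_le ?_
      -- The midpoint lies in C n, so its norm is at least that of v n; the parallelogram law then
      -- bounds ‖v n − v m‖² by 2(L − ‖v n‖²).
      have hmid : ‖v n‖ ≤ ‖(1 / 2 : ℝ) • v n + (1 / 2 : ℝ) • v m‖ :=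
        hvmin n _ (hconv n (hv n) (hanti h (hv m)) (by norm_num) (by norm_num) (by norm_num))
      rw [← smul_add, norm_smul, Real.norm_of_nonneg (by norm_num)] at hmid
      have hpar := parallelogram_law_with_norm ℝ (v n) (v m)
      have hL : ‖v m‖ ^ 2 ≤ L := le_ciSup hbdd m
      nlinarith [norm_nonneg (v n), norm_nonneg (v n + v m)]
    · have : Tendsto (fun n => √(2 * (L - ‖v n‖ ^ 2))) atTop (𝓝 (√(2 * (L - L)))) :=
        ((hlim.const_sub L).const_mul 2).sqrt
      simpa using this
  obtain ⟨w, hw⟩ := cauchySeq_tendsto_of_complete hcau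
  refine ⟨w, fun D hD hDc hev => ?_⟩
  obtain ⟨n, hn⟩ := eventually_atTop.1 hev
  have hsub : C n ⊆ D := closure_minimal
    (convexHull_min (image_subset_iff.2 fun k hk => hn k hk) hDc) hD
  exact hsub (isClosed_closure.mem_of_tendsto hw
    (eventually_atTop.2 ⟨n, fun m h => hanti h (hv m)⟩))

end Mazur

/-! ### H₀¹(Ω) as a closed subspace of a Hilbert space. -/

section Spaces

variable {N : ℕ} {Ω : Set (Eucl N)}

theorem fn_add (u v : H10 Ω) : fn (u + v) = fn u + fn v := rfl
theorem fn_smul (c : ℝ) (u : H10 Ω) : fn (c • u) = c • fn u := rfl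
theorem grad_add (u v : H10 Ω) : grad (u + v) = grad u + grad v := rfl
theorem grad_smul (c : ℝ) (u : H10 Ω) : grad (c • u) = c • grad u := rfl

theorem continuous_fn : Continuous (fn (Ω := Ω)) :=
  continuous_fst.comp (continuous_subtype_val.comp continuous_subtype_val)

theorem continuous_grad : Continuous (grad (Ω := Ω)) :=
  continuous_snd.comp (continuous_subtype_val.comp continuous_subtype_val)

/-- For a fixed test function, the weak gradient identity equates two continuous functionals on L² ×
L², so W^{1,2} is an intersection of closed sets. -/
theorem isClosed_W12 : IsClosed (W12 Ω : Set (Lp ℝ 2 (vol Ω) × Lp (Eucl N) 2 (vol Ω))) := by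
  have hrep : (W12 Ω : Set (Lp ℝ 2 (vol Ω) × Lp (Eucl N) 2 (vol Ω))) =
      ⋂ (ψ) (hψ : IsTestFunction Ω ψ) (i : Fin N), {U |
        inner ℝ ((hψ.memLp_partialDeriv i).toLp (partialDeriv i ψ)) U.1 =
          -inner ℝ (hψ.memLp.toLp ψ) ((EuclideanSpace.proj i : Eucl N →L[ℝ] ℝ).compLpL 2 (vol Ω) U.2)} := by
    ext U
    simp only [mem_iInter, mem_ofPred_eq]
    refine forall_congr' fun ψ => forall_congr' fun hψ => forall_congr' fun i => ?_
    rw [L2.inner_def, L2.inner_def]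
    have e1 : ∫ x, inner ℝ (((hψ.memLp_partialDeriv i).toLp (partialDeriv i ψ)) x) (U.1 x) ∂(vol Ω) =
        ∫ x in Ω, U.1 x * partialDeriv i ψ x := by
      refine integral_congr_ae ?_
      filter_upwards [(hψ.memLp_partialDeriv i).coeFn_toLp] with x hx
      rw [hx]
      simp
    have e2 : ∫ x, inner ℝ ((hψ.memLp.toLp ψ) x)
        ((EuclideanSpace.proj i : Eucl N →L[ℝ] ℝ).compLpL 2 (vol Ω) U.2 x) ∂(vol Ω) =
        ∫ x in Ω, U.2 x i * ψ x := by
      refine integral_congr_ae ?_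
      filter_upwards [hψ.memLp.coeFn_toLp,
        (EuclideanSpace.proj i : Eucl N →L[ℝ] ℝ).coeFn_compLpL U.2] with x hx hx'
      rw [hx, hx']
      simp [mul_comm]
    rw [e1, e2]
  rw [hrep]
  refine isClosed_iInter fun ψ => isClosed_iInter fun hψ => isClosed_iInter fun i =>
    isClosed_eq (by fun_prop) (by fun_prop)

/-- The plain product L² × L² carries the sup norm, which is not Hilbertian; `WithLp 2` supplies the
inner product, and closedness of the image carries closed sets across. -/
theorem isClosedEmbedding_H10 : IsClosedEmbedding fun u : H10 Ω =>
    WithLp.toLp 2 ((fn u, grad u) : Lp ℝ 2 (vol Ω) × Lp (Eucl N) 2 (vol Ω)) := by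
  have h1 : IsClosedEmbedding (Subtype.val : W12 Ω → _) := isClosed_W12.isClosedEmbedding_subtypeVal
  have h2 : IsClosedEmbedding (Subtype.val : H10 Ω → W12 Ω) :=
    (Submodule.isClosed_topologicalClosure _).isClosedEmbedding_subtypeVal
  exact (WithLp.prodContinuousLinearEquiv 2 ℝ (Lp ℝ 2 (vol Ω))
    (Lp (Eucl N) 2 (vol Ω))).symm.toHomeomorph.isClosedEmbedding.comp (h1.comp h2)

theorem exists_mem_of_eventually_mem_convex_H10 (u : ℕ → H10 Ω) {M : ℝ}
    (hf : ∀ n, ‖fn (u n)‖ ≤ M) (hg : ∀ n, ‖grad (u n)‖ ≤ M) :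
    ∃ w : H10 Ω, ∀ C : Set (H10 Ω), IsClosed C → Convex ℝ C → (∀ᶠ n in atTop, u n ∈ C) →
      w ∈ C := by
  set e : H10 Ω →ₗ[ℝ] WithLp 2 (Lp ℝ 2 (vol Ω) × Lp (Eucl N) 2 (vol Ω)) :=
    { toFun := fun u => WithLp.toLp 2 (fn u, grad u)
      map_add' := fun _ _ => rfl
      map_smul' := fun _ _ => rfl } with he
  have hcl : IsClosedEmbedding e := isClosedEmbedding_H10
  obtain ⟨w, hw⟩ := exists_mem_of_eventually_mem_convex (fun n => e (u n))
    (M := √(M ^ 2 + M ^ 2)) fun n => by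
      have : ‖e (u n)‖ = √(‖fn (u n)‖ ^ 2 + ‖grad (u n)‖ ^ 2) := WithLp.prod_norm_eq_of_L2 _
      rw [this]
      have := hf n
      have := hg n
      gcongr
  have himg : ∀ C : Set (H10 Ω), IsClosed C → Convex ℝ C → (∀ᶠ n in atTop, u n ∈ C) →
      w ∈ e '' C := fun C h1 h2 h3 =>
    hw _ (hcl.isClosedMap _ h1) (h2.linear_image e) (h3.mono fun n hn => mem_image_of_mem e hn)
  -- Applied to the whole space, this shows that the limit point lies in the image of H₀¹.
  obtain ⟨w', -, rfl⟩ := himg univ isClosed_univ convex_univ (by simp)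
  refine ⟨w', fun C h1 h2 h3 => ?_⟩
  obtain ⟨v, hv, hvw⟩ := himg C h1 h2 h3
  rwa [← hcl.injective hvw]

end Spaces

/-! ### The Sobolev inequality on H₀¹(Ω), up to and including the critical exponent. -/

section Sobolev

variable {N : ℕ} {Ω : Set (Eucl N)}

theorem norm_gradient (ψ : Eucl N → ℝ) (x : Eucl N) : ‖gradient ψ x‖ = ‖fderiv ℝ ψ x‖ := by
  simp [gradient]

/-- A closed property of pairs `(u, ∇u)` valid for test functions holds on `H₀¹(Ω)`. -/
theorem H10_induction {P : Set (Lp ℝ 2 (vol Ω) × Lp (Eucl N) 2 (vol Ω))} (hP : IsClosed P)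
    (h : ∀ ψ, IsTestFunction Ω ψ → ∀ U : Lp ℝ 2 (vol Ω) × Lp (Eucl N) 2 (vol Ω),
      U.1 =ᵐ[vol Ω] ψ → U.2 =ᵐ[vol Ω] (fun x => gradient ψ x) → U ∈ P) (u : H10 Ω) :
    (fn u, grad u) ∈ P := by
  have hsub : (testSubspace Ω : Set (W12 Ω)) ⊆ Subtype.val ⁻¹' P := by
    rintro U ⟨ψ, hψ, h1, h2⟩
    exact h ψ hψ _ h1 h2
  exact closure_minimal hsub (hP.preimage continuous_subtype_val) u.2

/-- The inequality for test functions is the Gagliardo–Nirenberg–Sobolev inequality. It survives L²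
limits of (u, ∇u) because the left side is lower semicontinuous (Fatou) and the right side
continuous. -/
theorem exists_sobolev_const (hN : 2 < N) (hΩ : Bornology.IsBounded Ω) {r : ℝ} (hr : 0 < r)
    (hr2 : r ≤ 2 * (N : ℝ) / ((N : ℝ) - 2)) :
    ∃ C : ℝ≥0, ∀ u : H10 Ω, eLpNorm (fn u) (ENNReal.ofReal r) (vol Ω) ≤
      C * eLpNorm (grad u) 2 (vol Ω) := by
  have hN' : (2 : ℝ) < N := by exact_mod_cast hN
  refine ⟨eLpNormLESNormFDerivOfLeConst ℝ (volume : Measure (Eucl N)) Ω 2 r.toNNReal, fun u => ?_⟩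
  set C := eLpNormLESNormFDerivOfLeConst ℝ (volume : Measure (Eucl N)) Ω 2 r.toNNReal
  refine H10_induction (P := {U | eLpNorm U.1 (ENNReal.ofReal r) (vol Ω) ≤
    C * eLpNorm U.2 2 (vol Ω)}) ?_ ?_ u
  · refine IsSeqClosed.isClosed fun U V hU hUV => ?_
    have h1 : Tendsto (fun n => (U n).1) atTop (𝓝 V.1) := (continuous_fst.tendsto V).comp hUV
    have h2 : Tendsto (fun n => (U n).2) atTop (𝓝 V.2) := (continuous_snd.tendsto V).comp hUV
    obtain ⟨σ, hσ, hae⟩ := ((Lp.tendsto_Lp_iff_tendsto_eLpNorm' _ _).1 h1 |>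
      tendstoInMeasure_of_tendsto_eLpNorm (by norm_num) (fun n => Lp.aestronglyMeasurable _)
        (Lp.aestronglyMeasurable V.1)).exists_seq_tendsto_ae
    have hlim : Tendsto (fun n => C * eLpNorm (U (σ n)).2 2 (vol Ω)) atTop
        (𝓝 (C * eLpNorm V.2 2 (vol Ω))) := by
      refine ENNReal.Tendsto.const_mul ?_ (Or.inr ENNReal.coe_ne_top)
      have := (ENNReal.continuous_ofReal.tendsto _).comp ((h2.comp hσ.tendsto_atTop).norm)
      simpa [Function.comp_def, Lp.norm_def, ENNReal.ofReal_toReal, Lp.eLpNorm_ne_top] using this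
    calc eLpNorm V.1 (ENNReal.ofReal r) (vol Ω)
        ≤ liminf (fun n => eLpNorm (U (σ n)).1 (ENNReal.ofReal r) (vol Ω)) atTop :=
          Lp.eLpNorm_lim_le_liminf_eLpNorm (fun n => Lp.aestronglyMeasurable _) _ hae
      _ ≤ liminf (fun n => C * eLpNorm (U (σ n)).2 2 (vol Ω)) atTop :=
          liminf_le_liminf (Eventually.of_forall fun n => hU _)
      _ = _ := hlim.liminf_eq
  · intro ψ hψ U h1 h2
    have hs : Function.support ψ ⊆ Ω := (subset_tsupport ψ).trans hψ.tsupport_subset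
    have hs' : Function.support (fderiv ℝ ψ) ⊆ Ω :=
      (support_fderiv_subset ℝ).trans hψ.tsupport_subset
    -- This is r ≤ 2N/(N − 2) written with reciprocals.
    have hd : (2 : ℝ≥0)⁻¹ - (Module.finrank ℝ (Eucl N) : ℝ)⁻¹ ≤ (r.toNNReal : ℝ)⁻¹ := by
      rw [Real.coe_toNNReal r hr.le, finrank_euclideanSpace_fin, NNReal.coe_inv, NNReal.coe_ofNat]
      rw [le_div_iff₀ (by linarith)] at hr2
      rw [← sub_nonneg]
      have : r⁻¹ - (2⁻¹ - (N : ℝ)⁻¹) = (2 * N - r * (N - 2)) / (2 * N * r) := by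
        field_simp
      rw [this]
      exact div_nonneg (by linarith) (by positivity)
    have key := eLpNorm_le_eLpNorm_fderiv_of_le (μ := (volume : Measure (Eucl N)))
      (hψ.contDiff.of_le (by exact_mod_cast le_top)) hs (p := 2) (q := r.toNNReal)
      (by norm_num) (by simpa using hN') hd hΩ
    rw [mem_ofPred_eq, eLpNorm_congr_ae h1, eLpNorm_congr_ae h2,
      eLpNorm_congr_norm_ae (Eventually.of_forall (norm_gradient ψ)),
      eLpNorm_restrict_eq_of_support_subset hs, eLpNorm_restrict_eq_of_support_subset hs']
    exact key

/-- The admissible constants form a nonempty closed set, so the infimum defining S_r is attained. -/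
theorem eLpNorm_fn_le_sobolevConst (hN : 2 < N) (hΩ : Bornology.IsBounded Ω) {r : ℝ} (hr : 0 < r)
    (hr2 : r ≤ 2 * (N : ℝ) / ((N : ℝ) - 2)) (u : H10 Ω) :
    (eLpNorm (fn u) (ENNReal.ofReal r) (vol Ω)).toReal ≤ sobolevConst Ω r * ‖grad u‖ := by
  set S : Set ℝ≥0 := {C : ℝ≥0 | ∀ u : H10 Ω, eLpNorm (fn u) (ENNReal.ofReal r) (vol Ω) ≤
    C * eLpNorm (grad u) 2 (vol Ω)}
  have hne : S.Nonempty := exists_sobolev_const hN hΩ hr hr2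
  have hcl : IsClosed S := by
    simp only [S, ofPred_forall]
    exact isClosed_iInter fun u => isClosed_le continuous_const
      ((ENNReal.continuous_mul_const (Lp.eLpNorm_ne_top _)).comp ENNReal.continuous_coe)
  have h : eLpNorm (fn u) (ENNReal.ofReal r) (vol Ω) ≤ (sInf S : ℝ≥0) * eLpNorm (grad u) 2 (vol Ω) :=
    hcl.csInf_mem hne (OrderBot.bddBelow S) u
  have h' := ENNReal.toReal_mono (ENNReal.mul_ne_top ENNReal.coe_ne_top (Lp.eLpNorm_ne_top _)) h
  rwa [ENNReal.toReal_mul] at h'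

theorem memLp_fn (hN : 2 < N) (hΩ : Bornology.IsBounded Ω) {r : ℝ} (hr : 0 < r)
    (hr2 : r ≤ 2 * (N : ℝ) / ((N : ℝ) - 2)) (u : H10 Ω) :
    MemLp (fn u) (ENNReal.ofReal r) (vol Ω) := by
  obtain ⟨C, hC⟩ := exists_sobolev_const hN hΩ hr hr2
  exact ⟨Lp.aestronglyMeasurable _, (hC u).trans_lt
    (ENNReal.mul_lt_top ENNReal.coe_lt_top (Lp.eLpNorm_lt_top _))⟩

end Sobolev

/-! ### Approximation of a test function by its local averages. -/

section Averages

theorem sq_lintegral_le_lintegral_sq {α : Type*} [MeasurableSpace α] (ν : Measure α)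
    [IsProbabilityMeasure ν] {f : α → ℝ≥0∞} (hf : AEMeasurable f ν) :
    (∫⁻ x, f x ∂ν) ^ 2 ≤ ∫⁻ x, f x ^ 2 ∂ν := by
  have h := ENNReal.lintegral_mul_norm_pow_le (μ := ν) (hf.pow_const 2)
    (aemeasurable_const (b := (1 : ℝ≥0∞))) (p := 1 / 2) (q := 1 / 2) (by norm_num) (by norm_num)
    (by norm_num)
  have e : ∀ y : ℝ≥0∞, (y ^ 2) ^ (1 / 2 : ℝ) = y := fun y => by
    rw [← ENNReal.rpow_natCast, ← ENNReal.rpow_mul]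
    norm_num
  simp only [e, ENNReal.one_rpow, mul_one, lintegral_one, measure_univ] at h
  calc (∫⁻ x, f x ∂ν) ^ 2 ≤ ((∫⁻ x, f x ^ 2 ∂ν) ^ (1 / 2 : ℝ)) ^ 2 := by gcongr
    _ = ∫⁻ x, f x ^ 2 ∂ν := by
      rw [← ENNReal.rpow_natCast, ← ENNReal.rpow_mul]
      norm_num

variable {N : ℕ} {ψ : Eucl N → ℝ}

/-- The increment is the integral of the derivative along the segment; apply Cauchy–Schwarz on [0,
1], exchange integrals and use translation invariance. -/
theorem lintegral_enorm_translate_sub_sq_le (hψ : ContDiff ℝ 1 ψ) (h : Eucl N) :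
    ∫⁻ x, ‖ψ (x + h) - ψ x‖ₑ ^ 2 ≤ ‖h‖ₑ ^ 2 * ∫⁻ x, ‖fderiv ℝ ψ x‖ₑ ^ 2 := by
  have hcont : Continuous (fderiv ℝ ψ) := hψ.continuous_fderiv (by norm_num)
  set ν : Measure ℝ := volume.restrict (Ioc 0 1)
  have : IsProbabilityMeasure ν := ⟨by simp [ν]⟩
  have hjoint : Continuous fun z : Eucl N × ℝ => ‖fderiv ℝ ψ (z.1 + z.2 • h)‖ₑ ^ 2 :=
    (ENNReal.continuous_pow 2).comp (hcont.comp (by fun_prop)).enorm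
  have hpt : ∀ x, ‖ψ (x + h) - ψ x‖ₑ ^ 2 ≤
      ∫⁻ t, ‖h‖ₑ ^ 2 * ‖fderiv ℝ ψ (x + t • h)‖ₑ ^ 2 ∂ν := by
    intro x
    have hd : ∀ t : ℝ, HasDerivAt (fun t : ℝ => ψ (x + t • h)) (fderiv ℝ ψ (x + t • h) h) t := by
      intro t
      have h1 : HasDerivAt (fun t : ℝ => x + t • h) h t := by
        simpa using ((hasDerivAt_id t).smul_const h).const_add x
      exact ((hψ.differentiable (by norm_num)) _).hasFDerivAt.comp_hasDerivAt t h1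
    have hc1 : Continuous fun t : ℝ => fderiv ℝ ψ (x + t • h) :=
      hcont.comp (by fun_prop)
    have hc2 : Continuous fun t : ℝ => fderiv ℝ ψ (x + t • h) h := hc1.clm_apply continuous_const
    have hint := intervalIntegral.integral_eq_sub_of_hasDerivAt (fun t _ => hd t)
      (hc2.intervalIntegrable 0 1)
    rw [intervalIntegral.integral_of_le zero_le_one, one_smul, zero_smul, add_zero] at hint
    rw [← hint]
    calc ‖∫ t in Ioc (0 : ℝ) 1, fderiv ℝ ψ (x + t • h) h‖ₑ ^ 2
        ≤ (∫⁻ t, ‖fderiv ℝ ψ (x + t • h) h‖ₑ ∂ν) ^ 2 := by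
          gcongr
          exact enorm_integral_le_lintegral_enorm _
      _ ≤ ∫⁻ t, ‖fderiv ℝ ψ (x + t • h) h‖ₑ ^ 2 ∂ν :=
          sq_lintegral_le_lintegral_sq ν hc2.enorm.aemeasurable
      _ ≤ _ := by
          refine lintegral_mono fun t => ?_
          rw [← mul_pow, mul_comm]
          gcongr
          exact ContinuousLinearMap.le_opENorm _ _
  calc ∫⁻ x, ‖ψ (x + h) - ψ x‖ₑ ^ 2
      ≤ ∫⁻ x, (∫⁻ t, ‖h‖ₑ ^ 2 * ‖fderiv ℝ ψ (x + t • h)‖ₑ ^ 2 ∂ν) := lintegral_mono hpt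
    _ = ∫⁻ t, (∫⁻ x, ‖h‖ₑ ^ 2 * ‖fderiv ℝ ψ (x + t • h)‖ₑ ^ 2) ∂ν :=
        lintegral_lintegral_swap (hjoint.measurable.const_mul _).aemeasurable
    _ = ∫⁻ _, (‖h‖ₑ ^ 2 * ∫⁻ x, ‖fderiv ℝ ψ x‖ₑ ^ 2) ∂ν := by
        refine lintegral_congr fun t => ?_
        rw [lintegral_const_mul' _ _ (by finiteness)]
        congr 1
        exact lintegral_add_right_eq_self (fun x => ‖fderiv ℝ ψ x‖ₑ ^ 2) (t • h)
    _ = _ := by simp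

/-- Averaging the translation estimate over displacements of size at most ε gives the error in L²,
uniformly for a bounded gradient. -/
theorem lintegral_enorm_sub_average_sq_le (hψ : ContDiff ℝ 1 ψ) (hs : HasCompactSupport ψ)
    (ν : Measure (Eucl N)) [IsProbabilityMeasure ν] {ε : ℝ≥0} (hν : ∀ᵐ h ∂ν, ‖h‖ₑ ≤ ε) :
    ∫⁻ x, ‖ψ x - ∫ h, ψ (x + h) ∂ν‖ₑ ^ 2 ≤ ε ^ 2 * ∫⁻ x, ‖fderiv ℝ ψ x‖ₑ ^ 2 := by
  have hc := hψ.continuous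
  obtain ⟨K, hK⟩ := hc.bounded_above_of_compact_support hs
  have hpt : ∀ x, ‖ψ x - ∫ h, ψ (x + h) ∂ν‖ₑ ^ 2 ≤ ∫⁻ h, ‖ψ (x + h) - ψ x‖ₑ ^ 2 ∂ν := by
    intro x
    have hi : Integrable (fun h => ψ (x + h)) ν :=
      Integrable.of_bound (by fun_prop) K (Eventually.of_forall fun h => hK _)
    have e : ψ x - ∫ h, ψ (x + h) ∂ν = ∫ h, (ψ x - ψ (x + h)) ∂ν := by
      rw [integral_sub (integrable_const _) hi]
      simp
    rw [e]
    calc ‖∫ h, (ψ x - ψ (x + h)) ∂ν‖ₑ ^ 2 ≤ (∫⁻ h, ‖ψ x - ψ (x + h)‖ₑ ∂ν) ^ 2 := by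
          gcongr
          exact enorm_integral_le_lintegral_enorm _
      _ ≤ ∫⁻ h, ‖ψ x - ψ (x + h)‖ₑ ^ 2 ∂ν :=
          sq_lintegral_le_lintegral_sq ν (by fun_prop)
      _ = _ := by
          refine lintegral_congr fun h => ?_
          rw [← enorm_neg, neg_sub]
  have hjoint : Continuous fun z : Eucl N × Eucl N => ‖ψ (z.1 + z.2) - ψ z.1‖ₑ ^ 2 :=
    (ENNReal.continuous_pow 2).comp (by fun_prop)
  calc ∫⁻ x, ‖ψ x - ∫ h, ψ (x + h) ∂ν‖ₑ ^ 2
      ≤ ∫⁻ x, (∫⁻ h, ‖ψ (x + h) - ψ x‖ₑ ^ 2 ∂ν) := lintegral_mono hpt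
    _ = ∫⁻ h, (∫⁻ x, ‖ψ (x + h) - ψ x‖ₑ ^ 2) ∂ν :=
        lintegral_lintegral_swap hjoint.measurable.aemeasurable
    _ ≤ ∫⁻ _, (ε ^ 2 * ∫⁻ x, ‖fderiv ℝ ψ x‖ₑ ^ 2) ∂ν := by
        refine lintegral_mono_ae ?_
        filter_upwards [hν] with h hh
        refine (lintegral_enorm_translate_sub_sq_le hψ h).trans ?_
        gcongr
    _ = _ := by simp

end Averages

/-! ### Weak sequential compactness in separable Hilbert spaces. -/

section WeakCompactness

/-- Sequential Banach–Alaoglu in the dual, transported by the Riesz isometry. -/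
theorem exists_subseq_tendsto_inner {H : Type*} [NormedAddCommGroup H] [InnerProductSpace ℝ H]
    [CompleteSpace H] [TopologicalSpace.SeparableSpace H] (u : ℕ → H) {M : ℝ}
    (hM : ∀ n, ‖u n‖ ≤ M) : ∃ σ : ℕ → ℕ, StrictMono σ ∧ ∃ w : H, ∀ v : H,
      Tendsto (fun n => inner ℝ (u (σ n)) v) atTop (𝓝 (inner ℝ w v)) := by
  obtain ⟨F, -, σ, hσ, hF⟩ := WeakDual.isSeqCompact_closedBall ℝ H 0 M
    (x := fun n => StrongDual.toWeakDual (InnerProductSpace.toDual ℝ H (u n)))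
    fun n => by simpa [dist_eq_norm] using hM n
  refine ⟨σ, hσ, (InnerProductSpace.toDual ℝ H).symm (WeakDual.toStrongDual F), fun v => ?_⟩
  have h := ((WeakDual.eval_continuous v).tendsto F).comp hF
  rw [InnerProductSpace.toDual_symm_apply]
  exact h

end WeakCompactness

/-! ### Rellich's theorem. -/

section Rellich

variable {N : ℕ} {Ω : Set (Eucl N)}

/-- An average over a ball is an L² pairing with a fixed indicator, since ψ vanishes off Ω; so weak
convergence makes the averages converge at every point. -/
theorem average_ball_eq_inner {ψ : Eucl N → ℝ} (hs : tsupport ψ ⊆ Ω) {f : Lp ℝ 2 (vol Ω)}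
    (hf : f =ᵐ[vol Ω] ψ) (ε : ℝ) (x : Eucl N) (hx : vol Ω (Metric.ball x ε) ≠ ⊤) :
    ∫ h, ψ (x + h) ∂(ProbabilityTheory.cond volume (Metric.ball (0 : Eucl N) ε)) =
      (volume (Metric.ball (0 : Eucl N) ε))⁻¹.toReal *
        inner ℝ f (indicatorConstLp 2 measurableSet_ball hx (1 : ℝ)) := by
  rw [ProbabilityTheory.cond, integral_smul_measure, smul_eq_mul, real_inner_comm,
    L2.inner_indicatorConstLp_one]
  congr 1
  have h0 : ∀ y, y ∉ Ω → ψ y = 0 := fun y hy =>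
    image_eq_zero_of_notMem_tsupport fun h => hy (hs h)
  calc ∫ h in Metric.ball 0 ε, ψ (x + h)
      = ∫ h, (Metric.ball x ε).indicator ψ (x + h) := by
        rw [← integral_indicator measurableSet_ball]
        refine integral_congr_ae (Eventually.of_forall fun h => ?_)
        simp [indicator, dist_eq_norm]
    _ = ∫ y in Metric.ball x ε, ψ y := by
        rw [integral_add_left_eq_self (fun y => (Metric.ball x ε).indicator ψ y) x,
          integral_indicator measurableSet_ball]
    _ = ∫ y in Metric.ball x ε ∩ Ω, ψ y :=
        setIntegral_eq_of_subset_of_forall_sdiff_eq_zero measurableSet_ball inter_subset_left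
          fun y hy => h0 y fun h => hy.2 ⟨hy.1, h⟩
    _ = ∫ y in Metric.ball x ε, f y ∂(vol Ω) := by
        rw [← Measure.restrict_restrict measurableSet_ball]
        exact integral_congr_ae (EventuallyEq.symm (ae_restrict_of_ae hf))

/-- Along a weakly convergent subsequence the ε-averages converge pointwise and boundedly, hence in
L² of the bounded set Ω. Each function is within ε times its gradient norm of its average, uniformly
in n. -/
theorem exists_subseq_cauchySeq_testFunction (hΩ : Bornology.IsBounded Ω)
    (f : ℕ → Lp ℝ 2 (vol Ω)) (ψ : ℕ → Eucl N → ℝ) (hψ : ∀ n, IsTestFunction Ω (ψ n))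
    (hf : ∀ n, f n =ᵐ[vol Ω] ψ n) {M : ℝ≥0} (hM : ∀ n, ‖f n‖ ≤ M)
    (hD : ∀ n, ∫⁻ x, ‖fderiv ℝ (ψ n) x‖ₑ ^ 2 ≤ (M : ℝ≥0∞) ^ 2) :
    ∃ σ : ℕ → ℕ, StrictMono σ ∧ CauchySeq fun n => f (σ n) := by
  have : Fact ((2 : ℝ≥0∞) ≠ ⊤) := ⟨by norm_num⟩
  have hfin : IsFiniteMeasure (vol Ω) := ⟨by simpa using hΩ.measure_lt_top⟩
  obtain ⟨σ, hσ, w, hw⟩ := exists_subseq_tendsto_inner f hM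
  refine ⟨σ, hσ, EMetric.cauchySeq_iff.2 fun δ hδ => ?_⟩
  -- Four errors: for each of two functions, the distance to its average and from there to the limit
  -- G.
  obtain ⟨δ', hδ'0, hδ'⟩ : ∃ δ' : ℝ≥0, 0 < δ' ∧ (4 : ℝ≥0∞) * δ' < δ := by
    obtain ⟨y, hy0, hy⟩ := ENNReal.lt_iff_exists_nnreal_btwn.1 hδ
    refine ⟨y / 4, by simpa using hy0, ?_⟩
    rwa [ENNReal.coe_div (by norm_num), ENNReal.coe_ofNat, ENNReal.mul_div_cancel (by norm_num)
      (by norm_num)]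
  set ε : ℝ≥0 := δ' / (M + 1) with hε
  have hε0 : 0 < ε := by positivity
  have hεM : (ε : ℝ≥0∞) * M ≤ δ' := by
    rw [← ENNReal.coe_mul, ENNReal.coe_le_coe, hε, div_mul_eq_mul_div]
    refine div_le_of_le_mul₀ (by positivity) (by positivity) ?_
    gcongr
    exact le_self_add
  set ν := ProbabilityTheory.cond volume (Metric.ball (0 : Eucl N) ε)
  have : IsProbabilityMeasure ν := ProbabilityTheory.cond_isProbabilityMeasure_of_finite
    (Metric.measure_ball_pos _ _ hε0).ne' measure_ball_lt_top.ne
  have hν : ∀ᵐ h ∂ν, ‖h‖ₑ ≤ ε := by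
    filter_upwards [ProbabilityTheory.ae_cond_mem measurableSet_ball] with h hh
    rw [enorm_le_coe]
    exact (mem_ball_zero_iff.1 hh).le
  set A : ℕ → Eucl N → ℝ := fun n x => ∫ h, ψ (σ n) (x + h) ∂ν
  set c : ℝ := (volume (Metric.ball (0 : Eucl N) ε))⁻¹.toReal
  have hc : 0 ≤ c := ENNReal.toReal_nonneg
  set I : Eucl N → Lp ℝ 2 (vol Ω) := fun x =>
    indicatorConstLp 2 (measurableSet_ball (x := x) (ε := (ε : ℝ))) (measure_ne_top _ _) (1 : ℝ)
  have hA : ∀ n x, A n x = c * inner ℝ (f (σ n)) (I x) := fun n x =>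
    average_ball_eq_inner (hψ _).tsupport_subset (hf _) _ _ _
  set G : Eucl N → ℝ := fun x => c * inner ℝ w (I x)
  have hAG : ∀ x, Tendsto (fun n => A n x) atTop (𝓝 (G x)) := fun x => by
    simp only [hA]
    exact (hw (I x)).const_mul c
  have hAm : ∀ n, Measurable (A n) := fun n => by
    have hcont : Continuous (Function.uncurry fun x h : Eucl N => ψ (σ n) (x + h)) :=
      (hψ (σ n)).contDiff.continuous.comp continuous_add
    exact (hcont.stronglyMeasurable.integral_prod_right (ν := ν)).measurable
  have hGm : Measurable G := measurable_of_tendsto_metrizable hAm (tendsto_pi_nhds.2 hAG)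
  set D : ℝ := c * (M * (vol Ω).real univ ^ (1 / 2 : ℝ))
  have hI : ∀ x, ‖I x‖ ≤ (vol Ω).real univ ^ (1 / 2 : ℝ) := fun x => by
    rw [norm_indicatorConstLp (by norm_num) (by norm_num), norm_one, one_mul]
    rw [ENNReal.toReal_ofNat]
    gcongr
    · exact measure_ne_top _ _
    · exact subset_univ _
  have hAD : ∀ n x, |A n x| ≤ D := fun n x => by
    rw [hA, abs_mul, abs_of_nonneg hc]
    refine mul_le_mul_of_nonneg_left ((abs_real_inner_le_norm _ _).trans ?_) hc
    exact mul_le_mul (hM _) (hI x) (norm_nonneg _) M.2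
  have hGD : ∀ x, |G x| ≤ D := fun x =>
    le_of_tendsto (hAG x).abs (Eventually.of_forall fun n => hAD n x)
  have hsq : ∀ g : Eucl N → ℝ, eLpNorm g 2 (vol Ω) = (∫⁻ x in Ω, ‖g x‖ₑ ^ 2) ^ (1 / 2 : ℝ) :=
    fun g => by
      rw [eLpNorm_eq_lintegral_rpow_enorm_toReal (by norm_num) (by norm_num)]
      norm_num
  have hlim : Tendsto (fun n => eLpNorm (A n - G) 2 (vol Ω)) atTop (𝓝 0) := by
    have h1 : Tendsto (fun n => ∫⁻ x in Ω, ‖A n x - G x‖ₑ ^ 2) atTop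
        (𝓝 (∫⁻ _ in Ω, (0 : ℝ≥0∞))) := by
      refine tendsto_lintegral_of_dominated_convergence (fun _ => ENNReal.ofReal (D + D) ^ 2)
        (fun n => ((hAm n).sub hGm).enorm.pow_const 2) (fun n => ?_) ?_ ?_
      · refine Eventually.of_forall fun x => ?_
        refine pow_le_pow_left₀ (by simp) ?_ 2
        rw [Real.enorm_eq_ofReal_abs]
        refine ENNReal.ofReal_le_ofReal ((abs_sub _ _).trans (add_le_add (hAD n x) (hGD x)))
      · rw [lintegral_const]
        finiteness
      · refine Eventually.of_forall fun x => ?_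
        have h2 : Tendsto (fun n => A n x - G x) atTop (𝓝 0) := by
          simpa using (hAG x).sub_const (G x)
        simpa [Function.comp_def] using (ENNReal.continuous_pow 2).tendsto _ |>.comp h2.enorm
    have h3 := ((ENNReal.continuous_rpow_const (y := (1 / 2 : ℝ))).tendsto _).comp h1
    simpa [Function.comp_def, hsq] using h3
  have hclose : ∀ n, eLpNorm (ψ (σ n) - A n) 2 (vol Ω) ≤ δ' := fun n => by
    rw [hsq]
    calc (∫⁻ x in Ω, ‖(ψ (σ n) - A n) x‖ₑ ^ 2) ^ (1 / 2 : ℝ)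
        ≤ ((ε : ℝ≥0∞) ^ 2 * (M : ℝ≥0∞) ^ 2) ^ (1 / 2 : ℝ) := by
          gcongr
          refine (setLIntegral_le_lintegral _ _).trans ((lintegral_enorm_sub_average_sq_le
            ((hψ _).contDiff.of_le (by exact_mod_cast le_top)) (hψ _).hasCompactSupport ν hν).trans ?_)
          gcongr
          exact hD _
      _ = ε * M := by
          rw [← mul_pow, ← ENNReal.rpow_natCast, ← ENNReal.rpow_mul]
          norm_num
      _ ≤ δ' := hεM
  obtain ⟨K, hK⟩ := eventually_atTop.1
    (hlim.eventually_le_const (u := (δ' : ℝ≥0∞)) (by exact_mod_cast hδ'0))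
  have hψm : ∀ n, AEStronglyMeasurable (ψ (σ n)) (vol Ω) := fun n =>
    (hψ _).contDiff.continuous.aestronglyMeasurable
  have hfG : ∀ n ≥ K, eLpNorm (⇑(f (σ n)) - G) 2 (vol Ω) ≤ δ' + δ' := fun n hn => by
    have e : ⇑(f (σ n)) - G =ᵐ[vol Ω] (ψ (σ n) - A n) + (A n - G) := by
      filter_upwards [hf (σ n)] with x hx
      simp [hx]
    rw [eLpNorm_congr_ae e]
    exact (eLpNorm_add_le ((hψm n).sub (hAm n).aestronglyMeasurable)
      ((hAm n).sub hGm).aestronglyMeasurable (by norm_num)).trans (add_le_add (hclose n) (hK n hn))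
  refine ⟨K, fun n hn m hm => ?_⟩
  rw [Lp.edist_def]
  have e : ⇑(f (σ n)) - ⇑(f (σ m)) = (⇑(f (σ n)) - G) - (⇑(f (σ m)) - G) := by abel
  rw [e]
  refine ((eLpNorm_sub_le ((Lp.aestronglyMeasurable _).sub hGm.aestronglyMeasurable)
    ((Lp.aestronglyMeasurable _).sub hGm.aestronglyMeasurable) (by norm_num)).trans
    (add_le_add (hfG n hn) (hfG m hm))).trans_lt ?_
  convert hδ' using 1
  ring

/-- Rellich's theorem: `H₀¹(Ω)` embeds compactly into `L²(Ω)`. -/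
theorem exists_subseq_tendsto_fn (hΩ : Bornology.IsBounded Ω) (u : ℕ → H10 Ω) {M : ℝ}
    (hf : ∀ n, ‖fn (u n)‖ ≤ M) (hg : ∀ n, ‖grad (u n)‖ ≤ M) :
    ∃ σ : ℕ → ℕ, StrictMono σ ∧ ∃ f : Lp ℝ 2 (vol Ω), Tendsto (fun n => fn (u (σ n))) atTop (𝓝 f) := by
  have hM : 0 ≤ M := (norm_nonneg _).trans (hf 0)
  -- Replacing u n by a test function at distance below 1/(n+1) changes neither boundedness, up to
  -- the constant 1, nor the L² limit.
  have hnear : ∀ n : ℕ, ∃ V ∈ testSubspace Ω, dist (u n).1 V < 1 / ((n : ℝ) + 1) := fun n =>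
    Metric.mem_closure_iff.1 (u n).2 _ (by positivity)
  choose V hV hd using hnear
  choose ψ hψ h1 h2 using hV
  have hd1 : ∀ n, dist (fn (u n)) (V n).1.1 < 1 / ((n : ℝ) + 1) := fun n =>
    (le_max_left _ _).trans_lt (hd n)
  have hd2 : ∀ n, dist (grad (u n)) (V n).1.2 < 1 / ((n : ℝ) + 1) := fun n =>
    (le_max_right _ _).trans_lt (hd n)
  have hone : ∀ n : ℕ, 1 / ((n : ℝ) + 1) ≤ 1 := fun n => by
    rw [div_le_one (by positivity)]
    linarith [Nat.cast_nonneg (α := ℝ) n]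
  have hb1 : ∀ n, ‖(V n).1.1‖ ≤ (M + 1).toNNReal := fun n => by
    rw [Real.coe_toNNReal _ (by linarith)]
    have := norm_sub_norm_le (V n).1.1 (fn (u n))
    rw [← dist_eq_norm, dist_comm] at this
    linarith [hd1 n, hone n, hf n]
  have hb2 : ∀ n, ∫⁻ x, ‖fderiv ℝ (ψ n) x‖ₑ ^ 2 ≤ ((M + 1).toNNReal : ℝ≥0∞) ^ 2 := fun n => by
    have hn : ‖(V n).1.2‖ ≤ M + 1 := by
      have := norm_sub_norm_le (V n).1.2 (grad (u n))
      rw [← dist_eq_norm, dist_comm] at this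
      linarith [hd2 n, hone n, hg n]
    have hs : Function.support (fderiv ℝ (ψ n)) ⊆ Ω :=
      (support_fderiv_subset ℝ).trans (hψ n).tsupport_subset
    have e : eLpNorm (V n).1.2 2 (vol Ω) = eLpNorm (fderiv ℝ (ψ n)) 2 volume := by
      rw [eLpNorm_congr_ae (h2 n),
        eLpNorm_congr_norm_ae (Eventually.of_forall (norm_gradient (ψ n))),
        eLpNorm_restrict_eq_of_support_subset hs]
    have e2 : eLpNorm (fderiv ℝ (ψ n)) 2 volume ≤ (M + 1).toNNReal := by
      rw [← e, ← ENNReal.ofReal_toReal (Lp.eLpNorm_ne_top (V n).1.2), ← Lp.norm_def]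
      exact ENNReal.ofReal_le_ofReal hn
    rw [eLpNorm_eq_lintegral_rpow_enorm_toReal (by norm_num) (by norm_num)] at e2
    norm_num at e2
    calc ∫⁻ x, ‖fderiv ℝ (ψ n) x‖ₑ ^ 2
        = ((∫⁻ x, ‖fderiv ℝ (ψ n) x‖ₑ ^ 2) ^ (1 / 2 : ℝ)) ^ 2 := by
          rw [← ENNReal.rpow_natCast, ← ENNReal.rpow_mul]
          norm_num
      _ ≤ _ := by gcongr
  obtain ⟨σ, hσ, hcau⟩ := exists_subseq_cauchySeq_testFunction hΩ (fun n => (V n).1.1) ψ hψ h1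
    (M := (M + 1).toNNReal) hb1 hb2
  obtain ⟨g, hg⟩ := cauchySeq_tendsto_of_complete hcau
  refine ⟨σ, hσ, g, ?_⟩
  have hz : Tendsto (fun n => dist ((V (σ n)).1.1) (fn (u (σ n)))) atTop (𝓝 0) :=
    squeeze_zero (fun _ => dist_nonneg) (fun n => by rw [dist_comm]; exact (hd1 (σ n)).le)
      (tendsto_one_div_add_atTop_nhds_zero_nat.comp hσ.tendsto_atTop)
  exact (tendsto_iff_of_dist hz).1 hg

end Rellich

/-! ### Convergence of the power terms. -/

section PowerConvergence

variable {α : Type*} [MeasurableSpace α] {μ : Measure α}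

/-- For a bounded weight w ≥ 0, ∫ w|f|^r is the r-th power of the L^r norm of w^{1/r} f, so norm
continuity suffices. A signed weight is split as (a + c) − c with c = ‖a‖_∞. -/
theorem tendsto_integral_mul_abs_rpow {a : α → ℝ} {f : ℕ → α → ℝ} {g : α → ℝ} {r : ℝ} (hr : 1 < r)
    (ha : MemLp a ⊤ μ) (hf : ∀ n, MemLp (f n) (ENNReal.ofReal r) μ)
    (hg : MemLp g (ENNReal.ofReal r) μ)
    (h : Tendsto (fun n => eLpNorm (f n - g) (ENNReal.ofReal r) μ) atTop (𝓝 0)) :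
    Tendsto (fun n => ∫ x, a x * |f n x| ^ r ∂μ) atTop (𝓝 (∫ x, a x * |g x| ^ r ∂μ)) := by
  have hr0 : 0 < r := by linarith
  have : Fact (1 ≤ ENNReal.ofReal r) := ⟨by simpa using hr.le⟩
  set c := (eLpNorm a ⊤ μ).toReal
  have key : ∀ w : α → ℝ, AEStronglyMeasurable w μ → (∀ᵐ x ∂μ, 0 ≤ w x ∧ w x ≤ 2 * c) →
      Tendsto (fun n => ∫ x, w x * |f n x| ^ r ∂μ) atTop (𝓝 (∫ x, w x * |g x| ^ r ∂μ)) := by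
    intro w hw hwc
    set m : α → ℝ := fun x => w x ^ (1 / r)
    have hm : AEStronglyMeasurable m μ := (hw.aemeasurable.pow_const (1 / r)).aestronglyMeasurable
    have hmb : ∀ᵐ x ∂μ, ‖m x‖ ≤ (2 * c) ^ (1 / r) := by
      filter_upwards [hwc] with x hx
      rw [Real.norm_of_nonneg (Real.rpow_nonneg hx.1 _)]
      exact Real.rpow_le_rpow hx.1 hx.2 (by positivity)
    have hbd : ∀ k : α → ℝ, eLpNorm (fun x => m x * k x) (ENNReal.ofReal r) μ ≤
        ENNReal.ofReal ((2 * c) ^ (1 / r)) * eLpNorm k (ENNReal.ofReal r) μ := fun k => by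
      refine eLpNorm_le_mul_eLpNorm_of_ae_le_mul ?_ _
      filter_upwards [hmb] with x hx
      rw [norm_mul]
      gcongr
    have hmem : ∀ k : α → ℝ, MemLp k (ENNReal.ofReal r) μ →
        MemLp (fun x => m x * k x) (ENNReal.ofReal r) μ := fun k hk =>
      ⟨hm.mul hk.1, (hbd k).trans_lt (ENNReal.mul_lt_top (by simp) hk.2)⟩
    have hint : ∀ k : α → ℝ, MemLp k (ENNReal.ofReal r) μ → ∫ x, w x * |k x| ^ r ∂μ =
        (eLpNorm (fun x => m x * k x) (ENNReal.ofReal r) μ).toReal ^ r := fun k hk => by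
      rw [← integral_abs_rpow hr0 (hmem k hk)]
      refine integral_congr_ae ?_
      filter_upwards [hwc] with x hx
      rw [abs_mul, Real.mul_rpow (abs_nonneg _) (abs_nonneg _), abs_of_nonneg
        (Real.rpow_nonneg hx.1 _), ← Real.rpow_mul hx.1, one_div_mul_cancel hr0.ne', Real.rpow_one]
    have hconv : Tendsto (fun n => eLpNorm ((fun x => m x * f n x) - fun x => m x * g x)
        (ENNReal.ofReal r) μ) atTop (𝓝 0) := by
      have h2 := ENNReal.Tendsto.const_mul (a := ENNReal.ofReal ((2 * c) ^ (1 / r))) h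
        (Or.inr ENNReal.ofReal_ne_top)
      rw [mul_zero] at h2
      refine tendsto_of_tendsto_of_tendsto_of_le_of_le tendsto_const_nhds h2 (fun _ => zero_le)
        fun n => ?_
      refine le_trans (le_of_eq ?_) (hbd (f n - g))
      congr 1
      funext x
      simp [mul_sub]
    have hLp := ((Lp.tendsto_Lp_iff_tendsto_eLpNorm'' _ (fun n => hmem _ (hf n)) _
      (hmem _ hg)).2 hconv).norm
    simp only [Lp.norm_toLp] at hLp
    simp only [hint _ (hf _), hint _ hg]
    exact hLp.rpow_const (Or.inr hr0.le)
  have hc : 0 ≤ c := ENNReal.toReal_nonneg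
  have hab := ae_abs_le_of_memLp_top ha
  have h1 := key (fun x => a x + c) (ha.1.add aestronglyMeasurable_const) <| by
    filter_upwards [hab] with x hx
    have := abs_le.1 hx
    constructor <;> linarith
  have h2 := key (fun _ => c) aestronglyMeasurable_const
    (Eventually.of_forall fun x => ⟨hc, by linarith⟩)
  have e : ∀ k : α → ℝ, MemLp k (ENNReal.ofReal r) μ → ∫ x, a x * |k x| ^ r ∂μ =
      ∫ x, (a x + c) * |k x| ^ r ∂μ - ∫ x, c * |k x| ^ r ∂μ := fun k hk => by
    have hk' := integrable_abs_rpow hr0 hk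
    rw [← integral_sub _ (hk'.const_mul c)]
    · refine integral_congr_ae (Eventually.of_forall fun x => ?_)
      simp only
      ring
    · refine ((integrable_mul_of_memLp_top ha hk').add (hk'.const_mul c)).congr
        (Eventually.of_forall fun x => ?_)
      simp only [Pi.add_apply]
      ring
  simp only [e _ (hf _), e _ hg]
  exact h1.sub h2

theorem lintegral_rpow_interpolation {f : α → ℝ≥0∞} (hf : AEMeasurable f μ) {r s : ℝ} (hr : 2 < r)
    (hs : r < s) : ∫⁻ x, f x ^ r ∂μ ≤ (∫⁻ x, f x ^ (2 : ℝ) ∂μ) ^ ((s - r) / (s - 2)) *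
      (∫⁻ x, f x ^ s ∂μ) ^ ((r - 2) / (s - 2)) := by
  have h0 : 0 < s - 2 := by linarith
  have h1 : 0 ≤ (s - r) / (s - 2) := div_nonneg (by linarith) h0.le
  have h2 : 0 ≤ (r - 2) / (s - 2) := div_nonneg (by linarith) h0.le
  refine le_trans (le_of_eq ?_) (ENNReal.lintegral_mul_norm_pow_le (hf.pow_const 2) (hf.pow_const s)
    h1 h2 (by field_simp; ring))
  refine lintegral_congr fun x => ?_
  rw [← ENNReal.rpow_mul, ← ENNReal.rpow_mul, ← ENNReal.rpow_add_of_nonneg _ _ (by positivity)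
    (mul_nonneg (by linarith) h2)]
  congr 1
  field_simp
  ring

/-- For r ≤ 2 the measure is finite, so the L² norm controls the L^r norm; for 2 < r < s interpolate
between L² and L^s. -/
theorem tendsto_eLpNorm_of_tendsto_of_bounded [IsFiniteMeasure μ] {f : ℕ → α → ℝ}
    (hf : ∀ n, AEStronglyMeasurable (f n) μ) {r s : ℝ} (hr : 0 < r) (hrs : r < s) (hs : 2 < s)
    (h2 : Tendsto (fun n => eLpNorm (f n) 2 μ) atTop (𝓝 0)) {K : ℝ≥0}
    (hK : ∀ n, eLpNorm (f n) (ENNReal.ofReal s) μ ≤ K) :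
    Tendsto (fun n => eLpNorm (f n) (ENNReal.ofReal r) μ) atTop (𝓝 0) := by
  have htwo : ENNReal.ofReal 2 = 2 := by simp
  rcases le_or_gt r 2 with hr2 | hr2
  · have hle : ENNReal.ofReal r ≤ 2 := by rw [← htwo]; exact ENNReal.ofReal_le_ofReal hr2
    set D := μ univ ^ (1 / (ENNReal.ofReal r).toReal - 1 / (2 : ℝ≥0∞).toReal)
    have hD : D ≠ ⊤ := by
      refine ENNReal.rpow_ne_top_of_nonneg ?_ (measure_ne_top μ univ)
      rw [ENNReal.toReal_ofReal hr.le, ENNReal.toReal_ofNat, sub_nonneg]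
      exact one_div_le_one_div_of_le hr hr2
    have h3 := ENNReal.Tendsto.mul_const (b := D) h2 (Or.inr hD)
    rw [zero_mul] at h3
    exact tendsto_of_tendsto_of_tendsto_of_le_of_le tendsto_const_nhds h3 (fun _ => zero_le)
      fun n => eLpNorm_le_eLpNorm_mul_rpow_measure_univ hle (hf n)
  · have hs0 : 0 < s := by linarith
    have hint : ∀ t : ℝ, 0 < t → ∀ n, eLpNorm (f n) (ENNReal.ofReal t) μ =
        (∫⁻ x, ‖f n x‖ₑ ^ t ∂μ) ^ (1 / t) := fun t ht n => by
      rw [eLpNorm_eq_lintegral_rpow_enorm_toReal (by simpa using ht) ENNReal.ofReal_ne_top,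
        ENNReal.toReal_ofReal ht.le]
    have hinv : ∀ t : ℝ, 0 < t → ∀ n, ∫⁻ x, ‖f n x‖ₑ ^ t ∂μ =
        eLpNorm (f n) (ENNReal.ofReal t) μ ^ t := fun t ht n => by
      rw [hint t ht, ← ENNReal.rpow_mul, one_div_mul_cancel ht.ne', ENNReal.rpow_one]
    have h1 : 0 < (s - r) / (s - 2) := div_pos (by linarith) (by linarith)
    have h1' : 0 < (r - 2) / (s - 2) := div_pos (by linarith) (by linarith)
    set D := ((K : ℝ≥0∞) ^ s) ^ ((r - 2) / (s - 2))
    have hD : D ≠ ⊤ := by finiteness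
    have hlim : Tendsto (fun n => ((eLpNorm (f n) 2 μ ^ (2 : ℝ)) ^ ((s - r) / (s - 2)) * D) ^ (1 / r))
        atTop (𝓝 0) := by
      have e1 := h2.ennrpow_const 2
      have e2 := ENNReal.Tendsto.mul_const (b := D) (e1.ennrpow_const ((s - r) / (s - 2))) (Or.inr hD)
      have e3 := e2.ennrpow_const (1 / r)
      rwa [ENNReal.zero_rpow_of_pos two_pos, ENNReal.zero_rpow_of_pos h1, zero_mul,
        ENNReal.zero_rpow_of_pos (by positivity)] at e3
    refine tendsto_of_tendsto_of_tendsto_of_le_of_le tendsto_const_nhds hlim (fun _ => zero_le)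
      fun n => ?_
    simp only
    rw [hint r hr]
    gcongr
    refine (lintegral_rpow_interpolation (hf n).enorm hr2 hrs).trans ?_
    rw [hinv 2 two_pos, hinv s hs0, htwo]
    exact mul_le_mul' le_rfl
      (ENNReal.rpow_le_rpow (ENNReal.rpow_le_rpow (hK n) hs0.le) h1'.le)

end PowerConvergence

/-! ### The pair (u, ∇u) as one Hilbert-valued L² function. -/

section Pairing

variable {N : ℕ} {Ω : Set (Eucl N)}

/-- The map `u ↦ (u, ∇u)` into a single `L²` space. -/
noncomputable def pairing : H10 Ω →L[ℝ] Lp (WithLp 2 (ℝ × Eucl N)) 2 (vol Ω) :=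
  (((WithLp.prodContinuousLinearEquiv 2 ℝ ℝ (Eucl N)).symm.toContinuousLinearMap.comp
      (ContinuousLinearMap.inl ℝ ℝ (Eucl N))).compLpL 2 (vol Ω) ∘L
        ContinuousLinearMap.fst ℝ (Lp ℝ 2 (vol Ω)) (Lp (Eucl N) 2 (vol Ω)) +
    ((WithLp.prodContinuousLinearEquiv 2 ℝ ℝ (Eucl N)).symm.toContinuousLinearMap.comp
      (ContinuousLinearMap.inr ℝ ℝ (Eucl N))).compLpL 2 (vol Ω) ∘L
        ContinuousLinearMap.snd ℝ (Lp ℝ 2 (vol Ω)) (Lp (Eucl N) 2 (vol Ω))) ∘L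
    (W12 Ω).subtypeL ∘L (H10 Ω).subtypeL

theorem pairing_ae (u : H10 Ω) :
    pairing u =ᵐ[vol Ω] fun x => WithLp.toLp 2 (fn u x, grad u x) := by
  set L₁ := (WithLp.prodContinuousLinearEquiv 2 ℝ ℝ (Eucl N)).symm.toContinuousLinearMap.comp
      (ContinuousLinearMap.inl ℝ ℝ (Eucl N))
  set L₂ := (WithLp.prodContinuousLinearEquiv 2 ℝ ℝ (Eucl N)).symm.toContinuousLinearMap.comp
      (ContinuousLinearMap.inr ℝ ℝ (Eucl N))
  have e : pairing u = L₁.compLp (fn u) + L₂.compLp (grad u) := rfl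
  rw [e]
  filter_upwards [Lp.coeFn_add (L₁.compLp (fn u)) (L₂.compLp (grad u)), L₁.coeFn_compLp (fn u),
    L₂.coeFn_compLp (grad u)] with x h1 h2 h3
  rw [h1, Pi.add_apply, h2, h3]
  change WithLp.toLp 2 (fn u x, (0 : Eucl N)) + WithLp.toLp 2 ((0 : ℝ), grad u x) = _
  rw [← WithLp.toLp_add]
  simp

attribute [irreducible] pairing

theorem dens_ae (u : H10 Ω) : dens u =ᵐ[vol Ω] fun x => ‖pairing u x‖ ^ 2 / 2 := by
  filter_upwards [pairing_ae u] with x hx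
  rw [hx, WithLp.prod_norm_sq_eq_of_L2, dens]
  simp

theorem inner_pairing_ae (u v : H10 Ω) :
    (fun x => fn u x * fn v x + inner ℝ (grad u x) (grad v x)) =ᵐ[vol Ω]
      fun x => inner ℝ (pairing u x) (pairing v x) := by
  filter_upwards [pairing_ae u, pairing_ae v] with x hu hv
  rw [hu, hv, WithLp.prod_inner_apply, Real.inner_apply, mul_comm (fn u x)]

theorem pairing_comb_ae (u v : H10 Ω) (t s : ℝ) :
    pairing (t • u + s • v) =ᵐ[vol Ω] fun x => t • pairing u x + s • pairing v x := by
  have e : pairing (t • u + s • v) = t • pairing u + s • pairing v := by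
    rw [map_add, map_smul, map_smul]
  rw [e]
  generalize pairing u = U
  generalize pairing v = V
  filter_upwards [Lp.coeFn_add (t • U) (s • V), Lp.coeFn_smul t U, Lp.coeFn_smul s V]
    with x h1 h2 h3
  rw [h1, Pi.add_apply, h2, h3, Pi.smul_apply, Pi.smul_apply]

theorem fn_comb_ae (u v : H10 Ω) (t s : ℝ) :
    fn (t • u + s • v) =ᵐ[vol Ω] fun x => t * fn u x + s * fn v x := by
  rw [fn_add, fn_smul, fn_smul]
  filter_upwards [Lp.coeFn_add (t • fn u) (s • fn v), Lp.coeFn_smul t (fn u),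
    Lp.coeFn_smul s (fn v)] with x h1 h2 h3
  rw [h1, Pi.add_apply, h2, h3]
  rfl

theorem fn_smul_ae (t : ℝ) (u : H10 Ω) : fn (t • u) =ᵐ[vol Ω] fun x => t * fn u x :=
  Lp.coeFn_smul t (fn u)

theorem dens_smul_ae (t : ℝ) (u : H10 Ω) : dens (t • u) =ᵐ[vol Ω] fun x => t ^ 2 * dens u x := by
  filter_upwards [fn_smul_ae t u, Lp.coeFn_smul t (grad u)] with x h1 h2
  have h2' : grad (t • u) x = t • grad u x := h2
  rw [dens, dens, h1, h2', norm_smul, mul_pow, mul_pow, Real.norm_eq_abs, sq_abs]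
  ring

theorem dens_nonneg (u : H10 Ω) (x : Eucl N) : 0 ≤ dens u x := by
  unfold dens
  positivity

theorem integrable_dens (u : H10 Ω) : Integrable (dens u) (vol Ω) :=
  (integrable_half_norm_sq (Lp.memLp (pairing u))).congr (dens_ae u).symm

theorem integral_dens (u : H10 Ω) :
    ∫ x in Ω, dens u x = (‖fn u‖ ^ 2 + ‖grad u‖ ^ 2) / 2 := by
  unfold dens
  have h : ∀ {F : Type} [NormedAddCommGroup F] (g : Lp F 2 (vol Ω)),
      ∫ x in Ω, ‖g x‖ ^ 2 = ‖g‖ ^ 2 := fun g => by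
    have := (Lp.memLp g).eLpNorm_eq_integral_rpow_norm (by norm_num) (by norm_num)
    rw [Lp.norm_def, this, ENNReal.toReal_ofReal (by positivity)]
    norm_num
    rw [← Real.sqrt_eq_rpow, Real.sq_sqrt (integral_nonneg fun x => by positivity)]
  rw [integral_div, integral_add, h (grad u), ← h (fn u)]
  · simp
  · exact (Lp.memLp (fn u)).integrable_sq
  · exact (Lp.memLp (grad u)).integrable_norm_pow (by norm_num)

end Pairing

/-- The standing assumptions on the domain, the exponents, the weights and the diffusion
coefficient, the latter being extended to a bounded continuous function on the line. -/
structure Setting {N : ℕ} (Ω : Set (Eucl N)) (φ : ℝ → ℝ) (p q : ℝ) (a b : Eucl N → ℝ)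
    (ρ₀ ρ₁ ρ₂ : ℝ) : Prop where
  dim : 2 < N
  bounded : Bornology.IsBounded Ω
  q_pos : 0 < q
  q_lt : q < 1
  p_gt : 1 < p
  p_lt : p + 1 < 2 * (N : ℝ) / ((N : ℝ) - 2)
  a_bdd : MemLp a ⊤ (vol Ω)
  b_bdd : MemLp b ⊤ (vol Ω)
  cont : Continuous φ
  contDiff : ContDiffOn ℝ 2 φ (Ici 0)
  pos : 0 < ρ₀
  lower : ∀ s, ρ₀ ≤ φ s
  upper : ∀ s, φ s ≤ ρ₁
  dphi_le : ∀ s, 0 ≤ s → |dphi φ s| * s ≤ ρ₂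
  concave : ∀ s, 0 ≤ s → (1 - q) * (1 - p) * φ s + 2 * (4 - p - q) * dphi φ s * s
      + 4 * ddphi φ s * s ^ 2 ≤ 0
  convex : ConvexOn ℝ (Ici 0) (fun t : ℝ => primitive φ (t ^ 2))

theorem sobolevConst_nonneg {N : ℕ} (Ω : Set (Eucl N)) (r : ℝ) : 0 ≤ sobolevConst Ω r :=
  NNReal.coe_nonneg _

/-! ### Estimates and derivatives of J along lines and rays. -/

section Calculus

variable {N : ℕ} {Ω : Set (Eucl N)}

/-- `∫ a |u|^r`. -/
noncomputable def powerInt (a : Eucl N → ℝ) (r : ℝ) (u : H10 Ω) : ℝ := ∫ x in Ω, a x * |fn u x| ^ r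

/-- `∫ Φ((u² + |∇u|²)/2)`. -/
noncomputable def energy (φ : ℝ → ℝ) (u : H10 Ω) : ℝ := ∫ x in Ω, primitive φ (dens u x)

variable {φ : ℝ → ℝ} {p q : ℝ} {a b : Eucl N → ℝ} {lam ρ₀ ρ₁ ρ₂ : ℝ}

theorem J_eq (u : H10 Ω) : J φ p q a b lam u =
    energy φ u - lam / (q + 1) * powerInt a (q + 1) u - 1 / (p + 1) * powerInt b (p + 1) u := rfl

theorem powerInt_smul (a : Eucl N → ℝ) (r : ℝ) {t : ℝ} (ht : 0 ≤ t) (u : H10 Ω) :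
    powerInt a r (t • u) = t ^ r * powerInt a r u := by
  rw [powerInt, powerInt, ← integral_const_mul]
  refine integral_congr_ae ?_
  filter_upwards [fn_smul_ae t u] with x hx
  rw [hx, abs_mul, Real.mul_rpow (abs_nonneg _) (abs_nonneg _), abs_of_nonneg ht]
  ring

theorem energy_eq (u : H10 Ω) :
    energy φ u = ∫ x in Ω, primitive φ (‖pairing u x‖ ^ 2 / 2) := by
  refine integral_congr_ae ?_
  filter_upwards [dens_ae u] with x hx
  rw [hx]

theorem power_kernel_self {r : ℝ} (hr : 1 < r) (w : ℝ) : |w| ^ (r - 2) * w * w = |w| ^ r := by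
  rw [mul_assoc, ← abs_mul_abs_self w, ← mul_assoc, abs_rpow_sub_two_mul_abs hr]
  have := abs_rpow_sub_two_mul_abs (r := r + 1) (by linarith) w
  rw [show r + 1 - 2 = r - 1 by ring, show r + 1 - 1 = r by ring] at this
  exact this

theorem dJ_self (hq : 0 < q) (hp : 0 < p) (u : H10 Ω) : dJ φ p q a b lam u u =
    (∫ x in Ω, φ (dens u x) * (2 * dens u x)) - lam * powerInt a (q + 1) u -
      powerInt b (p + 1) u := by
  have h : ∀ (c : Eucl N → ℝ) {r : ℝ}, 0 < r →
      ∫ x in Ω, c x * (|fn u x| ^ (r - 1) * fn u x * fn u x) = powerInt c (r + 1) u :=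
    fun c r hr => by
      refine integral_congr_ae (Eventually.of_forall fun x => ?_)
      have := power_kernel_self (r := r + 1) (by linarith) (fn u x)
      rw [show r + 1 - 2 = r - 1 by ring] at this
      simp only [this]
  rw [dJ, h a hq, h b hp]
  congr 2
  refine integral_congr_ae (Eventually.of_forall fun x => ?_)
  simp only [dens, real_inner_self_eq_norm_sq]
  ring

theorem J_eq_of_ae (w : H10 Ω) {f : Eucl N → ℝ} {W : Eucl N → WithLp 2 (ℝ × Eucl N)}
    (hf : fn w =ᵐ[vol Ω] f) (hW : pairing w =ᵐ[vol Ω] W) : J φ p q a b lam w =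
      (∫ x in Ω, primitive φ (‖W x‖ ^ 2 / 2)) - lam / (q + 1) * (∫ x in Ω, a x * |f x| ^ (q + 1)) -
        1 / (p + 1) * ∫ x in Ω, b x * |f x| ^ (p + 1) := by
  have h : ∀ (c : Eucl N → ℝ) (r : ℝ), powerInt c r w = ∫ x in Ω, c x * |f x| ^ r := fun c r => by
    refine integral_congr_ae ?_
    filter_upwards [hf] with x hx
    rw [hx]
  have h' : energy φ w = ∫ x in Ω, primitive φ (‖W x‖ ^ 2 / 2) := by
    rw [energy_eq]
    refine integral_congr_ae ?_
    filter_upwards [hW] with x hx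
    rw [hx]
  rw [J_eq, h, h, h']

theorem dJ_eq_of_ae (w v : H10 Ω) {f : Eucl N → ℝ} {W : Eucl N → WithLp 2 (ℝ × Eucl N)}
    (hf : fn w =ᵐ[vol Ω] f) (hW : pairing w =ᵐ[vol Ω] W) : dJ φ p q a b lam w v =
      (∫ x in Ω, φ (‖W x‖ ^ 2 / 2) * inner ℝ (W x) (pairing v x)) -
      lam * (∫ x in Ω, a x * (|f x| ^ (q + 1 - 2) * f x * fn v x)) -
      ∫ x in Ω, b x * (|f x| ^ (p + 1 - 2) * f x * fn v x) := by
  have h : ∀ (c : Eucl N → ℝ) (r : ℝ), ∫ x in Ω, c x * (|fn w x| ^ (r - 1) * fn w x * fn v x) =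
      ∫ x in Ω, c x * (|f x| ^ (r + 1 - 2) * f x * fn v x) := fun c r => by
    refine integral_congr_ae ?_
    filter_upwards [hf] with x hx
    rw [hx, show r + 1 - 2 = r - 1 by ring]
  have h' : ∫ x in Ω, φ (dens w x) * (fn w x * fn v x + inner ℝ (grad w x) (grad v x)) =
      ∫ x in Ω, φ (‖W x‖ ^ 2 / 2) * inner ℝ (W x) (pairing v x) := by
    refine integral_congr_ae ?_
    filter_upwards [dens_ae w, inner_pairing_ae w v, hW] with x h1 h2 h3
    rw [h1, h2, h3]
  rw [dJ, h a q, h b p, h']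

theorem dJ_comb (u v : H10 Ω) (z : ℝ × ℝ) :
    dJ φ p q a b lam (z.1 • u + z.2 • v) v =
      (∫ x in Ω, φ (‖z.1 • pairing u x + z.2 • pairing v x‖ ^ 2 / 2) *
        inner ℝ (z.1 • pairing u x + z.2 • pairing v x) (pairing v x)) -
      lam * (∫ x in Ω, a x * (|z.1 * fn u x + z.2 * fn v x| ^ (q + 1 - 2) *
        (z.1 * fn u x + z.2 * fn v x) * fn v x)) -
      ∫ x in Ω, b x * (|z.1 * fn u x + z.2 * fn v x| ^ (p + 1 - 2) *
        (z.1 * fn u x + z.2 * fn v x) * fn v x) :=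
  dJ_eq_of_ae _ v (fn_comb_ae u v z.1 z.2) (pairing_comb_ae u v z.1 z.2)

namespace Setting

variable (S : Setting Ω φ p q a b ρ₀ ρ₁ ρ₂)
include S

theorem two_lt : (2 : ℝ) < 2 * (N : ℝ) / ((N : ℝ) - 2) := by
  linarith [S.p_lt, S.p_gt]

theorem memLp_q (u : H10 Ω) : MemLp (fn u) (ENNReal.ofReal (q + 1)) (vol Ω) :=
  memLp_fn S.dim S.bounded (by linarith [S.q_pos]) (by linarith [S.two_lt, S.q_lt]) u

theorem memLp_p (u : H10 Ω) : MemLp (fn u) (ENNReal.ofReal (p + 1)) (vol Ω) :=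
  memLp_fn S.dim S.bounded (by linarith [S.p_gt]) S.p_lt.le u

theorem abs_powerInt_q_le (u : H10 Ω) : |powerInt a (q + 1) u| ≤
    supNorm Ω a * sobolevConst Ω (q + 1) ^ (q + 1) * ‖grad u‖ ^ (q + 1) := by
  have hr : 0 < q + 1 := by linarith [S.q_pos]
  refine (abs_integral_mul_abs_rpow_le hr S.a_bdd (S.memLp_q u)).trans ?_
  rw [mul_assoc, ← Real.mul_rpow (sobolevConst_nonneg _ _) (norm_nonneg _)]
  exact mul_le_mul_of_nonneg_left (Real.rpow_le_rpow ENNReal.toReal_nonneg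
    (eLpNorm_fn_le_sobolevConst S.dim S.bounded hr (by linarith [S.two_lt, S.q_lt]) u) hr.le)
    ENNReal.toReal_nonneg

theorem abs_powerInt_p_le (u : H10 Ω) : |powerInt b (p + 1) u| ≤
    supNorm Ω b * sobolevConst Ω (p + 1) ^ (p + 1) * ‖grad u‖ ^ (p + 1) := by
  have hr : 0 < p + 1 := by linarith [S.p_gt]
  refine (abs_integral_mul_abs_rpow_le hr S.b_bdd (S.memLp_p u)).trans ?_
  rw [mul_assoc, ← Real.mul_rpow (sobolevConst_nonneg _ _) (norm_nonneg _)]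
  exact mul_le_mul_of_nonneg_left (Real.rpow_le_rpow ENNReal.toReal_nonneg
    (eLpNorm_fn_le_sobolevConst S.dim S.bounded hr S.p_lt.le u) hr.le) ENNReal.toReal_nonneg

/-- If ∇u = 0, the Sobolev inequality forces the L^{q+1} norm of u to vanish. -/
theorem grad_pos {u : H10 Ω} (hu : fn u ≠ 0) : 0 < ‖grad u‖ := by
  refine (norm_nonneg _).lt_of_ne fun h => hu ?_
  have hr : 0 < q + 1 := by linarith [S.q_pos]
  have h1 := eLpNorm_fn_le_sobolevConst S.dim S.bounded hr (by linarith [S.two_lt, S.q_lt]) u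
  rw [← h, mul_zero] at h1
  have h2 : eLpNorm (fn u) (ENNReal.ofReal (q + 1)) (vol Ω) = 0 := by
    rcases (ENNReal.toReal_eq_zero_iff _).1 (le_antisymm h1 ENNReal.toReal_nonneg) with h | h
    · exact h
    · exact absurd h (S.memLp_q u).2.ne
  rw [eLpNorm_eq_zero_iff (Lp.aestronglyMeasurable _) (by simpa using hr)] at h2
  exact (Lp.eq_zero_iff_ae_eq_zero).2 h2

theorem exists_norm_fn_le : ∃ K : ℝ, 0 ≤ K ∧ ∀ u : H10 Ω, ‖fn u‖ ≤ K * ‖grad u‖ := by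
  refine ⟨sobolevConst Ω 2, NNReal.coe_nonneg _, fun u => ?_⟩
  simpa [Lp.norm_def] using eLpNorm_fn_le_sobolevConst S.dim S.bounded two_pos S.two_lt.le u

theorem rho_le : ρ₀ ≤ ρ₁ := (S.lower 0).trans (S.upper 0)

theorem integrable_primitive_dens (u : H10 Ω) :
    Integrable (fun x => primitive φ (dens u x)) (vol Ω) := by
  refine (integrable_primitive S.cont S.pos S.lower S.upper (Lp.memLp (pairing u))).congr ?_
  filter_upwards [dens_ae u] with x hx
  rw [hx]

theorem le_energy (u : H10 Ω) : ρ₀ / 2 * (‖fn u‖ ^ 2 + ‖grad u‖ ^ 2) ≤ energy φ u := by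
  have h : ρ₀ / 2 * (‖fn u‖ ^ 2 + ‖grad u‖ ^ 2) = ∫ x in Ω, ρ₀ * dens u x := by
    rw [integral_const_mul, integral_dens]
    ring
  rw [h]
  exact integral_mono ((integrable_dens u).const_mul _) (S.integrable_primitive_dens u)
    fun x => mul_le_primitive S.cont S.lower (dens_nonneg u x)

theorem energy_le (u : H10 Ω) : energy φ u ≤ ρ₁ / 2 * (‖fn u‖ ^ 2 + ‖grad u‖ ^ 2) := by
  have h : ρ₁ / 2 * (‖fn u‖ ^ 2 + ‖grad u‖ ^ 2) = ∫ x in Ω, ρ₁ * dens u x := by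
    rw [integral_const_mul, integral_dens]
    ring
  rw [h]
  exact integral_mono (S.integrable_primitive_dens u) ((integrable_dens u).const_mul _)
    fun x => primitive_le_mul S.cont S.upper (dens_nonneg u x)

/-- Differentiability along lines replaces Fréchet differentiability throughout. -/
theorem hasDerivAt_J (u v : H10 Ω) (t₀ : ℝ) :
    HasDerivAt (fun t : ℝ => J φ p q a b lam (u + t • v)) (dJ φ p q a b lam (u + t₀ • v) v) t₀ := by
  have hJ : (fun t : ℝ => J φ p q a b lam (u + t • v)) = fun t =>
      (∫ x in Ω, primitive φ (‖pairing u x + t • pairing v x‖ ^ 2 / 2)) -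
      lam / (q + 1) * (∫ x in Ω, a x * |fn u x + t * fn v x| ^ (q + 1)) -
      1 / (p + 1) * ∫ x in Ω, b x * |fn u x + t * fn v x| ^ (p + 1) := by
    funext t
    have e1 := fn_comb_ae u v 1 t
    have e2 := pairing_comb_ae u v 1 t
    simp only [one_smul, one_mul] at e1 e2
    exact J_eq_of_ae _ e1 e2
  have hd := dJ_comb (φ := φ) (p := p) (q := q) (a := a) (b := b) (lam := lam) u v (1, t₀)
  simp only [one_smul, one_mul] at hd
  have hq0 : q + 1 ≠ 0 := by linarith [S.q_pos]
  have hp0 : p + 1 ≠ 0 := by linarith [S.p_gt]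
  have haux : ∀ x y z : ℝ, x - lam / (q + 1) * ((q + 1) * y) - 1 / (p + 1) * ((p + 1) * z) =
      x - lam * y - z := fun x y z => by field_simp
  have h1 := hasDerivAt_integral_primitive S.cont S.pos S.lower S.upper (Lp.memLp (pairing u))
    (Lp.memLp (pairing v)) t₀
  have h2 := (hasDerivAt_integral_abs_rpow (by linarith [S.q_pos]) S.a_bdd (S.memLp_q u)
    (S.memLp_q v) t₀).const_mul (lam / (q + 1))
  have h3 := (hasDerivAt_integral_abs_rpow (by linarith [S.p_gt]) S.b_bdd (S.memLp_p u)
    (S.memLp_p v) t₀).const_mul (1 / (p + 1))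
  refine (((h1.sub h2).sub h3).congr_of_eventuallyEq
    (Eventually.of_forall fun t => congrFun hJ t)).congr_deriv (Eq.trans ?_ hd.symm)
  exact haux _ _ _

theorem continuousAt_dJ (u v : H10 Ω) :
    ContinuousAt (fun z : ℝ × ℝ => dJ φ p q a b lam (z.1 • u + z.2 • v) v) (1, 0) := by
  simp only [dJ_comb u v]
  exact ((continuousAt_integral_quasilinear_kernel S.cont S.pos S.lower S.upper
    (Lp.memLp (pairing u)) (Lp.memLp (pairing v))).sub
    (continuousAt_const.mul (continuousAt_integral_power_kernel (by linarith [S.q_pos]) S.a_bdd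
      (S.memLp_q u) (S.memLp_q v)))).sub
    (continuousAt_integral_power_kernel (by linarith [S.p_gt]) S.b_bdd (S.memLp_p u) (S.memLp_p v))

theorem hasDerivAt_fiber (u : H10 Ω) (t : ℝ) :
    HasDerivAt (fiber φ p q a b lam u) (dJ φ p q a b lam (t • u) u) t := by
  have h := S.hasDerivAt_J (lam := lam) 0 u t
  simp only [zero_add] at h
  exact h

/-- Homogeneity in the second slot follows by differentiating J along the ray through tu in two
parametrizations. -/
theorem dJ_smul_self (u : H10 Ω) (t : ℝ) :
    dJ φ p q a b lam (t • u) (t • u) = t * dJ φ p q a b lam (t • u) u := by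
  have h1 := S.hasDerivAt_fiber (lam := lam) (t • u) 1
  have h2 : HasDerivAt (fun s : ℝ => fiber φ p q a b lam u (s * t)) (dJ φ p q a b lam (t • u) u * t) 1 := by
    have h3 := S.hasDerivAt_fiber (lam := lam) u (1 * t)
    rw [one_mul] at h3
    have h4 : HasDerivAt (fun s : ℝ => s * t) t 1 := by simpa using (hasDerivAt_id (1 : ℝ)).mul_const t
    rw [← one_mul t] at h3
    have := h3.comp 1 h4
    rwa [one_mul] at this
  have e : (fun s : ℝ => fiber φ p q a b lam u (s * t)) = fiber φ p q a b lam (t • u) := by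
    funext s
    simp [fiber, mul_smul]
  rw [e] at h2
  rw [one_smul] at h1
  rw [h1.unique h2, mul_comm]

theorem dJ_ray {t : ℝ} (ht : 0 < t) (u : H10 Ω) : dJ φ p q a b lam (t • u) u =
    (∫ x in Ω, φ (t ^ 2 * dens u x) * (t * (2 * dens u x))) - lam * (t ^ q * powerInt a (q + 1) u)
      - t ^ p * powerInt b (p + 1) u := by
  have h := S.dJ_smul_self (lam := lam) u t
  rw [dJ_self S.q_pos (by linarith [S.p_gt]), powerInt_smul _ _ ht.le, powerInt_smul _ _ ht.le,
    Real.rpow_add_one ht.ne', Real.rpow_add_one ht.ne'] at h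
  have e : ∫ x in Ω, φ (dens (t • u) x) * (2 * dens (t • u) x) =
      t * ∫ x in Ω, φ (t ^ 2 * dens u x) * (t * (2 * dens u x)) := by
    rw [← integral_const_mul]
    refine integral_congr_ae ?_
    filter_upwards [dens_smul_ae t u] with x hx
    rw [hx]
    ring
  rw [e] at h
  have ht0 := ht.ne'
  refine (mul_left_cancel₀ ht0 ?_).symm
  rw [← h]
  ring

/-- The second derivative of the fibering map on the positive half-line. -/
theorem hasDerivAt_dJ_ray {t : ℝ} (ht : 0 < t) (u : H10 Ω) :
    HasDerivAt (fun s : ℝ => dJ φ p q a b lam (s • u) u)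
      (raySecond φ 0 (vol Ω) (dens u) t - lam * (q * t ^ (q - 1) * powerInt a (q + 1) u)
        - p * t ^ (p - 1) * powerInt b (p + 1) u) t := by
  have h1 := hasDerivAt_integral_scaled_kernel S.cont S.contDiff S.pos S.lower S.upper S.dphi_le
    (integrable_dens u) (dens_nonneg u) ht
  have h2 := ((Real.hasDerivAt_rpow_const (p := q) (Or.inl ht.ne')).mul_const
    (powerInt a (q + 1) u)).const_mul lam
  have h3 := (Real.hasDerivAt_rpow_const (p := p) (Or.inl ht.ne')).mul_const (powerInt b (p + 1) u)
  refine ((h1.sub h2).sub h3).congr_of_eventuallyEq ?_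
  filter_upwards [Ioi_mem_nhds ht] with s hs
  exact S.dJ_ray hs u

theorem iteratedDeriv_two_fiber {t : ℝ} (ht : 0 < t) (u : H10 Ω) :
    iteratedDeriv 2 (fiber φ p q a b lam u) t =
      raySecond φ 0 (vol Ω) (dens u) t - lam * (q * t ^ (q - 1) * powerInt a (q + 1) u)
        - p * t ^ (p - 1) * powerInt b (p + 1) u := by
  have e : deriv (fiber φ p q a b lam u) = fun s => dJ φ p q a b lam (s • u) u :=
    funext fun s => (S.hasDerivAt_fiber u s).deriv
  rw [iteratedDeriv_succ, iteratedDeriv_one, e, (S.hasDerivAt_dJ_ray ht u).deriv]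

/-- Since γ_{tu}(s) = γ_u(st), whether tu belongs to N⁺ or N⁻ can be read from γ_u at t. -/
theorem iteratedDeriv_two_fiber_smul {t : ℝ} (ht : 0 < t) (u : H10 Ω) :
    iteratedDeriv 2 (fiber φ p q a b lam (t • u)) 1 =
      t ^ 2 * iteratedDeriv 2 (fiber φ p q a b lam u) t := by
  rw [S.iteratedDeriv_two_fiber one_pos, S.iteratedDeriv_two_fiber ht, powerInt_smul _ _ ht.le,
    powerInt_smul _ _ ht.le]
  have e : raySecond φ 0 (vol Ω) (dens (t • u)) 1 = t ^ 2 * raySecond φ 0 (vol Ω) (dens u) t := by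
    rw [raySecond, raySecond, ← integral_const_mul]
    refine integral_congr_ae ?_
    filter_upwards [dens_smul_ae t u] with x hx
    rw [hx]
    ring_nf
  have e1 : ∀ r : ℝ, t ^ (r + 1) = t ^ 2 * t ^ (r - 1) := fun r => by
    rw [← Real.rpow_natCast, ← Real.rpow_add ht]
    congr 1
    push_cast
    ring
  rw [e, e1, e1, Real.one_rpow, Real.one_rpow]
  ring

end Setting

end Calculus

/-! ### Test functions in H₀¹(Ω), and directions where a weighted integral is positive. -/

section TestFunctions

variable {N : ℕ} {Ω : Set (Eucl N)} {ψ : Eucl N → ℝ}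

theorem IsTestFunction.memLp_gradient (h : IsTestFunction Ω ψ) :
    MemLp (fun x => gradient ψ x) 2 (vol Ω) := by
  have hc : Continuous (fderiv ℝ ψ) := h.contDiff.continuous_fderiv (by simp)
  have hg : Continuous fun x => gradient ψ x :=
    (InnerProductSpace.toDual ℝ (Eucl N)).symm.continuous.comp hc
  have hs : HasCompactSupport fun x => gradient ψ x :=
    (h.hasCompactSupport.fderiv (𝕜 := ℝ)).comp_left
      (g := (InnerProductSpace.toDual ℝ (Eucl N)).symm) (map_zero _)
  exact (hg.memLp_of_hasCompactSupport hs).restrict Ω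

theorem gradient_apply (x : Eucl N) (i : Fin N) : gradient ψ x i = partialDeriv i ψ x := by
  have h : inner ℝ (gradient ψ x) (EuclideanSpace.single i (1 : ℝ)) = partialDeriv i ψ x :=
    InnerProductSpace.toDual_symm_apply
  rw [← h, EuclideanSpace.inner_single_right]
  simp

theorem IsTestFunction.hasWeakGradient (h : IsTestFunction Ω ψ) :
    HasWeakGradient Ω ψ fun x => gradient ψ x := by
  intro χ hχ i
  simp only [gradient_apply]
  have hz : ∀ {ψ : Eucl N → ℝ}, IsTestFunction Ω ψ → ∀ x, x ∉ Ω → ψ x = 0 := fun h x hx =>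
    image_eq_zero_of_notMem_tsupport fun h' => hx (h.tsupport_subset h')
  rw [setIntegral_eq_integral_of_forall_compl_eq_zero fun x hx => by rw [hz h x hx, zero_mul],
    setIntegral_eq_integral_of_forall_compl_eq_zero fun x hx => by rw [hz hχ x hx, mul_zero]]
  have hc : ∀ {ψ : Eucl N → ℝ}, IsTestFunction Ω ψ → Continuous ψ := fun h => h.contDiff.continuous
  have hdc : ∀ {ψ : Eucl N → ℝ}, IsTestFunction Ω ψ →
      Continuous fun x => fderiv ℝ ψ x (EuclideanSpace.single i 1) := fun h =>
    (h.contDiff.continuous_fderiv (by simp)).clm_apply continuous_const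
  refine integral_mul_fderiv_eq_neg_fderiv_mul_of_integrable ?_ ?_ ?_
    (fun x _ => h.contDiff.differentiable (by simp) x)
    (fun x _ => hχ.contDiff.differentiable (by simp) x)
  · exact ((hdc h).mul (hc hχ)).integrable_of_hasCompactSupport hχ.hasCompactSupport.mul_left
  · exact ((hc h).mul (hdc hχ)).integrable_of_hasCompactSupport h.hasCompactSupport.mul_right
  · exact ((hc h).mul (hc hχ)).integrable_of_hasCompactSupport hχ.hasCompactSupport.mul_left

theorem IsTestFunction.exists_H10 (h : IsTestFunction Ω ψ) : ∃ u : H10 Ω, fn u =ᵐ[vol Ω] ψ := by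
  have h1 := h.memLp.coeFn_toLp
  have h2 := h.memLp_gradient.coeFn_toLp
  have hW : ((h.memLp.toLp ψ, h.memLp_gradient.toLp _) :
      Lp ℝ 2 (vol Ω) × Lp (Eucl N) 2 (vol Ω)) ∈ W12 Ω := by
    intro χ hχ i
    have e1 : ∫ x in Ω, h.memLp.toLp ψ x * partialDeriv i χ x =
        ∫ x in Ω, ψ x * partialDeriv i χ x := by
      refine integral_congr_ae ?_
      filter_upwards [h1] with x hx
      rw [hx]
    have e2 : ∫ x in Ω, h.memLp_gradient.toLp _ x i * χ x = ∫ x in Ω, gradient ψ x i * χ x := by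
      refine integral_congr_ae ?_
      filter_upwards [h2] with x hx
      rw [hx]
    exact e1.trans ((h.hasWeakGradient χ hχ i).trans (congrArg Neg.neg e2.symm))
  exact ⟨⟨⟨_, hW⟩, Submodule.le_topologicalClosure _ ⟨ψ, h, h1, h2⟩⟩, h1⟩

/-- A bump function supported in a closed ball on which c is positive. -/
theorem exists_powerInt_pos (hΩ : IsOpen Ω) {c : Eucl N → ℝ} (hc : ContinuousOn c Ω)
    (hcb : MemLp c ⊤ (vol Ω)) {x₀ : Eucl N} (hx₀ : x₀ ∈ Ω) (hpos : 0 < c x₀) {r : ℝ} (hr : 0 < r) :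
    ∃ u : H10 Ω, 0 < powerInt c r u := by
  have hnhds : {x | x ∈ Ω ∧ 0 < c x} ∈ 𝓝 x₀ := by
    have h1 := hΩ.mem_nhds hx₀
    have h2 := (hc.continuousAt h1).eventually_const_lt hpos
    filter_upwards [h1, h2] with x h h'
    exact ⟨h, h'⟩
  obtain ⟨ε, hε, hball⟩ := Metric.nhds_basis_closedBall.mem_iff.1 hnhds
  let f : ContDiffBump x₀ := ⟨ε / 2, ε, by positivity, by linarith⟩
  have hts : tsupport f = Metric.closedBall x₀ ε := f.tsupport_eq
  have hf : IsTestFunction Ω f := ⟨f.contDiff, f.hasCompactSupport, fun x hx =>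
    (hball (hts ▸ hx)).1⟩
  obtain ⟨u, hu⟩ := hf.exists_H10
  refine ⟨u, ?_⟩
  have e : powerInt c r u = ∫ x in Ω, c x * |f x| ^ r := by
    refine integral_congr_ae ?_
    filter_upwards [hu] with x hx
    rw [hx]
  have hmem : MemLp (f : Eucl N → ℝ) (ENNReal.ofReal r) (vol Ω) :=
    (hf.contDiff.continuous.memLp_of_hasCompactSupport hf.hasCompactSupport).restrict Ω
  have hi := integrable_mul_of_memLp_top hcb (integrable_abs_rpow hr hmem)
  have hnn : ∀ x, 0 ≤ c x * |f x| ^ r := fun x => by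
    by_cases hx : x ∈ Metric.closedBall x₀ ε
    · exact mul_nonneg (hball hx).2.le (by positivity)
    · have : f x = 0 := f.zero_of_le_dist (le_of_lt (by simpa using hx))
      simp [this, Real.zero_rpow hr.ne']
  rw [e, integral_pos_iff_support_of_nonneg hnn hi]
  refine lt_of_lt_of_le (Metric.measure_ball_pos volume x₀ hε) ?_
  have hsub : Metric.ball x₀ ε ⊆ Ω := fun x hx => (hball (Metric.ball_subset_closedBall hx)).1
  have e2 : volume (Metric.ball x₀ ε) = vol Ω (Metric.ball x₀ ε) := by
    rw [Measure.restrict_apply measurableSet_ball, inter_eq_left.2 hsub]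
  rw [e2]
  refine measure_mono fun x hx => ?_
  have h1 : 0 < f x := f.pos_of_mem_ball hx
  exact (mul_pos (hball (Metric.ball_subset_closedBall hx)).2
    (Real.rpow_pos_of_pos (abs_pos.2 h1.ne') r)).ne'

end TestFunctions

/-! ### Compactness and lower semicontinuity along bounded sequences. -/

section Compactness

variable {N : ℕ} {Ω : Set (Eucl N)} {φ : ℝ → ℝ} {p q : ℝ} {a b : Eucl N → ℝ} {lam ρ₀ ρ₁ ρ₂ : ℝ}

theorem convex_setOf_norm_sub_le {F : Type*} [NormedAddCommGroup F] [NormedSpace ℝ F]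
    (L : H10 Ω → F) (hadd : ∀ u v, L (u + v) = L u + L v) (hsmul : ∀ (c : ℝ) u, L (c • u) = c • L u)
    (f : F) (r : ℝ) : Convex ℝ {u : H10 Ω | dist (L u) f ≤ r} :=
  (convex_closedBall f r).is_linear_preimage (f := L) ⟨hadd, hsmul⟩

namespace Setting

variable (S : Setting Ω φ p q a b ρ₀ ρ₁ ρ₂)
include S

theorem convex_setOf_energy_le (t c : ℝ) : Convex ℝ {u : H10 Ω | energy φ (t • u) ≤ c} := by
  have h := convex_setOf_integral_primitive_le (μ := vol Ω) (E := WithLp 2 (ℝ × Eucl N)) S.cont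
    S.pos S.lower S.upper S.convex c
  simp only [energy_eq]
  exact h.is_linear_preimage (f := fun u : H10 Ω => pairing (t • u))
    ⟨fun u v => by rw [smul_add, map_add], fun k u => by rw [smul_comm, map_smul]⟩

theorem isClosed_setOf_energy_le (t c : ℝ) : IsClosed {u : H10 Ω | energy φ (t • u) ≤ c} := by
  have h := isClosed_setOf_integral_primitive_le (μ := vol Ω) (E := WithLp 2 (ℝ × Eucl N)) S.cont
    S.pos S.lower S.upper c
  simp only [energy_eq]
  have hc : Continuous fun u : H10 Ω => pairing (t • u) :=
    pairing.continuous.comp (continuous_const_smul t)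
  exact h.preimage hc

theorem tendsto_powerInt {u : ℕ → H10 Ω} {w : H10 Ω} {M : ℝ} (hu : ∀ n, ‖grad (u n)‖ ≤ M)
    (h : Tendsto (fun n => fn (u n)) atTop (𝓝 (fn w))) {c : Eucl N → ℝ} (hc : MemLp c ⊤ (vol Ω))
    {r : ℝ} (hr : 1 < r) (hr2 : r < 2 * (N : ℝ) / ((N : ℝ) - 2)) :
    Tendsto (fun n => powerInt c r (u n)) atTop (𝓝 (powerInt c r w)) := by
  have hr0 : 0 < r := by linarith
  have : IsFiniteMeasure (vol Ω) := ⟨by simpa using S.bounded.measure_lt_top⟩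
  refine tendsto_integral_mul_abs_rpow hr hc (fun n => memLp_fn S.dim S.bounded hr0 hr2.le _)
    (memLp_fn S.dim S.bounded hr0 hr2.le _) ?_
  set s := 2 * (N : ℝ) / ((N : ℝ) - 2)
  have hs0 : 0 < s := by linarith
  set K : ℝ := sobolevConst Ω s * (M + ‖grad w‖)
  refine tendsto_eLpNorm_of_tendsto_of_bounded (s := s) (K := K.toNNReal) (fun n =>
    (Lp.aestronglyMeasurable _).sub (Lp.aestronglyMeasurable _)) hr0 hr2 S.two_lt
    ((Lp.tendsto_Lp_iff_tendsto_eLpNorm' _ _).1 h) fun n => ?_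
  -- The difference is realized as an element of H₀¹ so that the critical Sobolev inequality bounds
  -- it; interpolation then upgrades L² convergence to L^r.
  have e1 : fn (u n + (-1 : ℝ) • w) =ᵐ[vol Ω] fn (u n) - fn w := by
    have := fn_comb_ae (u n) w 1 (-1)
    rw [one_smul] at this
    filter_upwards [this] with x hx
    rw [hx, Pi.sub_apply]
    ring
  rw [← eLpNorm_congr_ae e1, ← ENNReal.ofReal_toReal (memLp_fn S.dim S.bounded hs0 le_rfl _).2.ne]
  refine ENNReal.ofReal_le_ofReal ((eLpNorm_fn_le_sobolevConst S.dim S.bounded hs0 le_rfl _).trans ?_)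
  refine mul_le_mul_of_nonneg_left ?_ (sobolevConst_nonneg _ _)
  rw [grad_add, grad_smul]
  refine (norm_add_le _ _).trans ?_
  rw [norm_smul, norm_neg, norm_one, one_mul]
  gcongr
  exact hu n

/-- Weak sequential compactness of bounded sets together with the weak lower semicontinuity of
`J` along rays. -/
theorem exists_limit (u : ℕ → H10 Ω) {M : ℝ} (hu : ∀ n, ‖grad (u n)‖ ≤ M) :
    ∃ σ : ℕ → ℕ, StrictMono σ ∧ ∃ w : H10 Ω, ‖grad w‖ ≤ M ∧
      Tendsto (fun n => powerInt b (p + 1) (u (σ n))) atTop (𝓝 (powerInt b (p + 1) w)) ∧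
      ∀ t : ℝ, 0 ≤ t → ∀ (c : ℕ → ℝ) (l : ℝ), Tendsto c atTop (𝓝 l) →
        (∀ n, J φ p q a b lam (t • u (σ n)) ≤ c n) → J φ p q a b lam (t • w) ≤ l := by
  obtain ⟨K, hK, hfn⟩ := S.exists_norm_fn_le
  have hM : 0 ≤ M := (norm_nonneg _).trans (hu 0)
  have hf1 : ∀ n, ‖fn (u n)‖ ≤ max M (K * M) := fun n =>
    ((hfn _).trans (mul_le_mul_of_nonneg_left (hu n) hK)).trans (le_max_right _ _)
  have hg1 : ∀ n, ‖grad (u n)‖ ≤ max M (K * M) := fun n => (hu n).trans (le_max_left _ _)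
  obtain ⟨σ, hσ, f, hf⟩ := exists_subseq_tendsto_fn S.bounded u hf1 hg1
  obtain ⟨w, hw⟩ := exists_mem_of_eventually_mem_convex_H10 (fun n => u (σ n))
    (fun n => hf1 _) (fun n => hg1 _)
  -- Small balls around the strong limit f are closed and convex, which identifies the function of w
  -- with f.
  have hwf : fn w = f := by
    refine eq_of_forall_dist_le fun ε hε => ?_
    refine hw {v | dist (fn v) f ≤ ε} (isClosed_le (continuous_fn.dist continuous_const)
      continuous_const) (convex_setOf_norm_sub_le _ fn_add fn_smul _ _) ?_
    filter_upwards [eventually_atTop.2 (Metric.tendsto_atTop.1 hf ε hε)] with n hn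
    exact hn.le
  have hwg : dist (grad w) 0 ≤ M := by
    refine hw {v | dist (grad v) 0 ≤ M} (isClosed_le (continuous_grad.dist continuous_const)
      continuous_const) (convex_setOf_norm_sub_le _ grad_add grad_smul _ _) ?_
    exact Eventually.of_forall fun n => by simpa using hu _
  rw [← hwf] at hf
  have hA : Tendsto (fun n => powerInt a (q + 1) (u (σ n))) atTop (𝓝 (powerInt a (q + 1) w)) :=
    S.tendsto_powerInt (fun n => hu _) hf S.a_bdd (by linarith [S.q_pos])
      (by linarith [S.q_lt, S.two_lt])
  have hB : Tendsto (fun n => powerInt b (p + 1) (u (σ n))) atTop (𝓝 (powerInt b (p + 1) w)) :=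
    S.tendsto_powerInt (fun n => hu _) hf S.b_bdd (by linarith [S.p_gt]) S.p_lt
  refine ⟨σ, hσ, w, by simpa using hwg, hB, fun t ht c l hc hJ => ?_⟩
  -- The two power terms converge, so the bound on J becomes an asymptotic bound on the energy,
  -- whose sublevel sets are closed and convex. The same w and σ serve every t, as needed for
  -- projecting w onto N⁻ afterwards.
  have hsplit : ∀ v : H10 Ω, energy φ (t • v) = J φ p q a b lam (t • v) +
      lam / (q + 1) * (t ^ (q + 1) * powerInt a (q + 1) v) +
      1 / (p + 1) * (t ^ (p + 1) * powerInt b (p + 1) v) := fun v => by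
    rw [J_eq, powerInt_smul _ _ ht, powerInt_smul _ _ ht]
    ring
  have hlim := (hc.add ((hA.const_mul (t ^ (q + 1))).const_mul (lam / (q + 1)))).add
    ((hB.const_mul (t ^ (p + 1))).const_mul (1 / (p + 1)))
  have hE : energy φ (t • w) ≤ l + lam / (q + 1) * (t ^ (q + 1) * powerInt a (q + 1) w) +
      1 / (p + 1) * (t ^ (p + 1) * powerInt b (p + 1) w) := by
    refine le_of_forall_gt_imp_ge_of_dense fun e he => ?_
    refine hw {v | energy φ (t • v) ≤ e} (S.isClosed_setOf_energy_le t e)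
      (S.convex_setOf_energy_le t e) ?_
    filter_upwards [hlim.eventually_le_const he] with n hn
    rw [hsplit]
    linarith [hJ n]
  rw [hsplit] at hE
  linarith

end Setting

end Compactness

/-- The best constant in `∫ |c| |u|^r ≤ C ‖∇u‖^r` obtained from the Sobolev constant. -/
noncomputable def weightConst {N : ℕ} (Ω : Set (Eucl N)) (c : Eucl N → ℝ) (r : ℝ) : ℝ :=
  supNorm Ω c * sobolevConst Ω r ^ r

/-- The smallness condition on `λ` together with the structural inequalities it refers to. -/
structure Threshold {N : ℕ} (Ω : Set (Eucl N)) (φ : ℝ → ℝ) (p q : ℝ) (a b : Eucl N → ℝ)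
    (ρ₀ ρ₁ ρ₂ ρ₃ ρ₅ lam : ℝ) : Prop extends Setting Ω φ p q a b ρ₀ ρ₁ ρ₂ where
  gap : 2 / (p + 1) * ρ₁ < ρ₀
  rho3_pos : 0 < ρ₃
  rho3_le : ∀ s, 0 ≤ s → ρ₃ ≤ (1 - q) * φ s + 2 * dphi φ s * s
  rho5_pos : 0 < ρ₅
  rho5_le : ∀ s, 0 ≤ s → ρ₅ + 2 * dphi φ s * s ≤ (p - 1) * φ s
  lam_pos : 0 < lam
  lam_lt_one : lam < lambda1 Ω p q a b ρ₃ ρ₅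
  lam_lt_two : lam < lambda2 Ω p q a b ρ₀ ρ₁

/-! ### Shape of the fibering maps and absence of degenerate Nehari points. -/

section Fiber

variable {N : ℕ} {Ω : Set (Eucl N)} {φ : ℝ → ℝ} {p q : ℝ} {a b : Eucl N → ℝ}
  {lam ρ₀ ρ₁ ρ₂ ρ₃ ρ₅ : ℝ}

theorem weightConst_nonneg (c : Eucl N → ℝ) (r : ℝ) : 0 ≤ weightConst Ω c r :=
  mul_nonneg ENNReal.toReal_nonneg (Real.rpow_nonneg (sobolevConst_nonneg _ _) _)

theorem lambda1_eq : lambda1 Ω p q a b ρ₃ ρ₅ = ρ₅ / ((p - q) * weightConst Ω a (q + 1)) *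
    (ρ₃ / ((p - q) * weightConst Ω b (p + 1))) ^ ((1 - q) / (p - 1)) := by
  rw [lambda1, weightConst, weightConst, mul_assoc, mul_assoc]

/-- The sign of the derivative of `t ↦ t^{-q} γ_u'(t)`. -/
noncomputable def rayDisc (φ : ℝ → ℝ) (p q : ℝ) (b : Eucl N → ℝ) (u : H10 Ω) (t : ℝ) : ℝ :=
  raySecond φ q (vol Ω) (dens u) t - (p - q) * t ^ (p - 1) * powerInt b (p + 1) u

theorem integral_ray (u : H10 Ω) (t : ℝ) :
    ∫ x in Ω, φ (t ^ 2 * dens u x) * (t * (2 * dens u x)) =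
      t * ∫ x in Ω, φ (t ^ 2 * dens u x) * (2 * dens u x) := by
  rw [← integral_const_mul]
  refine integral_congr_ae (Eventually.of_forall fun x => ?_)
  simp only
  ring

namespace Setting

variable (S : Setting Ω φ p q a b ρ₀ ρ₁ ρ₂)
include S

theorem p_sub_q_pos : 0 < p - q := by linarith [S.p_gt, S.q_lt]

theorem raySecond_sub_dens (u : H10 Ω) (q' q'' t : ℝ) :
    raySecond φ q' (vol Ω) (dens u) t = raySecond φ q'' (vol Ω) (dens u) t +
      (q'' - q') * ∫ x in Ω, φ (t ^ 2 * dens u x) * (2 * dens u x) :=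
  raySecond_sub S.cont S.contDiff S.pos S.lower S.upper S.dphi_le (integrable_dens u)
    (dens_nonneg u) _ _ _

/-- Adding a multiple of γ_u' absorbs the a-term: `rayDisc` depends neither on λ nor on a, and
equals γ_u'' at critical points. -/
theorem iteratedDeriv_two_eq_rayDisc {t : ℝ} (ht : 0 < t) (u : H10 Ω) :
    iteratedDeriv 2 (fiber φ p q a b lam u) t =
      rayDisc φ p q b u t + q / t * dJ φ p q a b lam (t • u) u := by
  rw [S.iteratedDeriv_two_fiber ht, S.dJ_ray ht, rayDisc, S.raySecond_sub_dens u 0 q,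
    integral_ray]
  have e : ∀ r : ℝ, t ^ r = t ^ (r - 1) * t := fun r => by
    rw [← Real.rpow_add_one ht.ne', sub_add_cancel]
  rw [e q, e p]
  generalize ∫ x in Ω, φ (t ^ 2 * dens u x) * (2 * dens u x) = Y
  have := ht.ne'
  field_simp
  ring

theorem iteratedDeriv_two_eq_of_critical {t : ℝ} (ht : 0 < t) {u : H10 Ω}
    (h : dJ φ p q a b lam (t • u) u = 0) :
    iteratedDeriv 2 (fiber φ p q a b lam u) t = rayDisc φ p q b u t := by
  rw [S.iteratedDeriv_two_eq_rayDisc ht, h, mul_zero, add_zero]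

/-- The companion formula, in which the Nehari equation eliminates the b-term instead. -/
theorem iteratedDeriv_two_one_eq {u : H10 Ω} (h : dJ φ p q a b lam u u = 0) :
    iteratedDeriv 2 (fiber φ p q a b lam u) 1 =
      raySecond φ p (vol Ω) (dens u) 1 + lam * (p - q) * powerInt a (q + 1) u := by
  have h' := dJ_self (φ := φ) (a := a) (b := b) (lam := lam) S.q_pos (by linarith [S.p_gt] : 0 < p) u
  rw [h] at h'
  rw [S.iteratedDeriv_two_fiber one_pos, S.raySecond_sub_dens u 0 p]
  simp only [Real.one_rpow, one_pow, one_mul, mul_one, sub_zero]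
  linear_combination (-p) * h'

theorem hasDerivAt_rpow_mul_dJ {t : ℝ} (ht : 0 < t) (u : H10 Ω) :
    HasDerivAt (fun s : ℝ => s ^ (-q) * dJ φ p q a b lam (s • u) u)
      (t ^ (-q) * rayDisc φ p q b u t) t := by
  have h1 := Real.hasDerivAt_rpow_const (p := -q) (Or.inl ht.ne')
  have h2 := S.hasDerivAt_dJ_ray (lam := lam) ht u
  rw [← S.iteratedDeriv_two_fiber ht, S.iteratedDeriv_two_eq_rayDisc ht] at h2
  refine (h1.mul h2).congr_deriv ?_
  have e : t ^ (-q - 1) = t ^ (-q) / t := Real.rpow_sub_one ht.ne' _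
  rw [e]
  have := ht.ne'
  field_simp
  ring

/-- The factor t^{1-p} turns the b-term into a constant, leaving the antitone quasilinear part. -/
theorem rayDisc_antitone {u : H10 Ω} {t₁ t₂ : ℝ} (h1 : 0 < t₁) (h : t₁ ≤ t₂) :
    t₂ ^ (1 - p) * rayDisc φ p q b u t₂ ≤ t₁ ^ (1 - p) * rayDisc φ p q b u t₁ := by
  have h2 : 0 < t₂ := h1.trans_le h
  have key := rpow_mul_raySecond_antitoneOn S.cont S.contDiff S.pos S.lower S.upper S.dphi_le
    S.concave (integrable_dens u) (dens_nonneg u) (mem_Ioi.2 h1) (mem_Ioi.2 h2) h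
  have e : ∀ t : ℝ, 0 < t → t ^ (1 - p) * rayDisc φ p q b u t =
      t ^ (1 - p) * raySecond φ q (vol Ω) (dens u) t - (p - q) * powerInt b (p + 1) u := by
    intro t ht
    have : t ^ (1 - p) * t ^ (p - 1) = 1 := by
      rw [← Real.rpow_add ht]
      norm_num
    rw [rayDisc]
    linear_combination (-(p - q) * powerInt b (p + 1) u) * this
  rw [e _ h1, e _ h2]
  exact sub_le_sub_right key _

theorem rayDisc_neg_of_le {u : H10 Ω} {t₁ t₂ : ℝ} (h1 : 0 < t₁) (h : t₁ ≤ t₂)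
    (hd : rayDisc φ p q b u t₁ < 0) : rayDisc φ p q b u t₂ < 0 := by
  have h2 : 0 < t₂ := h1.trans_le h
  have := (S.rayDisc_antitone (u := u) h1 h).trans_lt
    (mul_neg_of_pos_of_neg (Real.rpow_pos_of_pos h1 _) hd)
  exact (pos_iff_neg_of_mul_neg this).1 (Real.rpow_pos_of_pos h2 _)

theorem rayDisc_pos_of_le {u : H10 Ω} {t₁ t₂ : ℝ} (h1 : 0 < t₁) (h : t₁ ≤ t₂)
    (hd : 0 < rayDisc φ p q b u t₂) : 0 < rayDisc φ p q b u t₁ := by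
  have h2 : 0 < t₂ := h1.trans_le h
  have := (mul_pos (Real.rpow_pos_of_pos h2 _) hd).trans_le (S.rayDisc_antitone (u := u) h1 h)
  exact (pos_iff_pos_of_mul_pos this).1 (Real.rpow_pos_of_pos h1 _)

/-- From t₁ on, t^{-q} γ_u'(t) is strictly decreasing and starts at zero. -/
theorem dJ_ray_neg_of_gt {u : H10 Ω} {t₁ t₂ : ℝ} (h1 : 0 < t₁) (h : t₁ < t₂)
    (hz : dJ φ p q a b lam (t₁ • u) u = 0) (hd : rayDisc φ p q b u t₁ < 0) :
    dJ φ p q a b lam (t₂ • u) u < 0 := by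
  have hpos : ∀ t ∈ Ici t₁, 0 < t := fun t ht => h1.trans_le ht
  have hanti := strictAntiOn_of_deriv_neg (convex_Ici t₁)
    (fun t ht => (S.hasDerivAt_rpow_mul_dJ (lam := lam) (hpos t ht) u).continuousAt.continuousWithinAt)
    fun t ht => by
      have ht' := interior_subset ht
      rw [(S.hasDerivAt_rpow_mul_dJ (lam := lam) (hpos t ht') u).deriv]
      exact mul_neg_of_pos_of_neg (Real.rpow_pos_of_pos (hpos t ht') _)
        (S.rayDisc_neg_of_le h1 ht' hd)
  have := hanti (mem_Ici.2 le_rfl) (mem_Ici.2 h.le) h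
  simp only [hz, mul_zero] at this
  exact (pos_iff_neg_of_mul_neg this).1 (Real.rpow_pos_of_pos (h1.trans h) _)

/-- Up to t₂, t^{-q} γ_u'(t) is strictly increasing and ends at zero. -/
theorem dJ_ray_neg_of_lt {u : H10 Ω} {t₁ t₂ : ℝ} (h1 : 0 < t₁) (h : t₁ < t₂)
    (hz : dJ φ p q a b lam (t₂ • u) u = 0) (hd : 0 < rayDisc φ p q b u t₂) :
    dJ φ p q a b lam (t₁ • u) u < 0 := by
  have hpos : ∀ t ∈ Ioc 0 t₂, 0 < t := fun t ht => ht.1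
  have hmono := strictMonoOn_of_deriv_pos (convex_Ioc 0 t₂)
    (fun t ht => (S.hasDerivAt_rpow_mul_dJ (lam := lam) (hpos t ht) u).continuousAt.continuousWithinAt)
    fun t ht => by
      have ht' := interior_subset ht
      rw [(S.hasDerivAt_rpow_mul_dJ (lam := lam) (hpos t ht') u).deriv]
      exact mul_pos (Real.rpow_pos_of_pos (hpos t ht') _) (S.rayDisc_pos_of_le ht'.1 ht'.2 hd)
  have := hmono ⟨h1, h.le⟩ ⟨h1.trans h, le_rfl⟩ h
  simp only [hz, mul_zero] at this
  exact (pos_iff_neg_of_mul_neg this).1 (Real.rpow_pos_of_pos h1 _)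

theorem J_zero : J φ p q a b lam (0 : H10 Ω) = 0 := by
  have h := powerInt_smul a (q + 1) le_rfl (0 : H10 Ω)
  have h' := powerInt_smul b (p + 1) le_rfl (0 : H10 Ω)
  rw [smul_zero, Real.zero_rpow (by linarith [S.q_pos]), zero_mul] at h
  rw [smul_zero, Real.zero_rpow (by linarith [S.p_gt]), zero_mul] at h'
  have h1 := S.le_energy (0 : H10 Ω)
  have h2 := S.energy_le (0 : H10 Ω)
  have e1 : fn (0 : H10 Ω) = 0 := rfl
  have e2 : grad (0 : H10 Ω) = 0 := rfl
  rw [e1, e2, norm_zero, norm_zero] at h1 h2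
  rw [J_eq, h, h']
  linarith

theorem continuous_J_ray (u : H10 Ω) : Continuous fun t : ℝ => J φ p q a b lam (t • u) :=
  continuous_iff_continuousAt.2 fun t => (S.hasDerivAt_fiber u t).continuousAt

end Setting

namespace Threshold

variable (T : Threshold Ω φ p q a b ρ₀ ρ₁ ρ₂ ρ₃ ρ₅ lam)
include T

/-- Division by zero gives 0, so a vanishing constant would make λ₁ = 0, contradicting 0 < λ < λ₁;
the same holds for b, through a positive power of 0. -/
theorem weightConst_a_pos : 0 < weightConst Ω a (q + 1) := by
  refine (weightConst_nonneg _ _).lt_of_ne fun h => ?_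
  have := T.lam_pos.trans T.lam_lt_one
  rw [lambda1_eq, ← h] at this
  simp at this

theorem weightConst_b_pos : 0 < weightConst Ω b (p + 1) := by
  refine (weightConst_nonneg _ _).lt_of_ne fun h => ?_
  have := T.lam_pos.trans T.lam_lt_one
  rw [lambda1_eq, ← h, mul_zero, div_zero, Real.zero_rpow (div_pos (by linarith [T.q_lt])
    (by linarith [T.p_gt])).ne', mul_zero] at this
  exact this.false

theorem le_raySecond (u : H10 Ω) : ρ₃ * ‖grad u‖ ^ 2 ≤ raySecond φ q (vol Ω) (dens u) 1 := by
  have h : ∫ x in Ω, ρ₃ * (2 * dens u x) = ρ₃ * (‖fn u‖ ^ 2 + ‖grad u‖ ^ 2) := by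
    rw [integral_const_mul, integral_const_mul, integral_dens]
    ring
  have h2 : ∫ x in Ω, ρ₃ * (2 * dens u x) ≤ raySecond φ q (vol Ω) (dens u) 1 := by
    refine integral_mono (((integrable_dens u).const_mul _).const_mul _)
      (integrable_raySecond T.cont T.contDiff T.pos T.lower T.upper T.dphi_le (integrable_dens u)
        (dens_nonneg u) q 1) fun x => ?_
    have hd := dens_nonneg u x
    simp only [one_pow, one_mul]
    refine mul_le_mul_of_nonneg_right ?_ (by linarith)
    linarith [T.rho3_le _ hd]
  nlinarith [sq_nonneg ‖fn u‖, T.rho3_pos, mul_nonneg T.rho3_pos.le (sq_nonneg ‖fn u‖)]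

theorem raySecond_le (u : H10 Ω) : raySecond φ p (vol Ω) (dens u) 1 ≤ -(ρ₅ * ‖grad u‖ ^ 2) := by
  have h : ∫ x in Ω, (-ρ₅) * (2 * dens u x) = -ρ₅ * (‖fn u‖ ^ 2 + ‖grad u‖ ^ 2) := by
    rw [integral_const_mul, integral_const_mul, integral_dens]
    ring
  have h2 : raySecond φ p (vol Ω) (dens u) 1 ≤ ∫ x in Ω, (-ρ₅) * (2 * dens u x) := by
    refine integral_mono (integrable_raySecond T.cont T.contDiff T.pos T.lower T.upper T.dphi_le
      (integrable_dens u) (dens_nonneg u) p 1) (((integrable_dens u).const_mul _).const_mul _)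
      fun x => ?_
    have hd := dens_nonneg u x
    simp only [one_pow, one_mul]
    refine mul_le_mul_of_nonneg_right ?_ (by linarith)
    linarith [T.rho5_le _ hd]
  nlinarith [mul_nonneg T.rho5_pos.le (sq_nonneg ‖fn u‖)]

/-- The Sobolev bound makes the right side of `h` of order ‖∇u‖^{p+1}; divide by ‖∇u‖². It applies
to degenerate points and to N⁻. -/
theorem lower_grad {u : H10 Ω} (hu : fn u ≠ 0)
    (h : ρ₃ * ‖grad u‖ ^ 2 ≤ (p - q) * powerInt b (p + 1) u) :
    ρ₃ / ((p - q) * weightConst Ω b (p + 1)) ≤ ‖grad u‖ ^ (p - 1) := by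
  have hg := T.grad_pos hu
  have hpq := T.p_sub_q_pos
  have hB : powerInt b (p + 1) u ≤ weightConst Ω b (p + 1) * ‖grad u‖ ^ (p + 1) :=
    (le_abs_self _).trans (T.abs_powerInt_p_le u)
  have e : ‖grad u‖ ^ (p + 1) = ‖grad u‖ ^ 2 * ‖grad u‖ ^ (p - 1) := by
    rw [← Real.rpow_natCast, ← Real.rpow_add hg]
    congr 1
    push_cast
    ring
  rw [div_le_iff₀ (mul_pos hpq T.weightConst_b_pos)]
  refine le_of_mul_le_mul_left ?_ (by positivity : 0 < ‖grad u‖ ^ 2)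
  calc ‖grad u‖ ^ 2 * ρ₃ ≤ (p - q) * (weightConst Ω b (p + 1) * ‖grad u‖ ^ (p + 1)) := by
        rw [mul_comm]
        exact h.trans (mul_le_mul_of_nonneg_left hB hpq.le)
    _ = _ := by
        rw [e]
        ring

/-- The degenerate part of the Nehari manifold is empty. -/
theorem iteratedDeriv_two_ne_zero {u : H10 Ω} (hu : u ∈ nehari φ p q a b lam Ω) :
    iteratedDeriv 2 (fiber φ p q a b lam u) 1 ≠ 0 := by
  intro h0
  have hg := T.grad_pos hu.1
  have hpq := T.p_sub_q_pos
  have h1 : rayDisc φ p q b u 1 = 0 := by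
    rw [← T.iteratedDeriv_two_eq_of_critical one_pos (lam := lam) (by rw [one_smul]; exact hu.2), h0]
  rw [rayDisc, Real.one_rpow, mul_one] at h1
  have h2 := T.iteratedDeriv_two_one_eq hu.2
  rw [h0] at h2
  -- Eliminating the a-term bounds ‖∇u‖ from below here; eliminating the b-term bounds it from above
  -- in `hC`. Together they yield λ₁ ≤ λ.
  have hB := T.lower_grad hu.1 (by linarith [T.le_raySecond u])
  have hA : powerInt a (q + 1) u ≤ weightConst Ω a (q + 1) * ‖grad u‖ ^ (q + 1) :=
    (le_abs_self _).trans (T.abs_powerInt_q_le u)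
  have e : ‖grad u‖ ^ 2 = ‖grad u‖ ^ (q + 1) * ‖grad u‖ ^ (1 - q) := by
    rw [← Real.rpow_natCast, ← Real.rpow_add hg]
    congr 1
    push_cast
    ring
  have hC : ρ₅ / ((p - q) * weightConst Ω a (q + 1)) * ‖grad u‖ ^ (1 - q) ≤ lam := by
    rw [div_mul_eq_mul_div, div_le_iff₀ (mul_pos hpq T.weightConst_a_pos)]
    refine le_of_mul_le_mul_left ?_ (Real.rpow_pos_of_pos hg (q + 1))
    calc ‖grad u‖ ^ (q + 1) * (ρ₅ * ‖grad u‖ ^ (1 - q)) = ρ₅ * ‖grad u‖ ^ 2 := by rw [e]; ring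
      _ ≤ lam * (p - q) * powerInt a (q + 1) u := by linarith [T.raySecond_le u]
      _ ≤ lam * (p - q) * (weightConst Ω a (q + 1) * ‖grad u‖ ^ (q + 1)) :=
          mul_le_mul_of_nonneg_left hA (mul_pos T.lam_pos hpq).le
      _ = _ := by ring
  have hp1 : 0 < p - 1 := by linarith [T.p_gt]
  have hD : (ρ₃ / ((p - q) * weightConst Ω b (p + 1))) ^ ((1 - q) / (p - 1)) ≤
      ‖grad u‖ ^ (1 - q) := by
    have h0 : 0 ≤ ρ₃ / ((p - q) * weightConst Ω b (p + 1)) :=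
      div_nonneg T.rho3_pos.le (mul_pos hpq T.weightConst_b_pos).le
    refine (Real.rpow_le_rpow h0 hB (div_nonneg (by linarith [T.q_lt]) hp1.le)).trans_eq ?_
    rw [← Real.rpow_mul hg.le, mul_div_cancel₀ _ hp1.ne']
  have := T.lam_lt_one
  rw [lambda1_eq] at this
  have h5 : 0 ≤ ρ₅ / ((p - q) * weightConst Ω a (q + 1)) :=
    div_nonneg T.rho5_pos.le (mul_pos hpq T.weightConst_a_pos).le
  linarith [mul_le_mul_of_nonneg_left hD h5]

end Threshold

end Fiber

/-! ### The second-order necessary condition at a local extremum. -/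

section SecondDerivative

/-- A negative second derivative would make x a local maximum as well, so f would be locally
constant and the second derivative zero. -/
theorem IsLocalMin.deriv_deriv_nonneg {f : ℝ → ℝ} {x : ℝ} (h : IsLocalMin f x)
    (hc : ContinuousAt f x) : 0 ≤ deriv (deriv f) x := by
  by_contra! hneg
  have hmax := isLocalMax_of_deriv_deriv_neg hneg h.deriv_eq_zero hc
  have he : f =ᶠ[𝓝 x] fun _ => f x := by
    filter_upwards [h, hmax] with y h1 h2
    exact le_antisymm h2 h1
  have h2 := he.deriv.deriv_eq
  simp at h2
  exact hneg.ne h2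

theorem IsLocalMax.deriv_deriv_nonpos {f : ℝ → ℝ} {x : ℝ} (h : IsLocalMax f x)
    (hc : ContinuousAt f x) : deriv (deriv f) x ≤ 0 := by
  by_contra! hpos
  have hmin := isLocalMin_of_deriv_deriv_pos hpos h.deriv_eq_zero hc
  have he : f =ᶠ[𝓝 x] fun _ => f x := by
    filter_upwards [h, hmin] with y h1 h2
    exact le_antisymm h1 h2
  have h2 := he.deriv.deriv_eq
  simp at h2
  exact hpos.ne' h2

end SecondDerivative

/-! ### The positive barrier, and the position of N⁺ and N⁻ relative to it. -/

section Geometry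

variable {N : ℕ} {Ω : Set (Eucl N)} {φ : ℝ → ℝ} {p q : ℝ} {a b : Eucl N → ℝ}
  {lam ρ₀ ρ₁ ρ₂ ρ₃ ρ₅ : ℝ}

theorem powerInt_of_fn_eq_zero {c : Eucl N → ℝ} {r : ℝ} (hr : 0 < r) {u : H10 Ω} (hu : fn u = 0) :
    powerInt c r u = 0 := by
  have h : powerInt c r u = ∫ _ in Ω, (0 : ℝ) := by
    refine integral_congr_ae ?_
    filter_upwards [(Lp.eq_zero_iff_ae_eq_zero).1 hu] with x hx
    simp [hx, Real.zero_rpow hr.ne']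
  simpa using h

theorem norm_grad_smul {t : ℝ} (ht : 0 ≤ t) (u : H10 Ω) : ‖grad (t • u)‖ = t * ‖grad u‖ := by
  rw [grad_smul, norm_smul, Real.norm_of_nonneg ht]

theorem norm_fn_smul {t : ℝ} (ht : 0 ≤ t) (u : H10 Ω) : ‖fn (t • u)‖ = t * ‖fn u‖ := by
  rw [fn_smul, norm_smul, Real.norm_of_nonneg ht]

theorem iteratedDeriv_two_eq_deriv (u : H10 Ω) (t : ℝ) :
    iteratedDeriv 2 (fiber φ p q a b lam u) t = deriv (deriv (fiber φ p q a b lam u)) t := by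
  rw [iteratedDeriv_succ, iteratedDeriv_one]

/-- The radius of the sphere on which the energy is positive. -/
noncomputable def barrierRadius (Ω : Set (Eucl N)) (b : Eucl N → ℝ) (p ρ₀ : ℝ) : ℝ :=
  (ρ₀ / weightConst Ω b (p + 1)) ^ (1 / (p - 1))

namespace Setting

variable (S : Setting Ω φ p q a b ρ₀ ρ₁ ρ₂)
include S

theorem nehari_smul {u : H10 Ω} (hu : fn u ≠ 0) {t : ℝ} (ht : 0 < t)
    (h : dJ φ p q a b lam (t • u) u = 0) : t • u ∈ nehari φ p q a b lam Ω :=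
  ⟨smul_ne_zero ht.ne' hu, by rw [S.dJ_smul_self, h, mul_zero]⟩

end Setting

namespace Threshold

variable (T : Threshold Ω φ p q a b ρ₀ ρ₁ ρ₂ ρ₃ ρ₅ lam)
include T

theorem gap_pos : 0 < ρ₀ / 2 - ρ₁ / (p + 1) := by
  have := T.gap
  have h : 2 / (p + 1) * ρ₁ = 2 * (ρ₁ / (p + 1)) := by ring
  linarith

theorem barrierRadius_pos : 0 < barrierRadius Ω b p ρ₀ :=
  Real.rpow_pos_of_pos (div_pos T.pos T.weightConst_b_pos) _

theorem barrierRadius_rpow :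
    barrierRadius Ω b p ρ₀ ^ (p - 1) = ρ₀ / weightConst Ω b (p + 1) := by
  have hp1 : p - 1 ≠ 0 := by linarith [T.p_gt]
  rw [barrierRadius, ← Real.rpow_mul (div_pos T.pos T.weightConst_b_pos).le,
    one_div_mul_cancel hp1, Real.rpow_one]

/-- With κ = ρ₀/2 − ρ₁/(p+1), the constant δ is κR². Thus λ < λ₂, multiplied by R^{q+1}, is this
inequality once the powers of κ and R are recombined. -/
theorem lam_barrier : lam / (q + 1) * (weightConst Ω a (q + 1) *
    barrierRadius Ω b p ρ₀ ^ (q + 1)) < (ρ₀ / 2 - ρ₁ / (p + 1)) * barrierRadius Ω b p ρ₀ ^ 2 := by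
  set κ := ρ₀ / 2 - ρ₁ / (p + 1) with hκ
  set R := barrierRadius Ω b p ρ₀ with hR
  have hκ0 : 0 < κ := T.gap_pos
  have hR0 : 0 < R := T.barrierRadius_pos
  have hA := T.weightConst_a_pos
  have hq1 : 0 < q + 1 := by linarith [T.q_pos]
  have hδ : deltaConst Ω p b ρ₀ ρ₁ = κ * R ^ 2 := by
    have : R ^ 2 = (ρ₀ / weightConst Ω b (p + 1)) ^ (2 / (p - 1)) := by
      rw [hR, barrierRadius, ← Real.rpow_natCast, ← Real.rpow_mul
        (div_pos T.pos T.weightConst_b_pos).le]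
      congr 1
      push_cast
      ring
    rw [this]
    rfl
  have hc1 : c1 Ω p q a ρ₀ ρ₁ = weightConst Ω a (q + 1) / ((q + 1) * κ ^ ((q + 1) / 2)) := rfl
  have hlam := T.lam_lt_two
  have hκq : 0 < κ ^ ((q + 1) / 2) := Real.rpow_pos_of_pos hκ0 _
  rw [lambda2, hδ, hc1, div_div_eq_mul_div, lt_div_iff₀ hA] at hlam
  have e : (κ * R ^ 2) ^ (1 - (q + 1) / 2) * κ ^ ((q + 1) / 2) * R ^ (q + 1) = κ * R ^ 2 := by
    have e1 : R ^ (q + 1) = (R ^ 2) ^ ((q + 1) / 2) := by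
      rw [← Real.rpow_natCast, ← Real.rpow_mul hR0.le]
      congr 1
      push_cast
      ring
    rw [e1, mul_assoc, ← Real.mul_rpow hκ0.le (by positivity), ← Real.rpow_add (by positivity)]
    rw [sub_add_cancel, Real.rpow_one]
  have hRq : 0 < R ^ (q + 1) := Real.rpow_pos_of_pos hR0 _
  calc lam / (q + 1) * (weightConst Ω a (q + 1) * R ^ (q + 1))
      = lam * weightConst Ω a (q + 1) * R ^ (q + 1) / (q + 1) := by ring
    _ < (κ * R ^ 2) ^ (1 - (q + 1) / 2) * ((q + 1) * κ ^ ((q + 1) / 2)) * R ^ (q + 1) / (q + 1) := by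
        gcongr
    _ = (κ * R ^ 2) ^ (1 - (q + 1) / 2) * κ ^ ((q + 1) / 2) * R ^ (q + 1) := by
        field_simp
    _ = κ * R ^ 2 := e

theorem le_J (u : H10 Ω) : ρ₀ / 2 * (‖fn u‖ ^ 2 + ‖grad u‖ ^ 2) -
    lam / (q + 1) * (weightConst Ω a (q + 1) * ‖grad u‖ ^ (q + 1)) -
    1 / (p + 1) * (weightConst Ω b (p + 1) * ‖grad u‖ ^ (p + 1)) ≤ J φ p q a b lam u := by
  have hA : powerInt a (q + 1) u ≤ weightConst Ω a (q + 1) * ‖grad u‖ ^ (q + 1) :=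
    (le_abs_self _).trans (T.abs_powerInt_q_le u)
  have hB : powerInt b (p + 1) u ≤ weightConst Ω b (p + 1) * ‖grad u‖ ^ (p + 1) :=
    (le_abs_self _).trans (T.abs_powerInt_p_le u)
  have h1 : 0 ≤ lam / (q + 1) := div_nonneg T.lam_pos.le (by linarith [T.q_pos])
  have h2 : 0 ≤ 1 / (p + 1) := div_nonneg one_pos.le (by linarith [T.p_gt])
  rw [J_eq]
  linarith [T.le_energy u, mul_le_mul_of_nonneg_left hA h1, mul_le_mul_of_nonneg_left hB h2]

/-- R makes the Sobolev bound of the b-term equal to ρ₀R²/(p+1) ≤ ρ₁R²/(p+1). What remains of the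
energy is at least κR², with κ = ρ₀/2 − ρ₁/(p+1), and this exceeds the a-term. -/
theorem J_pos_of_sphere {u : H10 Ω} (hu : ‖grad u‖ = barrierRadius Ω b p ρ₀) :
    0 < J φ p q a b lam u := by
  have h1 := T.le_J u
  have h2 := T.lam_barrier
  have h3 := T.barrierRadius_rpow
  have hR0 := T.barrierRadius_pos
  rw [hu] at h1
  set R := barrierRadius Ω b p ρ₀
  have hp1 : 0 < p + 1 := by linarith [T.p_gt]
  have e : weightConst Ω b (p + 1) * R ^ (p + 1) = ρ₀ * R ^ 2 := by
    have : R ^ (p + 1) = R ^ (p - 1) * R ^ 2 := by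
      rw [← Real.rpow_natCast, ← Real.rpow_add hR0]
      congr 1
      push_cast
      ring
    rw [this, h3, ← mul_assoc, mul_div_cancel₀ _ T.weightConst_b_pos.ne']
  have h4 : 1 / (p + 1) * (ρ₀ * R ^ 2) ≤ ρ₁ / (p + 1) * R ^ 2 := by
    rw [← mul_assoc, one_div_mul_eq_div]
    gcongr
    exact T.rho_le
  rw [e] at h1
  nlinarith [mul_nonneg T.pos.le (sq_nonneg ‖fn u‖)]

theorem mem_nehariMinus_of_isLocalMax {u : H10 Ω} (hu : fn u ≠ 0) {t : ℝ} (ht : 0 < t)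
    (h : IsLocalMax (fiber φ p q a b lam u) t) : t • u ∈ nehariMinus φ p q a b lam Ω := by
  have hd := T.hasDerivAt_fiber (lam := lam) u t
  have hn := T.nehari_smul (lam := lam) hu ht (h.hasDerivAt_eq_zero hd)
  refine ⟨hn, lt_of_le_of_ne ?_ (T.iteratedDeriv_two_ne_zero hn)⟩
  rw [T.iteratedDeriv_two_fiber_smul ht, iteratedDeriv_two_eq_deriv]
  exact mul_nonpos_of_nonneg_of_nonpos (by positivity)
    (IsLocalMax.deriv_deriv_nonpos h hd.continuousAt)

theorem mem_nehariPlus_of_isLocalMin {u : H10 Ω} (hu : fn u ≠ 0)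
    (h : IsLocalMin (fiber φ p q a b lam u) 1) : u ∈ nehariPlus φ p q a b lam Ω := by
  have hd := T.hasDerivAt_fiber (lam := lam) u 1
  have hn := T.nehari_smul (lam := lam) hu one_pos (h.hasDerivAt_eq_zero hd)
  rw [one_smul] at hn
  refine ⟨hn, lt_of_le_of_ne ?_ (T.iteratedDeriv_two_ne_zero hn).symm⟩
  rw [iteratedDeriv_two_eq_deriv]
  exact IsLocalMin.deriv_deriv_nonneg h hd.continuousAt

/-- Used when ∫ b|u|^{p+1} > 0: the last term then makes J nonpositive far out on the ray. -/
theorem J_smul_le {s : ℝ} (hs : 1 ≤ s) (u : H10 Ω) : J φ p q a b lam (s • u) ≤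
    s ^ 2 * (ρ₁ / 2 * (‖fn u‖ ^ 2 + ‖grad u‖ ^ 2) + lam / (q + 1) * |powerInt a (q + 1) u| -
      1 / (p + 1) * powerInt b (p + 1) u * s ^ (p - 1)) := by
  have hs0 : 0 < s := by linarith
  have h1 : 0 ≤ lam / (q + 1) := div_nonneg T.lam_pos.le (by linarith [T.q_pos])
  have hE := T.energy_le (s • u)
  rw [norm_fn_smul hs0.le, norm_grad_smul hs0.le] at hE
  rw [J_eq, powerInt_smul _ _ hs0.le, powerInt_smul _ _ hs0.le]
  have e : s ^ (p + 1) = s ^ 2 * s ^ (p - 1) := by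
    rw [← Real.rpow_natCast, ← Real.rpow_add hs0]
    congr 1
    push_cast
    ring
  have h2 : s ^ (q + 1) ≤ s ^ 2 := by
    rw [← Real.rpow_natCast]
    exact Real.rpow_le_rpow_of_exponent_le hs (by push_cast; linarith [T.q_lt])
  have h3 : -(s ^ (q + 1) * powerInt a (q + 1) u) ≤ s ^ 2 * |powerInt a (q + 1) u| :=
    calc -(s ^ (q + 1) * powerInt a (q + 1) u) = s ^ (q + 1) * -powerInt a (q + 1) u := by ring
      _ ≤ s ^ (q + 1) * |powerInt a (q + 1) u| :=
          mul_le_mul_of_nonneg_left (neg_le_abs _) (by positivity)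
      _ ≤ _ := mul_le_mul_of_nonneg_right h2 (abs_nonneg _)
  rw [e]
  nlinarith [mul_le_mul_of_nonneg_left h3 h1]

/-- J vanishes at 0, is positive where the ray crosses the barrier sphere and nonpositive far away,
so it has an interior global maximum; nondegeneracy puts it in N⁻. -/
theorem exists_max_ray {u : H10 Ω} (hB : 0 < powerInt b (p + 1) u) :
    ∃ t : ℝ, 0 < t ∧ t • u ∈ nehariMinus φ p q a b lam Ω ∧ 0 < J φ p q a b lam (t • u) ∧
      ∀ s : ℝ, 0 ≤ s → J φ p q a b lam (s • u) ≤ J φ p q a b lam (t • u) := by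
  have hp1 : 0 < p + 1 := by linarith [T.p_gt]
  have hu : fn u ≠ 0 := fun h => by
    rw [powerInt_of_fn_eq_zero hp1 h] at hB
    exact hB.false
  have hg := T.grad_pos hu
  set tR := barrierRadius Ω b p ρ₀ / ‖grad u‖
  have htR : 0 < tR := div_pos T.barrierRadius_pos hg
  have hJR : 0 < J φ p q a b lam (tR • u) := T.J_pos_of_sphere (by
    rw [norm_grad_smul htR.le, div_mul_cancel₀ _ hg.ne'])
  set C := ρ₁ / 2 * (‖fn u‖ ^ 2 + ‖grad u‖ ^ 2) + lam / (q + 1) * |powerInt a (q + 1) u|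
  have hlim : Tendsto (fun s : ℝ => 1 / (p + 1) * powerInt b (p + 1) u * s ^ (p - 1)) atTop atTop :=
    (tendsto_rpow_atTop (by linarith [T.p_gt])).const_mul_atTop
      (mul_pos (one_div_pos.2 hp1) hB)
  obtain ⟨K, hK⟩ := eventually_atTop.1 ((hlim.eventually_ge_atTop C).and (eventually_ge_atTop 1))
  have hneg : ∀ s ≥ K, J φ p q a b lam (s • u) ≤ 0 := fun s hs =>
    (T.J_smul_le (hK s hs).2 u).trans
      (mul_nonpos_of_nonneg_of_nonpos (sq_nonneg s) (sub_nonpos.2 (hK s hs).1))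
  obtain ⟨t, ht, htmax⟩ := (isCompact_Icc (a := (0 : ℝ)) (b := max K tR)).exists_isMaxOn
    ⟨tR, htR.le, le_max_right _ _⟩ (T.continuous_J_ray (lam := lam) u).continuousOn
  have hJt : 0 < J φ p q a b lam (t • u) :=
    hJR.trans_le (htmax (⟨htR.le, le_max_right _ _⟩ : tR ∈ Icc 0 (max K tR)))
  have hmax : ∀ s : ℝ, 0 ≤ s → J φ p q a b lam (s • u) ≤ J φ p q a b lam (t • u) := fun s hs => by
    rcases le_total s (max K tR) with h | h
    · exact htmax (⟨hs, h⟩ : s ∈ Icc 0 (max K tR))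
    · exact (hneg s ((le_max_left _ _).trans h)).trans hJt.le
  have ht0 : 0 < t := lt_of_le_of_ne ht.1 fun h => by
    rw [← h, zero_smul, T.J_zero] at hJt
    exact hJt.false
  refine ⟨t, ht0, T.mem_nehariMinus_of_isLocalMax hu ht0 ?_, hJt, hmax⟩
  filter_upwards [Ioi_mem_nhds ht0] with s hs
  exact hmax s (le_of_lt hs)

theorem rayDisc_one_of_nehari {u : H10 Ω} (hu : u ∈ nehari φ p q a b lam Ω) :
    iteratedDeriv 2 (fiber φ p q a b lam u) 1 = rayDisc φ p q b u 1 :=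
  T.iteratedDeriv_two_eq_of_critical one_pos (by rw [one_smul]; exact hu.2)

theorem rho3_le_of_nehariMinus {u : H10 Ω} (hu : u ∈ nehariMinus φ p q a b lam Ω) :
    ρ₃ * ‖grad u‖ ^ 2 ≤ (p - q) * powerInt b (p + 1) u := by
  have h := hu.2
  rw [T.rayDisc_one_of_nehari hu.1, rayDisc, Real.one_rpow, mul_one] at h
  linarith [T.le_raySecond u]

theorem powerInt_pos_of_nehariMinus {u : H10 Ω} (hu : u ∈ nehariMinus φ p q a b lam Ω) :
    0 < powerInt b (p + 1) u := by
  have h := T.rho3_le_of_nehariMinus hu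
  have hg := T.grad_pos hu.1.1
  exact pos_of_mul_pos_right ((mul_pos T.rho3_pos (by positivity)).trans_le h) T.p_sub_q_pos.le

/-- After the first point of N⁻ on a ray γ_u' stays negative, so there is no second one. -/
theorem eq_one_of_smul_mem_nehariMinus {u : H10 Ω} (hu : u ∈ nehariMinus φ p q a b lam Ω) {t : ℝ}
    (ht : 0 < t) (htm : t • u ∈ nehariMinus φ p q a b lam Ω) : t = 1 := by
  have hu2 : dJ φ p q a b lam ((1 : ℝ) • u) u = 0 := by rw [one_smul]; exact hu.1.2
  have ht2 : dJ φ p q a b lam (t • u) u = 0 := by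
    have := htm.1.2
    rw [T.dJ_smul_self] at this
    exact (mul_eq_zero.1 this).resolve_left ht.ne'
  have hdt : rayDisc φ p q b u t < 0 := by
    have h := htm.2
    rw [T.iteratedDeriv_two_fiber_smul ht, T.iteratedDeriv_two_eq_of_critical ht ht2] at h
    exact (pos_iff_neg_of_mul_neg h).1 (by positivity)
  have hd1 : rayDisc φ p q b u 1 < 0 := by
    rw [← T.rayDisc_one_of_nehari hu.1]
    exact hu.2
  rcases lt_trichotomy t 1 with h | h | h
  · exact absurd hu2 (T.dJ_ray_neg_of_gt ht h ht2 hdt).ne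
  · exact h
  · exact absurd ht2 (T.dJ_ray_neg_of_gt one_pos h hu2 hd1).ne

/-- The global maximum on the ray through u also lies in N⁻, so uniqueness identifies it with u. -/
theorem nehariMinus_maximal {u : H10 Ω} (hu : u ∈ nehariMinus φ p q a b lam Ω) :
    0 < J φ p q a b lam u ∧
      ∀ s : ℝ, 0 ≤ s → J φ p q a b lam (s • u) ≤ J φ p q a b lam u := by
  obtain ⟨t, ht, htm, hJ, hmax⟩ := T.exists_max_ray (T.powerInt_pos_of_nehariMinus hu)
  rw [T.eq_one_of_smul_mem_nehariMinus hu ht htm, one_smul] at hJ hmax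
  exact ⟨hJ, hmax⟩

/-- On N⁺ the map γ_u decreases on (0, 1] from γ_u(0) = 0, so the segment from 0 to u cannot meet
the sphere where J > 0. -/
theorem grad_lt_of_nehariPlus {u : H10 Ω} (hu : u ∈ nehariPlus φ p q a b lam Ω) :
    ‖grad u‖ < barrierRadius Ω b p ρ₀ := by
  by_contra! hle
  have hg := T.grad_pos hu.1.1
  set tR := barrierRadius Ω b p ρ₀ / ‖grad u‖
  have htR : 0 < tR := div_pos T.barrierRadius_pos hg
  have htR1 : tR ≤ 1 := (div_le_one hg).2 hle
  have hJR : 0 < J φ p q a b lam (tR • u) := T.J_pos_of_sphere (by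
    rw [norm_grad_smul htR.le, div_mul_cancel₀ _ hg.ne'])
  have hd1 : 0 < rayDisc φ p q b u 1 := by
    rw [← T.rayDisc_one_of_nehari hu.1]
    exact hu.2
  have hanti : AntitoneOn (fun t : ℝ => J φ p q a b lam (t • u)) (Icc 0 1) := by
    refine antitoneOn_of_deriv_nonpos (convex_Icc 0 1)
      (T.continuous_J_ray (lam := lam) u).continuousOn
      (fun t _ => (T.hasDerivAt_fiber u t).differentiableAt.differentiableWithinAt) fun t ht => ?_
    rw [interior_Icc] at ht
    have e : deriv (fun t : ℝ => J φ p q a b lam (t • u)) t = _ := (T.hasDerivAt_fiber u t).deriv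
    rw [e]
    exact (T.dJ_ray_neg_of_lt ht.1 ht.2 (by rw [one_smul]; exact hu.1.2) hd1).le
  have := hanti (⟨le_rfl, zero_le_one⟩ : (0 : ℝ) ∈ Icc 0 1) (⟨htR.le, htR1⟩ : tR ∈ Icc 0 1) htR.le
  simp only [zero_smul, T.J_zero] at this
  linarith

/-- Subtract 1/(p+1) times the Nehari identity, which removes the b-term; since q + 1 < 2 the
quadratic part dominates. -/
theorem coercive {u : H10 Ω} (hu : dJ φ p q a b lam u u = 0) :
    (ρ₀ / 2 - ρ₁ / (p + 1)) * ‖grad u‖ ^ 2 - lam / (q + 1) * weightConst Ω a (q + 1) *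
      ‖grad u‖ ^ (q + 1) ≤ J φ p q a b lam u := by
  rw [dJ_self T.q_pos (by linarith [T.p_gt])] at hu
  have hp1 : 0 < p + 1 := by linarith [T.p_gt]
  have hq1 : 0 < q + 1 := by linarith [T.q_pos]
  have hI : ∫ x in Ω, φ (dens u x) * (2 * dens u x) ≤ ρ₁ * (‖fn u‖ ^ 2 + ‖grad u‖ ^ 2) := by
    have e : ρ₁ * (‖fn u‖ ^ 2 + ‖grad u‖ ^ 2) = ∫ x in Ω, ρ₁ * (2 * dens u x) := by
      rw [integral_const_mul, integral_const_mul, integral_dens]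
      ring
    rw [e]
    refine integral_mono ?_ (((integrable_dens u).const_mul _).const_mul _) fun x => ?_
    · simpa using integrable_comp_mul T.cont T.pos T.lower T.upper (integrable_dens u) 1
    · exact mul_le_mul_of_nonneg_right (T.upper _) (by linarith [dens_nonneg u x])
  have hA := T.abs_powerInt_q_le u
  change |powerInt a (q + 1) u| ≤ weightConst Ω a (q + 1) * ‖grad u‖ ^ (q + 1) at hA
  set A := powerInt a (q + 1) u
  set B := powerInt b (p + 1) u
  set I := ∫ x in Ω, φ (dens u x) * (2 * dens u x)
  have hJ : J φ p q a b lam u = energy φ u - 1 / (p + 1) * I -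
      (lam / (q + 1) - lam / (p + 1)) * A := by
    rw [J_eq]
    linear_combination (1 / (p + 1)) * hu
  have hc : 0 ≤ lam / (q + 1) - lam / (p + 1) := by
    rw [sub_nonneg]
    exact div_le_div_of_nonneg_left T.lam_pos.le hq1 (by linarith [T.p_sub_q_pos])
  have hc' : lam / (q + 1) - lam / (p + 1) ≤ lam / (q + 1) := by
    linarith [div_nonneg T.lam_pos.le hp1.le]
  have hAA : (lam / (q + 1) - lam / (p + 1)) * A ≤
      lam / (q + 1) * (weightConst Ω a (q + 1) * ‖grad u‖ ^ (q + 1)) :=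
    (mul_le_mul_of_nonneg_left (le_abs_self A) hc).trans
      ((mul_le_mul_of_nonneg_right hc' (abs_nonneg A)).trans
        (mul_le_mul_of_nonneg_left hA (by positivity [T.lam_pos])))
  have hI' : 1 / (p + 1) * I ≤ ρ₁ / (p + 1) * (‖fn u‖ ^ 2 + ‖grad u‖ ^ 2) :=
    (mul_le_mul_of_nonneg_left hI (one_div_pos.2 hp1).le).trans_eq (by ring)
  rw [hJ]
  nlinarith [T.le_energy u, mul_nonneg T.gap_pos.le (sq_nonneg ‖fn u‖)]

theorem exists_bound_of_nehari (c : ℝ) : ∃ M : ℝ, ∀ u : H10 Ω, dJ φ p q a b lam u u = 0 →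
    J φ p q a b lam u ≤ c → ‖grad u‖ ≤ M := by
  have hκ := T.gap_pos
  have hq1 : 0 < q + 1 := by linarith [T.q_pos]
  set κ := ρ₀ / 2 - ρ₁ / (p + 1)
  set C := lam / (q + 1) * weightConst Ω a (q + 1)
  have hlim : Tendsto (fun g : ℝ => κ * g ^ (1 - q)) atTop atTop :=
    (tendsto_rpow_atTop (by linarith [T.q_lt])).const_mul_atTop hκ
  obtain ⟨K, hK⟩ := eventually_atTop.1
    ((hlim.eventually_ge_atTop (C + |c| + 1)).and (eventually_ge_atTop 1))
  refine ⟨K, fun u hu hJ => ?_⟩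
  by_contra! hlt
  obtain ⟨h1, h2⟩ := hK _ hlt.le
  have h3 := T.coercive hu
  have hg : 0 < ‖grad u‖ := by linarith
  have e : ‖grad u‖ ^ 2 = ‖grad u‖ ^ (q + 1) * ‖grad u‖ ^ (1 - q) := by
    rw [← Real.rpow_natCast, ← Real.rpow_add hg]
    congr 1
    push_cast
    ring
  have h4 : 1 ≤ ‖grad u‖ ^ (q + 1) := Real.one_le_rpow h2 hq1.le
  have h5 : ‖grad u‖ ^ (q + 1) * (|c| + 1) ≤ c := by
    calc ‖grad u‖ ^ (q + 1) * (|c| + 1) ≤ ‖grad u‖ ^ (q + 1) * (κ * ‖grad u‖ ^ (1 - q) - C) := by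
          gcongr
          linarith
      _ = κ * ‖grad u‖ ^ 2 - C * ‖grad u‖ ^ (q + 1) := by rw [e]; ring
      _ ≤ c := h3.trans hJ
  nlinarith [le_abs_self c, abs_nonneg c]

end Threshold

end Geometry

/-! ### Existence of the two minimizers and their criticality. -/

section Minimizers

variable {N : ℕ} {Ω : Set (Eucl N)} {φ : ℝ → ℝ} {p q : ℝ} {a b : Eucl N → ℝ}
  {lam ρ₀ ρ₁ ρ₂ ρ₃ ρ₅ : ℝ}

theorem exists_seq_tendsto_sInf_image {X : Type*} {s : Set X} {f : X → ℝ} (hs : s.Nonempty)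
    (hb : BddBelow (f '' s)) :
    ∃ u : ℕ → X, (∀ n, u n ∈ s) ∧ Tendsto (fun n => f (u n)) atTop (𝓝 (sInf (f '' s))) := by
  obtain ⟨y, -, hy, hmem⟩ := exists_seq_tendsto_sInf (hs.image f) hb
  choose u hu hfu using hmem
  exact ⟨u, hu, by simpa only [hfu] using hy⟩

namespace Threshold

variable (T : Threshold Ω φ p q a b ρ₀ ρ₁ ρ₂ ρ₃ ρ₅ lam)
include T

theorem bddBelow_J_ball (R : ℝ) :
    BddBelow (J φ p q a b lam '' {u : H10 Ω | ‖grad u‖ ≤ R}) := by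
  refine ⟨-(lam / (q + 1) * (weightConst Ω a (q + 1) * R ^ (q + 1))) -
    1 / (p + 1) * (weightConst Ω b (p + 1) * R ^ (p + 1)), ?_⟩
  rintro _ ⟨u, hu, rfl⟩
  replace hu : ‖grad u‖ ≤ R := hu
  have hq : 0 < q + 1 := by linarith [T.q_pos]
  have hp : 0 < p + 1 := by linarith [T.p_gt]
  have hA := T.weightConst_a_pos.le
  have hB := T.weightConst_b_pos.le
  have h1 : lam / (q + 1) * (weightConst Ω a (q + 1) * ‖grad u‖ ^ (q + 1)) ≤
      lam / (q + 1) * (weightConst Ω a (q + 1) * R ^ (q + 1)) :=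
    mul_le_mul_of_nonneg_left (mul_le_mul_of_nonneg_left
      (Real.rpow_le_rpow (norm_nonneg _) hu hq.le) hA) (div_nonneg T.lam_pos.le hq.le)
  have h2 : 1 / (p + 1) * (weightConst Ω b (p + 1) * ‖grad u‖ ^ (p + 1)) ≤
      1 / (p + 1) * (weightConst Ω b (p + 1) * R ^ (p + 1)) :=
    mul_le_mul_of_nonneg_left (mul_le_mul_of_nonneg_left
      (Real.rpow_le_rpow (norm_nonneg _) hu hp.le) hB) (one_div_pos.2 hp).le
  have h3 : 0 ≤ ρ₀ / 2 * (‖fn u‖ ^ 2 + ‖grad u‖ ^ 2) := by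
    have := T.pos
    positivity
  linarith [T.le_J u]

/-- Near t = 0 the term of order t^{q+1} beats all others, which are O(t²). -/
theorem exists_J_neg {R : ℝ} (hR : 0 < R) {u : H10 Ω} (hA : 0 < powerInt a (q + 1) u) :
    ∃ t : ℝ, ‖grad (t • u)‖ ≤ R ∧ J φ p q a b lam (t • u) < 0 := by
  have hq : 0 < q + 1 := by linarith [T.q_pos]
  have hp : 0 < p + 1 := by linarith [T.p_gt]
  set A := powerInt a (q + 1) u
  set B := powerInt b (p + 1) u
  set C := ρ₁ / 2 * (‖fn u‖ ^ 2 + ‖grad u‖ ^ 2) + 1 / (p + 1) * |B|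
  have hlA : 0 < lam / (q + 1) * A := mul_pos (div_pos T.lam_pos hq) hA
  have h1 : Tendsto (fun t : ℝ => C * t ^ (1 - q)) (𝓝[>] 0) (𝓝 0) := by
    have h : ContinuousAt (fun t : ℝ => C * t ^ (1 - q)) 0 :=
      continuousAt_const.mul (Real.continuousAt_rpow_const _ _ (Or.inr (by linarith [T.q_lt])))
    have h' := h.tendsto.mono_left (nhdsWithin_le_nhds (s := Ioi 0))
    rwa [Real.zero_rpow (by linarith [T.q_lt]), mul_zero] at h'
  have h2 : Tendsto (fun t : ℝ => t * ‖grad u‖) (𝓝[>] 0) (𝓝 0) := by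
    have h : Continuous fun t : ℝ => t * ‖grad u‖ := by fun_prop
    simpa using (h.tendsto 0).mono_left (nhdsWithin_le_nhds (s := Ioi 0))
  have h3 : ∀ᶠ t : ℝ in 𝓝[>] 0, t < 1 := nhdsWithin_le_nhds (Iio_mem_nhds one_pos)
  obtain ⟨t, ht1, ht2, ht3, ht0⟩ := ((h1.eventually_lt_const hlA).and
    ((h2.eventually_lt_const hR).and (h3.and self_mem_nhdsWithin))).exists
  replace ht0 : 0 < t := ht0
  refine ⟨t, by rw [norm_grad_smul ht0.le]; exact ht2.le, ?_⟩
  have hE := T.energy_le (t • u)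
  rw [norm_fn_smul ht0.le, norm_grad_smul ht0.le] at hE
  rw [J_eq, powerInt_smul _ _ ht0.le, powerInt_smul _ _ ht0.le]
  have e : t ^ 2 = t ^ (q + 1) * t ^ (1 - q) := by
    rw [← Real.rpow_natCast, ← Real.rpow_add ht0]
    congr 1
    push_cast
    ring
  have h4 : t ^ (p + 1) ≤ t ^ 2 := by
    rw [← Real.rpow_natCast]
    exact Real.rpow_le_rpow_of_exponent_ge ht0 ht3.le (by push_cast; linarith [T.p_gt])
  have h5 : -(1 / (p + 1) * (t ^ (p + 1) * B)) ≤ t ^ 2 * (1 / (p + 1) * |B|) :=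
    calc -(1 / (p + 1) * (t ^ (p + 1) * B)) = 1 / (p + 1) * (t ^ (p + 1) * -B) := by ring
      _ ≤ 1 / (p + 1) * (t ^ 2 * |B|) :=
          mul_le_mul_of_nonneg_left
            ((mul_le_mul_of_nonneg_left (neg_le_abs B) (Real.rpow_nonneg ht0.le _)).trans
              (mul_le_mul_of_nonneg_right h4 (abs_nonneg B))) (one_div_pos.2 hp).le
      _ = _ := by ring
  have h6 : t ^ (q + 1) * (C * t ^ (1 - q) - lam / (q + 1) * A) < 0 :=
    mul_neg_of_pos_of_neg (Real.rpow_pos_of_pos ht0 _) (by linarith)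
  have e2 : t ^ (q + 1) * (C * t ^ (1 - q) - lam / (q + 1) * A) =
      t ^ 2 * C - t ^ (q + 1) * (lam / (q + 1) * A) := by rw [e]; ring
  rw [e2] at h6
  have e3 : t ^ 2 * C = ρ₁ / 2 * ((t * ‖fn u‖) ^ 2 + (t * ‖grad u‖) ^ 2) +
      t ^ 2 * (1 / (p + 1) * |B|) := by
    change t ^ 2 * (_ + _) = _
    ring
  linarith

theorem fn_ne_zero_of_J_neg {u : H10 Ω} (h : J φ p q a b lam u < 0) : fn u ≠ 0 := fun h0 => by
  rw [J_eq, powerInt_of_fn_eq_zero (by linarith [T.q_pos]) h0,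
    powerInt_of_fn_eq_zero (by linarith [T.p_gt]) h0] at h
  have h3 : 0 ≤ ρ₀ / 2 * (‖fn u‖ ^ 2 + ‖grad u‖ ^ 2) := by
    have := T.pos
    positivity
  linarith [T.le_energy u]

/-- The energy attains a negative minimum on the ball, at an interior point. -/
theorem exists_ball_minimizer {u : H10 Ω} (hA : 0 < powerInt a (q + 1) u) :
    ∃ w : H10 Ω, ‖grad w‖ < barrierRadius Ω b p ρ₀ ∧ J φ p q a b lam w < 0 ∧
      ∀ z : H10 Ω, ‖grad z‖ ≤ barrierRadius Ω b p ρ₀ →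
        J φ p q a b lam w ≤ J φ p q a b lam z := by
  obtain ⟨t, htR, htneg⟩ := T.exists_J_neg T.barrierRadius_pos hA
  have hbdd := T.bddBelow_J_ball (barrierRadius Ω b p ρ₀)
  set s : Set (H10 Ω) := {u : H10 Ω | ‖grad u‖ ≤ barrierRadius Ω b p ρ₀}
  obtain ⟨x, hx, hlim⟩ := exists_seq_tendsto_sInf_image (s := s) (f := J φ p q a b lam)
    ⟨t • u, htR⟩ hbdd
  obtain ⟨σ, hσ, w, hwR, -, hw⟩ := T.exists_limit (lam := lam) x hx
  have hJ := hw 1 zero_le_one _ _ (hlim.comp hσ.tendsto_atTop) fun n => by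
    rw [one_smul]
    exact le_rfl
  rw [one_smul] at hJ
  have hmin : ∀ z ∈ s, J φ p q a b lam w ≤ J φ p q a b lam z := fun z hz =>
    hJ.trans (csInf_le hbdd (mem_image_of_mem _ hz))
  have hneg : J φ p q a b lam w < 0 := (hmin _ htR).trans_lt htneg
  exact ⟨w, lt_of_le_of_ne hwR fun h => lt_asymm hneg (T.J_pos_of_sphere h), hneg, hmin⟩

theorem dJ_eq_zero_of_ball_minimizer {w : H10 Ω} {R : ℝ} (hw : ‖grad w‖ < R)
    (hmin : ∀ z : H10 Ω, ‖grad z‖ ≤ R → J φ p q a b lam w ≤ J φ p q a b lam z) (v : H10 Ω) :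
    IsLocalMin (fun s : ℝ => J φ p q a b lam (w + s • v)) 0 ∧ dJ φ p q a b lam w v = 0 := by
  have hc : Continuous fun s : ℝ => ‖grad w + s • grad v‖ := by fun_prop
  have hev : ∀ᶠ s : ℝ in 𝓝 0, ‖grad w + s • grad v‖ < R :=
    hc.continuousAt.eventually_lt_const (by simpa using hw)
  have hloc : IsLocalMin (fun s : ℝ => J φ p q a b lam (w + s • v)) 0 := by
    filter_upwards [hev] with s hs
    rw [zero_smul, add_zero]
    exact hmin _ hs.le
  have hd := hloc.hasDerivAt_eq_zero (T.hasDerivAt_J (lam := lam) w v 0)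
  rw [zero_smul, add_zero] at hd
  exact ⟨hloc, hd⟩

theorem exists_negative_ground_state {u : H10 Ω} (hA : 0 < powerInt a (q + 1) u) :
    ∃ w : H10 Ω, IsNontrivialWeakSolution φ p q a b lam w ∧ J φ p q a b lam w < 0 ∧
      w ∈ nehariPlus φ p q a b lam Ω ∧
      (∀ z ∈ nehariPlus φ p q a b lam Ω, J φ p q a b lam w ≤ J φ p q a b lam z) ∧
      IsGroundState φ p q a b lam w := by
  obtain ⟨w, hwR, hneg, hmin⟩ := T.exists_ball_minimizer hA
  have hw0 := T.fn_ne_zero_of_J_neg hneg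
  have hsol : IsNontrivialWeakSolution φ p q a b lam w :=
    ⟨hw0, fun v => (T.dJ_eq_zero_of_ball_minimizer hwR hmin v).2⟩
  have hloc : IsLocalMin (fiber φ p q a b lam w) 1 := by
    have h := (T.dJ_eq_zero_of_ball_minimizer hwR hmin w).1
    have ht : Tendsto (fun t : ℝ => t - 1) (𝓝 1) (𝓝 0) := by
      simpa using (continuous_sub_right (1 : ℝ)).tendsto 1
    filter_upwards [ht.eventually h] with t ht
    have e : w + (t - 1) • w = t • w := by module
    rw [e, zero_smul, add_zero] at ht
    rw [fiber, one_smul]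
    exact ht
  have hplus : ∀ z ∈ nehariPlus φ p q a b lam Ω, J φ p q a b lam w ≤ J φ p q a b lam z :=
    fun z hz => hmin z (T.grad_lt_of_nehariPlus hz).le
  refine ⟨w, hsol, hneg, T.mem_nehariPlus_of_isLocalMin hw0 hloc, hplus, hsol, fun z hz => ?_⟩
  have hzn : z ∈ nehari φ p q a b lam Ω := ⟨hz.1, hz.2 z⟩
  rcases (T.iteratedDeriv_two_ne_zero hzn).lt_or_gt with h | h
  · exact (hneg.trans (T.nehariMinus_maximal ⟨hzn, h⟩).1).le
  · exact hplus z ⟨hzn, h⟩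

/-- Keeps ∫ b|w|^{p+1} positive for a weak limit w of a sequence in N⁻, so that the ray through w
still meets N⁻. -/
theorem exists_powerInt_lower_bound : ∃ c : ℝ, 0 < c ∧
    ∀ u ∈ nehariMinus φ p q a b lam Ω, c ≤ powerInt b (p + 1) u := by
  have hp1 : 0 < p - 1 := by linarith [T.p_gt]
  have hpq := T.p_sub_q_pos
  have hd : 0 < ρ₃ / ((p - q) * weightConst Ω b (p + 1)) :=
    div_pos T.rho3_pos (mul_pos hpq T.weightConst_b_pos)
  set d := ρ₃ / ((p - q) * weightConst Ω b (p + 1))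
  have hg := Real.rpow_pos_of_pos hd (1 / (p - 1))
  refine ⟨ρ₃ * (d ^ (1 / (p - 1))) ^ 2 / (p - q), by have := T.rho3_pos; positivity,
    fun u hu => ?_⟩
  have h1 := T.rho3_le_of_nehariMinus hu
  have h2 : d ^ (1 / (p - 1)) ≤ ‖grad u‖ := by
    have h := Real.rpow_le_rpow hd.le (T.lower_grad hu.1.1 h1) (one_div_pos.2 hp1).le
    rwa [← Real.rpow_mul (norm_nonneg _), mul_one_div_cancel hp1.ne', Real.rpow_one] at h
  rw [div_le_iff₀ hpq]
  have h3 : ρ₃ * (d ^ (1 / (p - 1))) ^ 2 ≤ ρ₃ * ‖grad u‖ ^ 2 :=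
    mul_le_mul_of_nonneg_left (pow_le_pow_left₀ hg.le h2 2) T.rho3_pos.le
  linarith

theorem exists_nehariMinus_minimizer {u : H10 Ω} (hB : 0 < powerInt b (p + 1) u) :
    ∃ w ∈ nehariMinus φ p q a b lam Ω, ∀ z ∈ nehariMinus φ p q a b lam Ω,
      J φ p q a b lam w ≤ J φ p q a b lam z := by
  obtain ⟨t₀, -, ht₀, -⟩ := T.exists_max_ray hB
  have hbdd : BddBelow (J φ p q a b lam '' nehariMinus φ p q a b lam Ω) := by
    refine ⟨0, ?_⟩
    rintro _ ⟨z, hz, rfl⟩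
    exact (T.nehariMinus_maximal hz).1.le
  obtain ⟨x, hx, hlim⟩ := exists_seq_tendsto_sInf_image ⟨_, ht₀⟩ hbdd
  obtain ⟨C, hC⟩ := hlim.bddAbove_range
  obtain ⟨M, hM⟩ := T.exists_bound_of_nehari C
  obtain ⟨σ, hσ, w, -, hBw, hw⟩ := T.exists_limit (lam := lam) x
    fun n => hM _ (hx n).1.2 (hC (mem_range_self n))
  obtain ⟨c, hc, hcB⟩ := T.exists_powerInt_lower_bound
  obtain ⟨t, ht, htw, -⟩ := T.exists_max_ray
    (hc.trans_le (ge_of_tendsto' hBw fun n => hcB _ (hx (σ n))))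
  refine ⟨t • w, htw, fun z hz => ?_⟩
  -- Each u_n maximizes J on its own ray, so J(tu_n) ≤ J(u_n), and lower semicontinuity at this t
  -- bounds J(tw) by the infimum. Neither strong convergence nor w in N⁻ is needed.
  exact (hw t ht.le _ _ (hlim.comp hσ.tendsto_atTop) fun n =>
    (T.nehariMinus_maximal (hx (σ n))).2 t ht.le).trans (csInf_le hbdd (mem_image_of_mem _ hz))

/-- Equality would give a second maximum on the ray, hence a second point of N⁻ there. -/
theorem J_smul_lt_of_nehariMinus {u : H10 Ω} (hu : u ∈ nehariMinus φ p q a b lam Ω) {t : ℝ}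
    (ht : 0 < t) (ht1 : t ≠ 1) : J φ p q a b lam (t • u) < J φ p q a b lam u := by
  obtain ⟨-, hmax⟩ := T.nehariMinus_maximal hu
  refine lt_of_le_of_ne (hmax t ht.le) fun h => ht1 ?_
  refine T.eq_one_of_smul_mem_nehariMinus hu ht (T.mem_nehariMinus_of_isLocalMax hu.1.1 ht ?_)
  filter_upwards [Ioi_mem_nhds ht] with s hs
  exact (hmax s (le_of_lt hs)).trans h.ge

theorem continuous_J_smul_add (u v : H10 Ω) (t : ℝ) :
    Continuous fun s : ℝ => J φ p q a b lam (t • (u + s • v)) := by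
  have h : Continuous fun s : ℝ => J φ p q a b lam (t • u + s • v) :=
    continuous_iff_continuousAt.2 fun s => (T.hasDerivAt_J _ _ s).continuousAt
  have e : (fun s : ℝ => J φ p q a b lam (t • (u + s • v))) =
      fun s : ℝ => J φ p q a b lam (t • u + (t * s) • v) := by
    funext s
    rw [smul_add, smul_smul]
  rw [e]
  exact h.comp (continuous_const.mul continuous_id)

/-- Takes the place of the implicit function theorem. The values at (1 ± η)u lie strictly below
J(u); this persists for u + sv with small s, so the maximum over [1 − η, 1 + η] is interior and lies
in N⁻. -/
theorem eventually_exists_smul_mem_nehariMinus {u : H10 Ω}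
    (hu : u ∈ nehariMinus φ p q a b lam Ω) (v : H10 Ω) {η : ℝ} (hη : 0 < η) (hη1 : η < 1) :
    ∀ᶠ s : ℝ in 𝓝 0, ∃ t ∈ Ioo (1 - η) (1 + η),
      t • (u + s • v) ∈ nehariMinus φ p q a b lam Ω := by
  have hJ : Continuous fun s : ℝ => J φ p q a b lam (u + s • v) := by
    simpa only [one_smul] using T.continuous_J_smul_add u v 1
  have hend : ∀ t : ℝ, 0 < t → t ≠ 1 → ∀ᶠ s : ℝ in 𝓝 0,
      J φ p q a b lam (t • (u + s • v)) < J φ p q a b lam (u + s • v) := fun t ht ht1 =>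
    (T.continuous_J_smul_add u v t).continuousAt.eventually_lt hJ.continuousAt
      (by simpa only [zero_smul, add_zero] using T.J_smul_lt_of_nehariMinus hu ht ht1)
  have hfn : ∀ᶠ s : ℝ in 𝓝 0, fn (u + s • v) ≠ 0 := by
    have h : Continuous fun s : ℝ => fn u + s • fn v := by fun_prop
    exact h.continuousAt.eventually_ne (by simpa only [zero_smul, add_zero] using hu.1.1)
  filter_upwards [hend (1 - η) (by linarith) (by linarith),
    hend (1 + η) (by linarith) (by linarith), hfn] with s hs1 hs2 hs3
  generalize u + s • v = w at hs1 hs2 hs3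
  obtain ⟨t, ht, htmax⟩ := (isCompact_Icc (a := 1 - η) (b := 1 + η)).exists_isMaxOn
    ⟨1, by linarith, by linarith⟩ (T.continuous_J_ray (lam := lam) w).continuousOn
  have h1 : J φ p q a b lam ((1 : ℝ) • w) ≤ J φ p q a b lam (t • w) :=
    htmax (⟨by linarith, by linarith⟩ : (1 : ℝ) ∈ Icc (1 - η) (1 + η))
  rw [one_smul] at h1
  have htl : 1 - η < t := lt_of_le_of_ne ht.1 fun h => by
    rw [h] at hs1
    exact hs1.not_ge h1
  have htr : t < 1 + η := lt_of_le_of_ne ht.2 fun h => by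
    rw [← h] at hs2
    exact hs2.not_ge h1
  exact ⟨t, ⟨htl, htr⟩, T.mem_nehariMinus_of_isLocalMax hs3 (by linarith)
    (htmax.isLocalMax (Icc_mem_nhds htl htr))⟩

theorem J_add_smul_lt {u v : H10 Ω} {s : ℝ} (hs : 0 < s)
    (h : ∀ τ, 0 < τ → τ < s → dJ φ p q a b lam (u + τ • v) v < 0) :
    J φ p q a b lam (u + s • v) < J φ p q a b lam u := by
  have hanti : StrictAntiOn (fun τ : ℝ => J φ p q a b lam (u + τ • v)) (Icc 0 s) := by
    refine strictAntiOn_of_deriv_neg (convex_Icc _ _)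
      (fun τ _ => (T.hasDerivAt_J _ _ τ).continuousAt.continuousWithinAt) fun τ hτ => ?_
    rw [interior_Icc] at hτ
    rw [(T.hasDerivAt_J (lam := lam) u v τ).deriv]
    exact h τ hτ.1 hτ.2
  have h2 := hanti (left_mem_Icc.2 hs.le) (right_mem_Icc.2 hs.le) hs
  simpa only [zero_smul, add_zero] using h2

theorem exists_dJ_neg_near {u v : H10 Ω} (h : dJ φ p q a b lam u v < 0) :
    ∃ ε, 0 < ε ∧ ∀ t s : ℝ, |t - 1| < ε → |s| < ε → dJ φ p q a b lam (t • u + s • v) v < 0 := by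
  have hc := T.continuousAt_dJ (lam := lam) u v
  obtain ⟨ε, hε, hball⟩ := Metric.eventually_nhds_iff.1
    (hc.eventually_lt_const (u := 0) (by simpa only [one_smul, zero_smul, add_zero] using h))
  refine ⟨ε, hε, fun t s ht hs => hball (y := (t, s)) ?_⟩
  rw [Prod.dist_eq, max_lt_iff, Real.dist_eq, Real.dist_eq, sub_zero]
  exact ⟨ht, hs⟩

theorem dJ_nonneg_of_nehariMinus_minimizer {u : H10 Ω} (hu : u ∈ nehariMinus φ p q a b lam Ω)
    (hmin : ∀ z ∈ nehariMinus φ p q a b lam Ω, J φ p q a b lam u ≤ J φ p q a b lam z)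
    (v : H10 Ω) : 0 ≤ dJ φ p q a b lam u v := by
  by_contra! hneg
  obtain ⟨ε, hε, hdec⟩ := T.exists_dJ_neg_near hneg
  obtain ⟨η, hη, hη'⟩ := exists_between (lt_min hε one_pos)
  have hηε := hη'.trans_le (min_le_left _ _)
  have hη1 := hη'.trans_le (min_le_right _ _)
  -- As t < 1 + η < 2, this keeps the displacement ts below ε.
  have hsm : ∀ᶠ s : ℝ in 𝓝 0, s < ε / 2 := Iio_mem_nhds (by positivity)
  obtain ⟨s, ⟨⟨t, ht, hmem⟩, hs⟩, hs0⟩ := ((((T.eventually_exists_smul_mem_nehariMinus hu v hη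
    hη1).and hsm).filter_mono (nhdsWithin_le_nhds (s := Ioi (0 : ℝ)))).and
    self_mem_nhdsWithin).exists
  replace hs0 : 0 < s := hs0
  have ht0 : 0 < t := by linarith [ht.1]
  have htsε : t * s < ε := by nlinarith [ht.2]
  have h3 := hmin _ hmem
  rw [smul_add, smul_smul] at h3
  have h2 := T.J_add_smul_lt (u := t • u) (v := v) (mul_pos ht0 hs0) fun τ hτ0 hτ =>
    hdec t τ (abs_lt.2 ⟨by linarith [ht.1], by linarith [ht.2]⟩)
      (abs_lt.2 ⟨by linarith, by linarith⟩)
  exact (h3.trans_lt h2).not_ge ((T.nehariMinus_maximal hu).2 t ht0.le)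

theorem exists_positive_solution {u : H10 Ω} (hB : 0 < powerInt b (p + 1) u) :
    ∃ w : H10 Ω, IsNontrivialWeakSolution φ p q a b lam w ∧ 0 < J φ p q a b lam w ∧
      w ∈ nehariMinus φ p q a b lam Ω ∧
      ∀ z ∈ nehariMinus φ p q a b lam Ω, J φ p q a b lam w ≤ J φ p q a b lam z := by
  obtain ⟨w, hw, hmin⟩ := T.exists_nehariMinus_minimizer hB
  refine ⟨w, ⟨hw.1.1, fun v => le_antisymm ?_ (T.dJ_nonneg_of_nehariMinus_minimizer hw hmin v)⟩,
    (T.nehariMinus_maximal hw).1, hw, hmin⟩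
  -- The reverse inequality comes from the direction −v; oddness of `dJ` in its second slot follows
  -- from uniqueness of the derivative of J along the line.
  have h1 := T.dJ_nonneg_of_nehariMinus_minimizer hw hmin ((-1 : ℝ) • v)
  have h2 : dJ φ p q a b lam w ((-1 : ℝ) • v) = -dJ φ p q a b lam w v := by
    have h3 := T.hasDerivAt_J (lam := lam) w ((-1 : ℝ) • v) 0
    have h4 := T.hasDerivAt_J (lam := lam) w v (-0)
    have h5 := h4.scomp (0 : ℝ) (hasDerivAt_neg (0 : ℝ))
    have e : (fun s : ℝ => J φ p q a b lam (w + s • v)) ∘ Neg.neg =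
        fun s : ℝ => J φ p q a b lam (w + s • (-1 : ℝ) • v) := by
      funext s
      simp [smul_smul]
    rw [e] at h5
    have := h3.unique h5
    simpa using this
  linarith

end Threshold

end Minimizers

/-- The extension of a function on `[0, ∞)` to the line which is constant on `(-∞, 0]`. -/
noncomputable def constExtend (φ : ℝ → ℝ) (s : ℝ) : ℝ := φ (max s 0)

/-! ### Every object depends only on φ on [0, ∞), since the density is nonnegative. -/

section Extension

variable {φ : ℝ → ℝ}

theorem constExtend_of_nonneg {s : ℝ} (hs : 0 ≤ s) : constExtend φ s = φ s := by
  rw [constExtend, max_eq_left hs]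

theorem eqOn_constExtend : EqOn (constExtend φ) φ (Ici 0) := fun _ hs => constExtend_of_nonneg hs

theorem continuous_constExtend (h : ContinuousOn φ (Ici 0)) : Continuous (constExtend φ) :=
  h.comp_continuous (by fun_prop) fun s => mem_Ici.2 (le_max_right s 0)

theorem primitive_constExtend {s : ℝ} (hs : 0 ≤ s) :
    primitive (constExtend φ) s = primitive φ s := by
  refine intervalIntegral.integral_congr fun τ hτ => ?_
  rw [uIcc_of_le hs] at hτ
  exact constExtend_of_nonneg hτ.1

theorem dphi_constExtend {s : ℝ} (hs : 0 ≤ s) : dphi (constExtend φ) s = dphi φ s :=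
  derivWithin_congr eqOn_constExtend (constExtend_of_nonneg hs)

theorem ddphi_constExtend {s : ℝ} (hs : 0 ≤ s) : ddphi (constExtend φ) s = ddphi φ s :=
  iteratedDerivWithin_congr eqOn_constExtend hs

variable {N : ℕ} {Ω : Set (Eucl N)} {p q : ℝ} {a b : Eucl N → ℝ} {lam : ℝ}

theorem J_constExtend :
    J (Ω := Ω) (constExtend φ) p q a b lam = J φ p q a b lam := by
  funext u
  have h : energy (constExtend φ) u = energy φ u :=
    integral_congr_ae (Eventually.of_forall fun x => primitive_constExtend (dens_nonneg u x))
  rw [J_eq, J_eq, h]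

theorem dJ_constExtend :
    dJ (Ω := Ω) (constExtend φ) p q a b lam = dJ φ p q a b lam := by
  funext u v
  have h : ∀ x, constExtend φ (dens u x) = φ (dens u x) := fun x =>
    constExtend_of_nonneg (dens_nonneg u x)
  simp only [dJ, h]

theorem nehari_constExtend :
    nehari (constExtend φ) p q a b lam Ω = nehari φ p q a b lam Ω := by
  simp only [nehari, dJ_constExtend]

theorem fiber_constExtend :
    fiber (Ω := Ω) (constExtend φ) p q a b lam = fiber φ p q a b lam := by
  funext u t
  rw [fiber, fiber, J_constExtend]

theorem nehariPlus_constExtend :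
    nehariPlus (constExtend φ) p q a b lam Ω = nehariPlus φ p q a b lam Ω := by
  simp only [nehariPlus, nehari_constExtend, fiber_constExtend]

theorem nehariMinus_constExtend :
    nehariMinus (constExtend φ) p q a b lam Ω = nehariMinus φ p q a b lam Ω := by
  simp only [nehariMinus, nehari_constExtend, fiber_constExtend]

theorem isNontrivialWeakSolution_constExtend :
    IsNontrivialWeakSolution (Ω := Ω) (constExtend φ) p q a b lam =
      IsNontrivialWeakSolution φ p q a b lam := by
  funext u
  simp only [IsNontrivialWeakSolution, dJ_constExtend]

theorem isGroundState_constExtend :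
    IsGroundState (Ω := Ω) (constExtend φ) p q a b lam = IsGroundState φ p q a b lam := by
  funext u
  simp only [IsGroundState, isNontrivialWeakSolution_constExtend, J_constExtend]

namespace Threshold

variable {ρ₀ ρ₁ ρ₂ ρ₃ ρ₅ : ℝ}

theorem exists_solutions (T : Threshold Ω (constExtend φ) p q a b ρ₀ ρ₁ ρ₂ ρ₃ ρ₅ lam)
    {u v : H10 Ω} (hA : 0 < powerInt a (q + 1) u) (hB : 0 < powerInt b (p + 1) v) :
    ∃ u₀ u₁ : H10 Ω,
      (IsNontrivialWeakSolution φ p q a b lam u₀ ∧ 0 < J φ p q a b lam u₀ ∧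
        u₀ ∈ nehariMinus φ p q a b lam Ω ∧
        ∀ w ∈ nehariMinus φ p q a b lam Ω, J φ p q a b lam u₀ ≤ J φ p q a b lam w) ∧
      (IsNontrivialWeakSolution φ p q a b lam u₁ ∧ J φ p q a b lam u₁ < 0 ∧
        u₁ ∈ nehariPlus φ p q a b lam Ω ∧
        (∀ w ∈ nehariPlus φ p q a b lam Ω, J φ p q a b lam u₁ ≤ J φ p q a b lam w) ∧
        IsGroundState φ p q a b lam u₁) := by
  obtain ⟨u₀, h₀⟩ := T.exists_positive_solution hB
  obtain ⟨u₁, h₁⟩ := T.exists_negative_ground_state hA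
  rw [isNontrivialWeakSolution_constExtend, J_constExtend, nehariMinus_constExtend] at h₀
  rw [isNontrivialWeakSolution_constExtend, J_constExtend, nehariPlus_constExtend,
    isGroundState_constExtend] at h₁
  exact ⟨u₀, u₁, h₀, h₁⟩

end Threshold

end Extension

end Stuart

/-! ### The main theorem. -/

theorem theorem1p1
    (N : ℕ) (hN : 2 < N) (Ω : Set (Eucl N)) (hΩ : IsSmoothBoundedDomain Ω)
    (p q : ℝ) (hq : 1 < q + 1) (hq2 : q + 1 < 2) (hp : 2 < p + 1)
    (hp2 : p + 1 < 2 * (N : ℝ) / ((N : ℝ) - 2))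
    (φ : ℝ → ℝ) (hφ : ContDiffOn ℝ 2 φ (Ici 0))
    (ρ₀ ρ₁ ρ₂ ρ₃ ρ₄ ρ₅ ρ₆ φinf : ℝ)
    (hφ1 : 0 < ρ₀ ∧ ρ₀ ≤ ρ₁ ∧ max ((q + 1) / 2) (2 / (p + 1)) * ρ₁ < ρ₀ ∧
      ∀ s, 0 ≤ s → ρ₀ ≤ φ s ∧ φ s ≤ ρ₁)
    (hφ2 : 0 < ρ₂ ∧ ∀ s, 0 ≤ s → |dphi φ s| * s + |ddphi φ s| * s ^ 2 ≤ ρ₂)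
    (hφ3 : 0 < ρ₃ ∧ ρ₃ ≤ ρ₄ ∧ ∀ s, 0 ≤ s →
      ρ₃ ≤ (1 - q) * φ s + 2 * dphi φ s * s ∧ (1 - q) * φ s + 2 * dphi φ s * s ≤ ρ₄)
    (hφ4 : 0 < ρ₅ ∧ ∀ s, 0 ≤ s → ρ₅ + 2 * dphi φ s * s ≤ (p - 1) * φ s)
    (hφ5 : 0 < ρ₆ ∧ ∀ s, 0 ≤ s →
      (1 - q) * (1 - p) * φ s + 2 * (4 - p - q) * dphi φ s * s + 4 * ddphi φ s * s ^ 2 ≤ -ρ₆)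
    (hφ6 : StrictConvexOn ℝ (Ici 0) (fun t : ℝ => primitive φ (t ^ 2)))
    (hφ7 : 0 < φinf ∧ Tendsto φ atTop (𝓝 φinf))
    (a b : Eucl N → ℝ) (ha : ContinuousOn a Ω) (hb : ContinuousOn b Ω)
    (ha_sign : SignChanging Ω a) (hb_sign : SignChanging Ω b)
    (ha_bdd : MemLp a ⊤ (vol Ω)) (hb_bdd : MemLp b ⊤ (vol Ω))
    (lam : ℝ) (hlam : 0 < lam)
    (hlam2 : lam < min (lambda1 Ω p q a b ρ₃ ρ₅) (lambda2 Ω p q a b ρ₀ ρ₁)) :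
    ∃ u₀ u₁ : H10 Ω,
      (IsNontrivialWeakSolution φ p q a b lam u₀ ∧ 0 < J φ p q a b lam u₀ ∧
        u₀ ∈ nehariMinus φ p q a b lam Ω ∧
        ∀ w ∈ nehariMinus φ p q a b lam Ω, J φ p q a b lam u₀ ≤ J φ p q a b lam w) ∧
      (IsNontrivialWeakSolution φ p q a b lam u₁ ∧ J φ p q a b lam u₁ < 0 ∧
        u₁ ∈ nehariPlus φ p q a b lam Ω ∧
        (∀ w ∈ nehariPlus φ p q a b lam Ω, J φ p q a b lam u₁ ≤ J φ p q a b lam w) ∧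
        IsGroundState φ p q a b lam u₁) := by
  obtain ⟨hρ₀, -, hmax, hbd⟩ := hφ1
  obtain ⟨hρ₃, -, hφ3⟩ := hφ3
  have hρ₁ : 0 < ρ₁ := hρ₀.trans_le ((hbd 0 le_rfl).1.trans (hbd 0 le_rfl).2)
  have T : Threshold Ω (constExtend φ) p q a b ρ₀ ρ₁ ρ₂ ρ₃ ρ₅ lam :=
    { dim := hN
      bounded := hΩ.isBounded
      q_pos := by linarith
      q_lt := by linarith
      p_gt := by linarith
      p_lt := hp2
      a_bdd := ha_bdd
      b_bdd := hb_bdd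
      cont := continuous_constExtend hφ.continuousOn
      contDiff := hφ.congr eqOn_constExtend
      pos := hρ₀
      lower := fun s => (hbd _ (le_max_right s 0)).1
      upper := fun s => (hbd _ (le_max_right s 0)).2
      dphi_le := fun s hs => by
        rw [dphi_constExtend hs]
        linarith [hφ2.2 s hs, mul_nonneg (abs_nonneg (ddphi φ s)) (sq_nonneg s)]
      concave := fun s hs => by
        rw [dphi_constExtend hs, ddphi_constExtend hs, constExtend_of_nonneg hs]
        linarith [hφ5.2 s hs]
      convex := hφ6.convexOn.congr fun t _ => (primitive_constExtend (sq_nonneg t)).symm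
      gap := (mul_le_mul_of_nonneg_right (le_max_right _ _) hρ₁.le).trans_lt hmax
      rho3_pos := hρ₃
      rho3_le := fun s hs => by
        rw [dphi_constExtend hs, constExtend_of_nonneg hs]
        exact (hφ3 s hs).1
      rho5_pos := hφ4.1
      rho5_le := fun s hs => by
        rw [dphi_constExtend hs, constExtend_of_nonneg hs]
        exact hφ4.2 s hs
      lam_pos := hlam
      lam_lt_one := hlam2.trans_le (min_le_left _ _)
      lam_lt_two := hlam2.trans_le (min_le_right _ _) }
  -- Positivity of a at a point supplies a ray on which J becomes negative near 0; positivity of b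
  -- at a point supplies a ray meeting N⁻.
  obtain ⟨x, hx, hxa⟩ := ha_sign.1
  obtain ⟨y, hy, hyb⟩ := hb_sign.1
  obtain ⟨ua, hua⟩ := exists_powerInt_pos hΩ.isOpen ha ha_bdd hx hxa (r := q + 1) (by linarith)
  obtain ⟨ub, hub⟩ := exists_powerInt_pos hΩ.isOpen hb hb_bdd hy hyb (r := p + 1) (by linarith)
  exact T.exists_solutions hua hub
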